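/- Let $\alpha,\beta>-1$, let $\sigma\in\{-\tfrac12,\tfrac12\}$, and on $[-1,1]^2$ let $$\mathcal W(x,y)=\mathcal W_{\alpha,\beta,\sigma}(x,y)=|x-y|^{2\alpha+1}|x+y|^{2\beta+1}(1-x^2)^{\sigma}(1-y^2)^{\sigma}.$$ A cubature rule of degree $s$ for $\mathcal W$ with $N$ nodes consists of $N$ distinct points $(x_k,y_k)\in\mathbb R^2$ and nonzero real weights $\lambda_k$ such that $\int_{[-1,1]^2} f\,\mathcal W\,dx\,dy=\sum_{k=1}^N\lambda_k f(x_k,y_k)$ for all real polynomials $f$ of total degree at most $s$, but not for all polynomials of degree at most $s+1$. It is minimal if no cubature rule of degree $s$ for $\mathcal W$ has fewer nodes. Let $N_{\min}(n)=\frac{n(n+1)}2+\lfloor\frac n2\rfloor$. Let $p_k^{(a,b)}$ be the Jacobi polynomials with positive leading coefficients, orthonormal for the weight $(1-t)^a(1+t)^b$ on $[-1,1]$ normalized to have integral $1$. With $u=\xi+\eta$, $v=\xi\eta$, let $P_{k,m}^{a,b,\sigma}(u,v)$, $0\le k\le m$, be the polynomial in $u,v$ given by $$P_{k,m}^{a,b,-\frac12}=p_m^{(a,b)}(\xi)p_k^{(a,b)}(\eta)+p_m^{(a,b)}(\eta)p_k^{(a,b)}(\xi)\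 \ (k<m),\qquad P_{m,m}^{a,b,-\frac12}=\sqrt2\,p_m^{(a,b)}(\xi)p_m^{(a,b)}(\eta),$$ $$P_{k,m}^{a,b,\frac12}=\frac{p_{m+1}^{(a,b)}(\xi)p_k^{(a,b)}(\eta)-p_{m+1}^{(a,b)}(\eta)p_k^{(a,b)}(\xi)}{\xi-\eta}.$$ Let $b_{a,b,\sigma}=\big(2^{2\sigma}\int_{[-1,1]^2}\mathcal W_{a,b,\sigma}\,dx\,dy\big)^{-1}$ and, for $m\ge 0$ and $0\le k\le m$, $${}_2Q_{k,2m+1}(x,y)=\sqrt{b_{\alpha+1,\beta,\sigma}/b_{\alpha,\beta,\sigma}}\;(x-y)\,P_{k,m}^{\alpha+1,\beta,\sigma}(2xy,\,x^2+y^2-1).$$ Let $q_m$ be the polynomial which for $x=\cos\theta$, $y=\cos\phi$, $\xi=\cos(\theta-\phi)$, $\eta=\cos(\theta+\phi)$ is $$q_m(x,y)=(x+y)\left[p_m^{(\alpha,\beta+1)}(\xi)\,p_m^{(\alpha+1,\beta)}(\eta)+p_m^{(\alpha,\beta+1)}(\eta)\,p_m^{(\alpha+1,\beta)}(\xi)\right]\qquad(\sigma=-\tfrac12),$$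 $$q_m(x,y)=(x+y)\,\frac{p_{m+1}^{(\alpha,\beta+1)}(\xi)\,p_{m+1}^{(\alpha+1,\beta)}(\eta)-p_{m+1}^{(\alpha,\beta+1)}(\eta)\,p_{m+1}^{(\alpha+1,\beta)}(\xi)}{\sin\theta\,\sin\phi}\qquad(\sigma=\tfrac12).$$ Theorem. Let $n=2m+1$, $m\ge0$. The $m+2$ polynomials $q_m,{}_2Q_{0,2m+1},\dots,{}_2Q_{m,2m+1}$ are linearly independent and have degree exactly $n$, and each of them is orthogonal with respect to $\mathcal W$ to all polynomials of degree less than $n$. The set of their real common zeros is the union of (i) the points $\pm(s,t)$, $\pm(t,s)$ with $s=\cos\frac{\theta-\phi}2$, $t=\cos\frac{\theta+\phi}2$, $\theta,\phi\in(0,\pi)$, where, for $\sigma=-\frac12$, $\cos\theta,\cos\phi$ are zeros of $p_m^{(\alpha+1,\beta)}$ and $\theta\le\phi$, and, for $\sigma=\frac12$, they are zeros of $p_{m+1}^{(\alpha+1,\beta)}$ and $\theta<\phi$; and (ii) the points $(\zeta,\zeta)$ with $-1<\zeta<1$ and $q_m(\zeta,\zeta)=0$. It is the set of nodes of a minimal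 cubature rule of degree $2n-1=4m+1$ for $\mathcal W$, and it has exactly $N_{\min}(n)=2(m+1)^2-1$ points. -/

import Mathlib

open MeasureTheory Polynomial

noncomputable section

namespace MinCuba

/-! ### Cubature rules and orthogonal polynomials on the square -/

/-- Real polynomials in two variables. -/
abbrev Poly2 : Type := MvPolynomial (Fin 2) ℝ

/-- The value of a polynomial in two variables at a point of the plane. -/
def evalAt (p : ℝ × ℝ) (f : Poly2) : ℝ := MvPolynomial.eval ![p.1, p.2] f

/-- The square `[-1,1]²`. -/
def square : Set (ℝ × ℝ) := Set.Icc (-1) 1 ×ˢ Set.Icc (-1) 1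

/-- `nodes`, `lam` is a cubature rule of degree `s` for the weight function `W` on `[-1,1]²`:
the weights `lam p`, `p ∈ nodes`, are nonzero real numbers, the rule integrates every polynomial
of degree at most `s` (these being integrable) exactly, and it is not exact on all polynomials of
degree at most `s + 1`. -/
structure IsCubatureRule (W : ℝ × ℝ → ℝ) (s : ℕ) (nodes : Finset (ℝ × ℝ))
    (lam : ℝ × ℝ → ℝ) : Prop where
  weight_ne_zero : ∀ p ∈ nodes, lam p ≠ 0
  integrable : ∀ f : Poly2, f.totalDegree ≤ s →
    IntegrableOn (fun p => evalAt p f * W p) square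
  exact_of_le : ∀ f : Poly2, f.totalDegree ≤ s →
    ∫ p in square, evalAt p f * W p = ∑ p ∈ nodes, lam p * evalAt p f
  not_exact : ∃ f : Poly2, f.totalDegree ≤ s + 1 ∧
    ∫ p in square, evalAt p f * W p ≠ ∑ p ∈ nodes, lam p * evalAt p f

/-- A cubature rule of degree `s` is minimal if no cubature rule of the same degree for the same
weight has fewer nodes. -/
def IsMinimalCubatureRule (W : ℝ × ℝ → ℝ) (s : ℕ) (nodes : Finset (ℝ × ℝ))
    (lam : ℝ × ℝ → ℝ) : Prop :=
  IsCubatureRule W s nodes lam ∧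
    ∀ (nodes' : Finset (ℝ × ℝ)) (lam' : ℝ × ℝ → ℝ),
      IsCubatureRule W s nodes' lam' → nodes.card ≤ nodes'.card

/-- `P` is an orthogonal polynomial of degree `n` with respect to `W` on `[-1,1]²`:
a polynomial of exact degree `n` orthogonal to all polynomials of degree less than `n`. -/
def IsOrthogonalPoly (W : ℝ × ℝ → ℝ) (n : ℕ) (P : Poly2) : Prop :=
  P.totalDegree = n ∧ ∀ Q : Poly2, Q.totalDegree < n →
    IntegrableOn (fun p => evalAt p P * evalAt p Q * W p) square ∧
      ∫ p in square, evalAt p P * evalAt p Q * W p = 0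

/-- The lower bound `n(n+1)/2 + ⌊n/2⌋` for the number of nodes of a cubature rule of degree
`2n-1` for a centrally symmetric weight. -/
def Nmin (n : ℕ) : ℕ := n * (n + 1) / 2 + n / 2

/-! ### The weight functions -/

/-- The two choices of the sign in the exponent `±1/2`. -/
inductive Sgn : Type
  | minus
  | plus

/-- The exponent `-1/2` or `1/2`. -/
def Sgn.half : Sgn → ℝ
  | .minus => -(1 / 2)
  | .plus => 1 / 2

/-- The weight `|x-y|^(2α+1) |x+y|^(2β+1) (1-x²)^(±1/2) (1-y²)^(±1/2)`. -/
def weight (α β : ℝ) (s : Sgn) (p : ℝ × ℝ) : ℝ :=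
  |p.1 - p.2| ^ (2 * α + 1) * |p.1 + p.2| ^ (2 * β + 1) *
    (1 - p.1 ^ 2) ^ s.half * (1 - p.2 ^ 2) ^ s.half

/-- The constant `b` that makes the integral of `b · 2^(±1) · weight` over `[-1,1]²` equal to `1`.
This is also the constant that normalizes `(1-u+v)^α (1+u+v)^β (u²-4v)^(±1/2)` on the region
bounded by the lines `1 ± u + v = 0` and the parabola `u² = 4v`. -/
def normConst (α β : ℝ) (s : Sgn) : ℝ :=
  ((2 : ℝ) ^ (2 * s.half) * ∫ p in square, weight α β s p)⁻¹

/-! ### Orthonormal Jacobi polynomials -/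

/-- The Jacobi weight `(1-t)^α (1+t)^β`. -/
def jacobiWeight (α β t : ℝ) : ℝ := (1 - t) ^ α * (1 + t) ^ β

/-- The inner product on `ℝ[X]` for the Jacobi weight normalized to have integral `1`. -/
def jacobiInner (α β : ℝ) (f g : ℝ[X]) : ℝ :=
  (∫ t in (-1 : ℝ)..1, f.eval t * g.eval t * jacobiWeight α β t) /
    ∫ t in (-1 : ℝ)..1, jacobiWeight α β t

/-- The monic Jacobi polynomials, by the Gram-Schmidt process applied to `1, t, t², …`. -/
def monicJacobi (α β : ℝ) (n : ℕ) : ℝ[X] :=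
  X ^ n - ∑ k : Fin n,
    C (jacobiInner α β (X ^ n) (monicJacobi α β k) /
      jacobiInner α β (monicJacobi α β k) (monicJacobi α β k)) * monicJacobi α β k
termination_by n
decreasing_by exact k.2

/-- The orthonormal Jacobi polynomials `p_n^{(α,β)}` (with positive leading coefficient) for the
normalized Jacobi weight. -/
def jacobi (α β : ℝ) (n : ℕ) : ℝ[X] :=
  C (Real.sqrt (jacobiInner α β (monicJacobi α β n) (monicJacobi α β n)))⁻¹ * monicJacobi α β n

/-! ### Symmetric polynomials written in `u = x + y`, `v = x y`

Polynomials in `u, v` are elements of `Poly2`, the variables `0`, `1` being `u`, `v`. -/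

/-- `x^k + y^k` as a polynomial in `u = x + y` and `v = x y`. -/
def powSum : ℕ → Poly2
  | 0 => 2
  | 1 => MvPolynomial.X 0
  | k + 2 => MvPolynomial.X 0 * powSum (k + 1) - MvPolynomial.X 1 * powSum k

/-- `(x^k - y^k)/(x - y)` as a polynomial in `u = x + y` and `v = x y`. -/
def powDiff : ℕ → Poly2
  | 0 => 0
  | 1 => 1
  | k + 2 => MvPolynomial.X 0 * powDiff (k + 1) - MvPolynomial.X 1 * powDiff k

/-- `x^i y^j + y^i x^j` as a polynomial in `u = x + y` and `v = x y`. -/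
def symMono (i j : ℕ) : Poly2 :=
  if j ≤ i then MvPolynomial.X 1 ^ j * powSum (i - j) else MvPolynomial.X 1 ^ i * powSum (j - i)

/-- `(x^i y^j - y^i x^j)/(x - y)` as a polynomial in `u = x + y` and `v = x y`. -/
def altMono (i j : ℕ) : Poly2 :=
  if j ≤ i then MvPolynomial.X 1 ^ j * powDiff (i - j)
  else -(MvPolynomial.X 1 ^ i * powDiff (j - i))

/-- `f(x) g(y) + f(y) g(x)` as a polynomial in `u = x + y` and `v = x y`. -/
def symPair (f g : ℝ[X]) : Poly2 :=
  f.sum fun i a => g.sum fun j b => MvPolynomial.C (a * b) * symMono i j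

/-- `(f(x) g(y) - f(y) g(x))/(x - y)` as a polynomial in `u = x + y` and `v = x y`. -/
def altPair (f g : ℝ[X]) : Poly2 :=
  f.sum fun i a => g.sum fun j b => MvPolynomial.C (a * b) * altMono i j

theorem evalAt_powSum (x y : ℝ) : ∀ k, evalAt (x + y, x * y) (powSum k) = x ^ k + y ^ k
  | 0 => by simp [evalAt, powSum]; norm_num
  | 1 => by simp [evalAt, powSum]
  | k + 2 => by
    have h0 := evalAt_powSum x y k
    have h1 := evalAt_powSum x y (k + 1)
    simp only [evalAt] at h0 h1
    simp only [evalAt, powSum, map_sub, map_mul, MvPolynomial.eval_X, h0, h1]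
    simp; ring

theorem evalAt_powDiff (x y : ℝ) :
    ∀ k, evalAt (x + y, x * y) (powDiff k) * (x - y) = x ^ k - y ^ k
  | 0 => by simp [evalAt, powDiff]
  | 1 => by simp [evalAt, powDiff]
  | k + 2 => by
    have h0 := evalAt_powDiff x y k
    have h1 := evalAt_powDiff x y (k + 1)
    simp only [evalAt] at h0 h1
    simp only [evalAt, powDiff, map_sub, map_mul, MvPolynomial.eval_X, sub_mul, mul_assoc, h0, h1]
    simp; ring

theorem evalAt_symMono (x y : ℝ) (i j : ℕ) :
    evalAt (x + y, x * y) (symMono i j) = x ^ i * y ^ j + y ^ i * x ^ j := by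
  unfold symMono
  split_ifs with h
  · obtain ⟨d, rfl⟩ := Nat.exists_eq_add_of_le h
    have := evalAt_powSum x y d
    simp only [evalAt] at this
    simp only [evalAt, map_mul, map_pow, MvPolynomial.eval_X, Nat.add_sub_cancel_left, this]
    simp; ring
  · obtain ⟨d, rfl⟩ := Nat.exists_eq_add_of_le (le_of_not_ge h)
    have := evalAt_powSum x y d
    simp only [evalAt] at this
    simp only [evalAt, map_mul, map_pow, MvPolynomial.eval_X, Nat.add_sub_cancel_left, this]
    simp; ring

theorem evalAt_altMono (x y : ℝ) (i j : ℕ) :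
    evalAt (x + y, x * y) (altMono i j) * (x - y) = x ^ i * y ^ j - y ^ i * x ^ j := by
  unfold altMono
  split_ifs with h
  · obtain ⟨d, rfl⟩ := Nat.exists_eq_add_of_le h
    have := evalAt_powDiff x y d
    simp only [evalAt] at this
    simp only [evalAt, map_mul, map_pow, MvPolynomial.eval_X, Nat.add_sub_cancel_left,
      mul_assoc, this]
    simp; ring
  · obtain ⟨d, rfl⟩ := Nat.exists_eq_add_of_le (le_of_not_ge h)
    have := evalAt_powDiff x y d
    simp only [evalAt] at this
    simp only [evalAt, map_neg, map_mul, map_pow, MvPolynomial.eval_X, Nat.add_sub_cancel_left,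
      neg_mul, mul_assoc, this]
    simp; ring

/-- `symPair f g` is what its description says. -/
theorem evalAt_symPair (f g : ℝ[X]) (x y : ℝ) :
    evalAt (x + y, x * y) (symPair f g) = f.eval x * g.eval y + f.eval y * g.eval x := by
  have h : ∀ i j, MvPolynomial.eval ![x + y, x * y] (symMono i j)
      = x ^ i * y ^ j + y ^ i * x ^ j := evalAt_symMono x y
  simp only [evalAt, symPair, Polynomial.sum, map_sum, map_mul, MvPolynomial.eval_C,
    Polynomial.eval_eq_sum, h, Finset.sum_mul_sum, ← Finset.sum_add_distrib]
  exact Finset.sum_congr rfl fun i _ => Finset.sum_congr rfl fun j _ => by ring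

/-- `altPair f g` is what its description says. -/
theorem evalAt_altPair (f g : ℝ[X]) (x y : ℝ) :
    evalAt (x + y, x * y) (altPair f g) * (x - y)
      = f.eval x * g.eval y - f.eval y * g.eval x := by
  have h : ∀ i j, MvPolynomial.eval ![x + y, x * y] (altMono i j) * (x - y)
      = x ^ i * y ^ j - y ^ i * x ^ j := evalAt_altMono x y
  have e : ∀ a b : ℝ, f.eval a * g.eval b
      = ∑ i ∈ f.support, ∑ j ∈ g.support, f.coeff i * g.coeff j * (a ^ i * b ^ j) := by
    intro a b
    rw [Polynomial.eval_eq_sum, Polynomial.eval_eq_sum, Polynomial.sum, Polynomial.sum,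
      Finset.sum_mul_sum]
    exact Finset.sum_congr rfl fun i _ => Finset.sum_congr rfl fun j _ => by ring
  simp only [e, evalAt, altPair, Polynomial.sum, map_sum, map_mul, MvPolynomial.eval_C,
    Finset.sum_mul, mul_assoc, h, ← Finset.sum_sub_distrib]
  exact Finset.sum_congr rfl fun i _ => Finset.sum_congr rfl fun j _ => by ring

/-! ### The orthogonal polynomials whose common zeros are the nodes -/

/-- The polynomials `P_{k,n}^{α,β,±1/2}(u,v)`: with `u = x + y`, `v = x y`, for the minus sign
`p_n(x) p_k(y) + p_n(y) p_k(x)` if `k < n` and `√2 p_n(x) p_n(y)` if `k = n`, and for the plus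
sign `(p_{n+1}(x) p_k(y) - p_{n+1}(y) p_k(x))/(x - y)`, where `p_k = p_k^{(α,β)}`. -/
def biJacobi (α β : ℝ) (s : Sgn) (k n : ℕ) : Poly2 :=
  match s with
  | .minus =>
    if k = n then MvPolynomial.C (Real.sqrt 2 / 2) * symPair (jacobi α β n) (jacobi α β n)
    else symPair (jacobi α β n) (jacobi α β k)
  | .plus => altPair (jacobi α β (n + 1)) (jacobi α β k)

/-- The substitution `P(u,v) ↦ P(2xy, x² + y² - 1)`. -/
def substUV (P : Poly2) : Poly2 :=
  MvPolynomial.aeval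
    ![2 * MvPolynomial.X 0 * MvPolynomial.X 1,
      MvPolynomial.X 0 ^ 2 + MvPolynomial.X 1 ^ 2 - 1] P

/-- The polynomial `₂Q_{k,2m+1}^{α,β,±1/2}`, that is
`√(b_{α+1,β}/b_{α,β}) (x - y) P_{k,m}^{α+1,β,±1/2}(2xy, x² + y² - 1)`. -/
def Q₂ (α β : ℝ) (s : Sgn) (m k : ℕ) : Poly2 :=
  MvPolynomial.C (Real.sqrt (normConst (α + 1) β s / normConst α β s)) *
    (MvPolynomial.X 0 - MvPolynomial.X 1) * substUV (biJacobi (α + 1) β s k m)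

/-- The additional polynomial `q_m`. With `x = cos θ`, `y = cos φ`, `ξ = cos (θ - φ)`,
`η = cos (θ + φ)` (so `ξ + η = 2xy`, `ξη = x² + y² - 1`, `ξ - η = 2 sin θ sin φ`), it is
`x + y` times `f(ξ) g(η) + f(η) g(ξ)`, `f = p_m^{(α,β+1)}`, `g = p_m^{(α+1,β)}`, for the minus
sign and `x + y` times `(f(ξ) g(η) - f(η) g(ξ))/(sin θ sin φ)`, `f = p_{m+1}^{(α,β+1)}`,
`g = p_{m+1}^{(α+1,β)}`, for the plus sign. -/
def qExtra (α β : ℝ) (s : Sgn) (m : ℕ) : Poly2 :=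
  (MvPolynomial.X 0 + MvPolynomial.X 1) *
    match s with
    | .minus => substUV (symPair (jacobi α (β + 1) m) (jacobi (α + 1) β m))
    | .plus => 2 * substUV (altPair (jacobi α (β + 1) (m + 1)) (jacobi (α + 1) β (m + 1)))

/-- The `m + 2` polynomials `q_m, ₂Q_{0,2m+1}, …, ₂Q_{m,2m+1}`. -/
def generators (α β : ℝ) (s : Sgn) (m : ℕ) : Fin (m + 2) → Poly2 :=
  Fin.cons (qExtra α β s m) fun k : Fin (m + 1) => Q₂ α β s m k

/-- The real common zeros of `q_m, ₂Q_{0,2m+1}, …, ₂Q_{m,2m+1}`. -/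
def commonZeros (α β : ℝ) (s : Sgn) (m : ℕ) : Set (ℝ × ℝ) :=
  {p | ∀ i, evalAt p (generators α β s m i) = 0}

/-- The points `±(s,t)`, `±(t,s)`, `s = cos ((θ-φ)/2)`, `t = cos ((θ+φ)/2)`, where `cos θ`, `cos φ`
are zeros of `p_m^{(α+1,β)}` and `θ ≤ φ` for the minus sign, and zeros of `p_{m+1}^{(α+1,β)}` and
`θ < φ` for the plus sign. -/
def offDiagonalNodes (α β : ℝ) (s : Sgn) (m : ℕ) : Set (ℝ × ℝ) :=
  {p | ∃ θ ∈ Set.Ioo 0 Real.pi, ∃ φ ∈ Set.Ioo 0 Real.pi,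
    (match s with
      | .minus => (jacobi (α + 1) β m).eval (Real.cos θ) = 0 ∧
          (jacobi (α + 1) β m).eval (Real.cos φ) = 0 ∧ θ ≤ φ
      | .plus => (jacobi (α + 1) β (m + 1)).eval (Real.cos θ) = 0 ∧
          (jacobi (α + 1) β (m + 1)).eval (Real.cos φ) = 0 ∧ θ < φ) ∧
    (p = (Real.cos ((θ - φ) / 2), Real.cos ((θ + φ) / 2)) ∨
      p = (Real.cos ((θ + φ) / 2), Real.cos ((θ - φ) / 2)) ∨
      p = (-Real.cos ((θ - φ) / 2), -Real.cos ((θ + φ) / 2)) ∨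
      p = (-Real.cos ((θ + φ) / 2), -Real.cos ((θ - φ) / 2)))}

/-- The points `(ξ,ξ)`, `-1 < ξ < 1`, with `q_m(ξ,ξ) = 0`. -/
def diagonalNodes (α β : ℝ) (s : Sgn) (m : ℕ) : Set (ℝ × ℝ) :=
  {p | ∃ ξ ∈ Set.Ioo (-1 : ℝ) 1, p = (ξ, ξ) ∧ evalAt p (qExtra α β s m) = 0}

end MinCuba

end

/-!
Throughout, `u = 2xy` and `v = x² + y² - 1`, so that `1 + u + v = (x + y)²` and
`1 - u + v = (x - y)²`, and `u = ξ + η`, `v = ξη` for `ξ = cos (θ - φ)`, `η = cos (θ + φ)` if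
`x = cos θ`, `y = cos φ`. The map `(θ, φ) ↦ (θ - φ, θ + φ)` preserves the measure of the torus
(`map_pointUV_arcsine`), which turns the integral of a polynomial in `u, v` against the weight into
an integral over `ξ, η` against a product of two Jacobi weights, times `((ξ - η)/2)²` for the plus
sign (`integral_pointUV_mul_weight`). The products `(x + y)^i (x - y)^j` with `i + j < d` span the
polynomials of degree less than `d`. Tested against one of them, a generator gives zero, either by
the symmetries of the weight or, after this change of variables, because every term has a factor
`∫ p_N q w = 0` with `deg q < N` (`weightInt_generators_mul`).

The leading forms of the `₂Q_{k,2m+1}` span the forms `(x + y)^i (x - y)^j`, `i + j = 2m + 1`, `j`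
odd, and the leading form of `q_m` contains `(x + y)^(2m+1)`. Hence, with control of the degrees,
every polynomial is congruent modulo the generators to an element of an explicit space of dimension
at most `N = 2(m+1)² - 1` (`degLT_le_compl_sup_idealLE`). As polynomials separate points, there are
at most `N` common zeros. The points in (i) and (ii) are common zeros, and there are at least `N`
of them: this needs `m` zeros in `(-1,1)` of the restriction of `q_m` to the diagonal
(`le_card_oddRoots_diagExtra`), which follow from orthogonality with respect to the parameters
`(α+1, β+1)` or `(α+2, β+1)`, together with the signs at the end points for the minus sign. So these
points are all the common zeros, and a polynomial of degree at most `4m + 1` that vanishes at them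
is a combination of the generators with coefficients of degree at most `2m` and has integral zero,
which gives the weights (`exists_weights`). Minimality is a lower bound valid for any weight
symmetric about the origin (`lower_bound`).
-/

namespace MinCuba

/-! ### Jacobi polynomials in one variable -/

/-- The integral of a polynomial against the unnormalized Jacobi weight. -/
noncomputable def jacobiInt (a b : ℝ) (f : ℝ[X]) : ℝ :=
  ∫ t in (-1 : ℝ)..1, f.eval t * jacobiWeight a b t

theorem intervalIntegrable_jacobiWeight {a b : ℝ} (ha : -1 < a) (hb : -1 < b) :
    IntervalIntegrable (jacobiWeight a b) volume (-1) 1 := by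
  have h1 : IntervalIntegrable (fun t : ℝ => (1 - t) ^ a * (1 + t) ^ b) volume (-1) 0 := by
    have h : IntervalIntegrable (fun t : ℝ => (1 + t) ^ b) volume (-1) 0 := by
      have := (intervalIntegral.intervalIntegrable_rpow' (a := 0) (b := 1) hb).comp_add_left 1
      simpa using this
    refine h.continuousOn_mul (ContinuousOn.rpow_const (by fun_prop) fun t ht => Or.inl ?_)
    rw [Set.uIcc_of_le (by norm_num)] at ht
    linarith [ht.2]
  have h2 : IntervalIntegrable (fun t : ℝ => (1 - t) ^ a * (1 + t) ^ b) volume 0 1 := by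
    have h : IntervalIntegrable (fun t : ℝ => (1 - t) ^ a) volume 0 1 := by
      have := (intervalIntegral.intervalIntegrable_rpow' (a := 0) (b := 1) ha).comp_sub_left 1
      simpa using this.symm
    refine h.mul_continuousOn (ContinuousOn.rpow_const (by fun_prop) fun t ht => Or.inl ?_)
    rw [Set.uIcc_of_le (by norm_num)] at ht
    linarith [ht.1]
  exact h1.trans h2

theorem intervalIntegrable_eval_mul_jacobiWeight {a b : ℝ} (ha : -1 < a) (hb : -1 < b)
    (f : ℝ[X]) :
    IntervalIntegrable (fun t => f.eval t * jacobiWeight a b t) volume (-1) 1 :=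
  (intervalIntegrable_jacobiWeight ha hb).continuousOn_mul f.continuous.continuousOn

theorem jacobiInt_add {a b : ℝ} (ha : -1 < a) (hb : -1 < b) (f g : ℝ[X]) :
    jacobiInt a b (f + g) = jacobiInt a b f + jacobiInt a b g := by
  unfold jacobiInt
  rw [← intervalIntegral.integral_add (intervalIntegrable_eval_mul_jacobiWeight ha hb f)
    (intervalIntegrable_eval_mul_jacobiWeight ha hb g)]
  simp [add_mul]

theorem jacobiInt_C_mul (a b c : ℝ) (f : ℝ[X]) :
    jacobiInt a b (C c * f) = c * jacobiInt a b f := by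
  unfold jacobiInt
  rw [← intervalIntegral.integral_const_mul]
  simp [mul_assoc]

theorem jacobiInt_neg (a b : ℝ) (f : ℝ[X]) :
    jacobiInt a b (-f) = -jacobiInt a b f := by
  simpa using jacobiInt_C_mul a b (-1) f

theorem jacobiInt_sub {a b : ℝ} (ha : -1 < a) (hb : -1 < b) (f g : ℝ[X]) :
    jacobiInt a b (f - g) = jacobiInt a b f - jacobiInt a b g := by
  rw [sub_eq_add_neg, jacobiInt_add ha hb, jacobiInt_neg, sub_eq_add_neg]

theorem jacobiInt_zero (a b : ℝ) : jacobiInt a b 0 = 0 := by simp [jacobiInt]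

theorem jacobiInt_sum {a b : ℝ} (ha : -1 < a) (hb : -1 < b) {ι : Type*} (s : Finset ι)
    (f : ι → ℝ[X]) : jacobiInt a b (∑ i ∈ s, f i) = ∑ i ∈ s, jacobiInt a b (f i) := by
  classical
  induction s using Finset.induction_on with
  | empty => simp [jacobiInt_zero]
  | insert i s hi ih => rw [Finset.sum_insert hi, Finset.sum_insert hi, jacobiInt_add ha hb, ih]

theorem jacobiWeight_pos {a b t : ℝ} (ht : t ∈ Set.Ioo (-1 : ℝ) 1) : 0 < jacobiWeight a b t :=
  mul_pos (Real.rpow_pos_of_pos (by linarith [ht.2]) _) (Real.rpow_pos_of_pos (by linarith [ht.1]) _)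

theorem jacobiInt_pos {a b : ℝ} (ha : -1 < a) (hb : -1 < b) {f : ℝ[X]} (hf : f ≠ 0)
    (h : ∀ t ∈ Set.Ioo (-1 : ℝ) 1, 0 ≤ f.eval t) : 0 < jacobiInt a b f := by
  unfold jacobiInt
  rw [intervalIntegral.integral_pos_iff_support_of_nonneg_ae']
  · refine ⟨by norm_num, ?_⟩
    have hsub : Set.Ioo (-1 : ℝ) 1 \ (f.roots.toFinset : Set ℝ) ⊆
        Function.support (fun t => f.eval t * jacobiWeight a b t) ∩ Set.Ioc (-1) 1 := by
      rintro t ⟨ht, hr⟩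
      refine ⟨mul_ne_zero (fun h0 => hr ?_) (jacobiWeight_pos ht).ne', ht.1, ht.2.le⟩
      simpa [hf] using h0
    refine lt_of_lt_of_le ?_ (measure_mono hsub)
    rw [measure_sdiff_null (Finset.measure_zero _ _)]
    simp
  · rw [Set.uIoc_of_le (by norm_num), ← Measure.restrict_congr_set Ioo_ae_eq_Ioc]
    filter_upwards [ae_restrict_mem measurableSet_Ioo] with t ht
    exact mul_nonneg (h t ht) (jacobiWeight_pos ht).le
  · exact intervalIntegrable_eval_mul_jacobiWeight ha hb f

theorem jacobiInner_eq (a b : ℝ) (f g : ℝ[X]) :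
    jacobiInner a b f g = jacobiInt a b (f * g) / jacobiInt a b 1 := by
  simp [jacobiInner, jacobiInt]

theorem jacobiInner_self_pos {a b : ℝ} (ha : -1 < a) (hb : -1 < b) {f : ℝ[X]} (hf : f ≠ 0) :
    0 < jacobiInner a b f f := by
  rw [jacobiInner_eq]
  refine div_pos (jacobiInt_pos ha hb (mul_ne_zero hf hf) fun t _ => ?_)
    (jacobiInt_pos ha hb one_ne_zero fun t _ => by simp)
  simpa using mul_self_nonneg _


theorem monicJacobi_monic_degree (a b : ℝ) (n : ℕ) :
    (monicJacobi a b n).Monic ∧ (monicJacobi a b n).degree = n := by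
  induction n using Nat.strong_induction_on with
  | _ n ih =>
    have hlt : (∑ k : Fin n, C (jacobiInner a b (X ^ n) (monicJacobi a b k) /
        jacobiInner a b (monicJacobi a b k) (monicJacobi a b k)) * monicJacobi a b k).degree
        < (n : WithBot ℕ) := by
      refine (degree_sum_le _ _).trans_lt
        ((Finset.sup_lt_iff (WithBot.bot_lt_coe n)).2 fun k _ => ?_)
      rw [← smul_eq_C_mul]
      refine (degree_smul_le _ _).trans_lt ?_
      rw [(ih k k.2).2]
      exact Nat.cast_lt.2 k.2
    rw [monicJacobi]
    refine ⟨monic_X_pow_sub hlt, ?_⟩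
    rw [degree_sub_eq_left_of_degree_lt] <;> rw [degree_X_pow]
    exact hlt

theorem monicJacobi_monic (a b : ℝ) (n : ℕ) : (monicJacobi a b n).Monic :=
  (monicJacobi_monic_degree a b n).1

/-- The monic Jacobi polynomials as a sequence of polynomials of degrees `0, 1, 2, …`. -/
noncomputable def monicJacobiSeq (a b : ℝ) : Polynomial.Sequence ℝ :=
  ⟨monicJacobi a b, fun n => (monicJacobi_monic_degree a b n).2⟩

theorem jacobiInt_monicJacobi_mul {a b : ℝ} (ha : -1 < a) (hb : -1 < b) (n : ℕ) :
    ∀ q : ℝ[X], q.degree < n → jacobiInt a b (monicJacobi a b n * q) = 0 := by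
  induction n using Nat.strong_induction_on with
  | _ n ih =>
    have h1 : ∀ j < n, jacobiInt a b (monicJacobi a b n * monicJacobi a b j) = 0 := by
      intro j hj
      have hne : jacobiInt a b (monicJacobi a b j * monicJacobi a b j) ≠ 0 :=
        (jacobiInt_pos ha hb (mul_ne_zero (monicJacobi_monic a b j).ne_zero
          (monicJacobi_monic a b j).ne_zero)
          fun t _ => by simpa using mul_self_nonneg _).ne'
      have h0 : jacobiInt a b 1 ≠ 0 := (jacobiInt_pos ha hb one_ne_zero fun t _ => by simp).ne'
      rw [monicJacobi, sub_mul, jacobiInt_sub ha hb, Finset.sum_mul, jacobiInt_sum ha hb,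
        Finset.sum_eq_single (⟨j, hj⟩ : Fin n)]
      · rw [mul_assoc, jacobiInt_C_mul, jacobiInner_eq, jacobiInner_eq]
        field_simp
        simp
      · intro k _ hk
        rw [mul_assoc, jacobiInt_C_mul]
        have hk' : (k : ℕ) ≠ j := fun h => hk (Fin.ext h)
        rcases lt_or_gt_of_ne hk' with h | h
        · rw [mul_comm (monicJacobi a b k), ih j hj, mul_zero]
          rw [(monicJacobi_monic_degree a b k).2]
          exact_mod_cast h
        · rw [ih k k.2, mul_zero]
          rw [(monicJacobi_monic_degree a b j).2]
          exact_mod_cast h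
      · simp
    intro q hq
    have hspan := (monicJacobiSeq a b).span_degreeLT (m := n) fun i _ => by
      rw [show (monicJacobiSeq a b) i = monicJacobi a b i from rfl,
        (monicJacobi_monic a b i).leadingCoeff]
      exact isUnit_one
    have hmem : q ∈ Submodule.span ℝ (monicJacobiSeq a b '' Set.Iio n) := by
      rw [hspan]; exact mem_degreeLT.2 hq
    induction hmem using Submodule.span_induction with
    | mem x hx => obtain ⟨j, hj, rfl⟩ := hx; exact h1 j hj
    | zero => simp [jacobiInt_zero]
    | add x y hx hy h1 h2 =>
      rw [hspan] at hx hy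
      rw [mul_add, jacobiInt_add ha hb, h1 (mem_degreeLT.1 hx), h2 (mem_degreeLT.1 hy), add_zero]
    | smul c x hx h1 =>
      rw [hspan] at hx
      rw [smul_eq_C_mul, mul_left_comm, jacobiInt_C_mul, h1 (mem_degreeLT.1 hx), mul_zero]

/-- The positive factor by which the orthonormal Jacobi polynomial differs from the monic one. -/
noncomputable def jacobiLead (a b : ℝ) (n : ℕ) : ℝ :=
  (Real.sqrt (jacobiInner a b (monicJacobi a b n) (monicJacobi a b n)))⁻¹

theorem jacobi_eq (a b : ℝ) (n : ℕ) : jacobi a b n = C (jacobiLead a b n) * monicJacobi a b n := rfl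

theorem leadingCoeff_jacobi (a b : ℝ) (n : ℕ) : (jacobi a b n).leadingCoeff = jacobiLead a b n := by
  rw [jacobi_eq, leadingCoeff_mul, leadingCoeff_C, (monicJacobi_monic a b n).leadingCoeff, mul_one]

section

variable {a b : ℝ} (ha : -1 < a) (hb : -1 < b)
include ha hb

theorem jacobiLead_pos (n : ℕ) : 0 < jacobiLead a b n :=
  inv_pos.2 (Real.sqrt_pos.2 (jacobiInner_self_pos ha hb (monicJacobi_monic a b n).ne_zero))

theorem degree_jacobi (n : ℕ) : (jacobi a b n).degree = n := by
  rw [jacobi_eq, degree_C_mul (jacobiLead_pos ha hb n).ne', (monicJacobi_monic_degree a b n).2]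

theorem natDegree_jacobi (n : ℕ) : (jacobi a b n).natDegree = n :=
  natDegree_eq_of_degree_eq_some (degree_jacobi ha hb n)

theorem jacobi_ne_zero (n : ℕ) : jacobi a b n ≠ 0 :=
  mul_ne_zero (C_ne_zero.2 (jacobiLead_pos ha hb n).ne') (monicJacobi_monic a b n).ne_zero

theorem jacobiInt_jacobi_mul (n : ℕ) (q : ℝ[X]) (hq : q.degree < n) :
    jacobiInt a b (jacobi a b n * q) = 0 := by
  rw [jacobi_eq, mul_assoc, jacobiInt_C_mul, jacobiInt_monicJacobi_mul ha hb n q hq, mul_zero]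

end

/-! ### Roots of orthogonal polynomials -/

/-- A polynomial all of whose roots in `(-1,1)` have even multiplicity does not change sign
there. -/
theorem eval_mul_eval_nonneg_of_even (f : ℝ[X]) (hf : f ≠ 0)
    (h : ∀ z ∈ Set.Ioo (-1 : ℝ) 1, Even (f.rootMultiplicity z)) :
    ∀ s ∈ Set.Ioo (-1 : ℝ) 1, ∀ t ∈ Set.Ioo (-1 : ℝ) 1, 0 ≤ f.eval s * f.eval t := by
  induction hn : f.natDegree using Nat.strong_induction_on generalizing f with
  | _ n ih =>
    by_cases hz : ∃ z ∈ Set.Ioo (-1 : ℝ) 1, f.IsRoot z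
    · obtain ⟨z, hz, hroot⟩ := hz
      obtain ⟨g, hg, -⟩ := exists_eq_pow_rootMultiplicity_mul_and_not_dvd f hf z
      have hpos : 0 < f.rootMultiplicity z := (rootMultiplicity_pos hf).2 hroot
      have heven := h z hz
      set k := f.rootMultiplicity z with hk
      have hg0 : g ≠ 0 := by rintro rfl; exact hf (by rw [hg, mul_zero])
      have hX : (X - C z : ℝ[X]) ^ k ≠ 0 := pow_ne_zero _ (X_sub_C_ne_zero z)
      have hdeg : g.natDegree < n := by
        rw [← hn, hg, natDegree_mul hX hg0, natDegree_pow, natDegree_X_sub_C]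
        omega
      have hev : ∀ w ∈ Set.Ioo (-1 : ℝ) 1, Even (g.rootMultiplicity w) := by
        intro w hw
        have h1 := h w hw
        rw [hg, rootMultiplicity_mul (mul_ne_zero hX hg0)] at h1
        have h2 : Even (((X - C z : ℝ[X]) ^ k).rootMultiplicity w) := by
          rw [← count_roots, roots_pow, Multiset.count_nsmul]
          exact heven.mul_right _
        exact (Nat.even_add.1 h1).1 h2
      intro s hs t ht
      have h3 := ih _ hdeg g hg0 hev rfl s hs t ht
      rw [hg]
      simp only [eval_mul, eval_pow, eval_sub, eval_X, eval_C]
      have := mul_nonneg (mul_nonneg (heven.pow_nonneg (s - z)) (heven.pow_nonneg (t - z))) h3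
      linarith
    · push Not at hz
      intro s hs t ht
      by_contra hneg
      push Not at hneg
      have hc : ContinuousOn (fun x => f.eval x) (Set.Ioo (-1) 1) := f.continuous.continuousOn
      have key : ∀ s ∈ Set.Ioo (-1 : ℝ) 1, ∀ t ∈ Set.Ioo (-1 : ℝ) 1,
          f.eval s < 0 → 0 < f.eval t → False := by
        intro s hs t ht h1 h2
        obtain ⟨z, hz1, hz2⟩ := isPreconnected_Ioo.intermediate_value hs ht hc
          (show (0 : ℝ) ∈ Set.Icc _ _ from ⟨h1.le, h2.le⟩)
        exact hz z hz1 hz2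
      rcases mul_neg_iff.1 hneg with ⟨h1, h2⟩ | ⟨h1, h2⟩
      · exact key t ht s hs h2 h1
      · exact key s hs t ht h1 h2

/-- The roots in `(-1,1)` of odd multiplicity. -/
noncomputable def oddRoots (f : ℝ[X]) : Finset ℝ :=
  {z ∈ f.roots.toFinset | z ∈ Set.Ioo (-1 : ℝ) 1 ∧ Odd (f.rootMultiplicity z)}

theorem mem_oddRoots {f : ℝ[X]} {z : ℝ} :
    z ∈ oddRoots f ↔ z ∈ Set.Ioo (-1 : ℝ) 1 ∧ Odd (f.rootMultiplicity z) := by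
  simp only [oddRoots, Finset.mem_filter, Multiset.mem_toFinset, and_iff_right_iff_imp]
  rintro ⟨-, h⟩
  exact Multiset.count_pos.1 (by rw [count_roots]; exact h.pos)

theorem eval_eq_zero_of_mem_oddRoots {f : ℝ[X]} {z : ℝ} (h : z ∈ oddRoots f) : f.eval z = 0 := by
  have := (Finset.mem_filter.1 h).1
  exact (mem_roots'.1 (Multiset.mem_toFinset.1 this)).2

/-- The product of `X - z` over the roots `z` of odd multiplicity in `(-1,1)`. -/
noncomputable def oddPart (f : ℝ[X]) : ℝ[X] := ∏ z ∈ oddRoots f, (X - C z)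

theorem oddPart_monic (f : ℝ[X]) : (oddPart f).Monic := monic_prod_X_sub_C _ _

theorem natDegree_oddPart (f : ℝ[X]) : (oddPart f).natDegree = (oddRoots f).card := by
  simp [oddPart]

theorem eval_mul_oddPart_nonneg {f : ℝ[X]} (hf : f ≠ 0) {s t : ℝ} (hs : s ∈ Set.Ioo (-1 : ℝ) 1)
    (ht : t ∈ Set.Ioo (-1 : ℝ) 1) :
    0 ≤ (f * oddPart f).eval s * (f * oddPart f).eval t := by
  refine eval_mul_eval_nonneg_of_even _ (mul_ne_zero hf (oddPart_monic f).ne_zero) ?_ s hs t ht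
  intro z hz
  rw [rootMultiplicity_mul (mul_ne_zero hf (oddPart_monic f).ne_zero)]
  have h : (oddPart f).rootMultiplicity z = if z ∈ oddRoots f then 1 else 0 := by
    rw [← count_roots, oddPart, roots_prod_X_sub_C]
    split_ifs with h
    · exact Multiset.count_eq_one_of_mem (oddRoots f).nodup h
    · exact Multiset.count_eq_zero_of_notMem h
  rw [h]
  split_ifs with h1
  · exact (mem_oddRoots.1 h1).2.add_one
  · have : ¬ Odd (f.rootMultiplicity z) := fun h2 => h1 (mem_oddRoots.2 ⟨hz, h2⟩)
    simpa using this

/-- A polynomial orthogonal to all polynomials of degree less than `k` has at least `k` roots of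
odd multiplicity in `(-1,1)`: its product with its odd part does not change sign. -/
theorem le_card_oddRoots {a b : ℝ} (ha : -1 < a) (hb : -1 < b) {f : ℝ[X]} (hf : f ≠ 0) {k : ℕ}
    (h : ∀ q : ℝ[X], q.degree < k → jacobiInt a b (f * q) = 0) : k ≤ (oddRoots f).card := by
  by_contra! hlt
  have h0 : jacobiInt a b (f * oddPart f) = 0 := by
    refine h _ ?_
    rw [degree_eq_natDegree (oddPart_monic f).ne_zero, natDegree_oddPart]
    exact_mod_cast hlt
  have hne : f * oddPart f ≠ 0 := mul_ne_zero hf (oddPart_monic f).ne_zero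
  by_cases hs : ∃ s ∈ Set.Ioo (-1 : ℝ) 1, (f * oddPart f).eval s < 0
  · obtain ⟨s, hs, hneg⟩ := hs
    have := jacobiInt_pos ha hb (neg_ne_zero.2 hne) fun t ht => by
      have h1 := eval_mul_oddPart_nonneg hf hs ht
      rw [eval_neg]
      nlinarith
    rw [jacobiInt_neg] at this
    linarith
  · push Not at hs
    exact (jacobiInt_pos ha hb hne hs).ne' h0

/-- A polynomial of degree at most `n` with `n` roots of odd multiplicity in `(-1,1)` is a constant
multiple of its odd part. -/
theorem eq_C_mul_oddPart {f : ℝ[X]} {n : ℕ} (hf : f ≠ 0) (hn : f.natDegree ≤ n)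
    (h : n ≤ (oddRoots f).card) : (oddRoots f).card = n ∧ f = C f.leadingCoeff * oddPart f := by
  have hdvd : oddPart f ∣ f := by
    refine (Multiset.prod_X_sub_C_dvd_iff_le_roots hf (oddRoots f).val).2 ?_
    exact (Multiset.le_iff_subset (oddRoots f).nodup).2 fun z hz =>
      (mem_roots hf).2 (eval_eq_zero_of_mem_oddRoots hz)
  obtain ⟨g, hg⟩ := hdvd
  have hg0 : g ≠ 0 := by rintro rfl; exact hf (by rw [hg, mul_zero])
  have hdeg : f.natDegree = (oddRoots f).card + g.natDegree := by
    conv_lhs => rw [hg]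
    rw [natDegree_mul (oddPart_monic f).ne_zero hg0, natDegree_oddPart]
  refine ⟨by omega, ?_⟩
  have hg1 : g = C (g.coeff 0) := eq_C_of_natDegree_eq_zero (by omega)
  have hlc : f.leadingCoeff = g.coeff 0 := by
    rw [hg, leadingCoeff_mul, (oddPart_monic f).leadingCoeff, one_mul, hg1]
    simp
  rw [hlc, ← hg1, mul_comm, ← hg]

theorem eval_one_oddPart_pos (f : ℝ[X]) : 0 < (oddPart f).eval 1 := by
  rw [oddPart, eval_prod]
  exact Finset.prod_pos fun z hz => by simpa using (mem_oddRoots.1 hz).1.2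

theorem eval_neg_one_oddPart_pos (f : ℝ[X]) :
    0 < (-1) ^ (oddRoots f).card * (oddPart f).eval (-1) := by
  rw [oddPart, eval_prod, ← Finset.prod_const, ← Finset.prod_mul_distrib]
  exact Finset.prod_pos fun z hz => by
    have := (mem_oddRoots.1 hz).1.1
    simp; linarith

section

variable {a b : ℝ} (ha : -1 < a) (hb : -1 < b) (n : ℕ)
include ha hb

theorem card_oddRoots_jacobi : (oddRoots (jacobi a b n)).card = n :=
  (eq_C_mul_oddPart (jacobi_ne_zero ha hb n) (natDegree_jacobi ha hb n).le
    (le_card_oddRoots ha hb (jacobi_ne_zero ha hb n) (jacobiInt_jacobi_mul ha hb n))).1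

theorem jacobi_eq_oddPart :
    jacobi a b n = C (jacobiLead a b n) * oddPart (jacobi a b n) := by
  have := (eq_C_mul_oddPart (jacobi_ne_zero ha hb n) (natDegree_jacobi ha hb n).le
    (le_card_oddRoots ha hb (jacobi_ne_zero ha hb n) (jacobiInt_jacobi_mul ha hb n))).2
  rwa [leadingCoeff_jacobi] at this

theorem eval_one_jacobi_pos : 0 < (jacobi a b n).eval 1 := by
  rw [jacobi_eq_oddPart ha hb, eval_mul, eval_C]
  exact mul_pos (jacobiLead_pos ha hb n) (eval_one_oddPart_pos _)

theorem eval_neg_one_jacobi_pos : 0 < (-1) ^ n * (jacobi a b n).eval (-1) := by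
  have := mul_pos (jacobiLead_pos ha hb n) (eval_neg_one_oddPart_pos (jacobi a b n))
  rw [card_oddRoots_jacobi ha hb] at this
  rw [jacobi_eq_oddPart ha hb, eval_mul, eval_C]
  linarith

end


/-! ### Integration over the square -/

/-- The cosine of a point of the circle `ℝ / 2πℤ`. -/
noncomputable def circleCos (z : AddCircle (2 * Real.pi)) : ℝ := Real.Angle.cos z

theorem continuous_circleCos : Continuous circleCos := Real.Angle.continuous_cos

instance : Fact (0 < 2 * Real.pi) := ⟨Real.two_pi_pos⟩

/-- The arcsine law on `[-1,1]` (of mass `2π`): the distribution of the cosine of a point of the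
circle. -/
noncomputable def arcsine : Measure ℝ := Measure.map circleCos volume

instance : IsFiniteMeasure arcsine := by unfold arcsine; infer_instance

theorem arcsine_eq :
    arcsine = (2 : ENNReal) • Measure.map Real.cos (volume.restrict (Set.Ioo 0 Real.pi)) := by
  have hpi := Real.pi_pos
  have h1 : arcsine = Measure.map Real.cos (volume.restrict (Set.Ioc (-Real.pi) Real.pi)) := by
    rw [arcsine, ← (AddCircle.measurePreserving_mk (2 * Real.pi) (-Real.pi)).map_eq,
      Measure.map_map continuous_circleCos.measurable AddCircle.measurable_mk',
      show -Real.pi + 2 * Real.pi = Real.pi by ring]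
    rfl
  have hneg : Measure.map Real.cos (volume.restrict (Set.Ioo (-Real.pi) 0)) =
      Measure.map Real.cos (volume.restrict (Set.Ioo 0 Real.pi)) := by
    have hmp : MeasurePreserving (fun x : ℝ => -x) (volume.restrict (Set.Ioo (-Real.pi) 0))
        (volume.restrict (Set.Ioo 0 Real.pi)) := by
      have h := (Measure.measurePreserving_neg (volume : Measure ℝ)).restrict_preimage
        (measurableSet_Ioo (a := 0) (b := Real.pi))
      have h2 : Neg.neg ⁻¹' (Set.Ioo 0 Real.pi) = Set.Ioo (-Real.pi) 0 := by
        ext x; simp only [Set.mem_preimage, Set.mem_Ioo]; constructor <;> rintro ⟨h1, h2⟩ <;>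
          constructor <;> linarith
      rwa [h2] at h
    rw [← hmp.map_eq, Measure.map_map Real.measurable_cos measurable_neg]
    congr 1
    ext x
    simp
  have h2 : volume.restrict (Set.Ioc (-Real.pi) Real.pi) =
      volume.restrict (Set.Ioo (-Real.pi) 0) + volume.restrict (Set.Ioo 0 Real.pi) := by
    rw [← Set.Ioc_union_Ioc_eq_Ioc (b := 0) (by linarith) hpi.le,
      Measure.restrict_union (Set.Ioc_disjoint_Ioc_of_le le_rfl) measurableSet_Ioc,
      Measure.restrict_congr_set (Ioo_ae_eq_Ioc (a := -Real.pi) (b := 0)).symm,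
      Measure.restrict_congr_set (Ioo_ae_eq_Ioc (a := 0) (b := Real.pi)).symm]
  rw [h1, h2, Measure.map_add _ _ Real.measurable_cos, hneg, two_smul]

theorem image_cos_Ioo : Real.cos '' Set.Ioo 0 Real.pi = Set.Ioo (-1) 1 := by
  ext x
  constructor
  · rintro ⟨t, ht, rfl⟩
    have h1 := Real.strictAntiOn_cos ⟨ht.1.le, ht.2.le⟩ ⟨Real.pi_pos.le, le_rfl⟩ ht.2
    have h2 := Real.strictAntiOn_cos ⟨le_rfl, Real.pi_pos.le⟩ ⟨ht.1.le, ht.2.le⟩ ht.1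
    rw [Real.cos_pi] at h1
    rw [Real.cos_zero] at h2
    exact ⟨h1, h2⟩
  · intro hx
    exact ⟨Real.arccos x, ⟨Real.arccos_pos.2 hx.2, Real.arccos_lt_pi.2 hx.1⟩,
      Real.cos_arccos hx.1.le hx.2.le⟩

theorem ae_arcsine_mem : ∀ᵐ x ∂arcsine, x ∈ Set.Ioo (-1 : ℝ) 1 := by
  have h : ∀ᵐ x ∂Measure.map Real.cos (volume.restrict (Set.Ioo 0 Real.pi)),
      x ∈ Set.Ioo (-1 : ℝ) 1 := by
    refine (ae_map_iff Real.measurable_cos.aemeasurable measurableSet_Ioo).2 ?_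
    filter_upwards [ae_restrict_mem measurableSet_Ioo] with t ht
    have h := Set.mem_image_of_mem Real.cos ht
    rwa [image_cos_Ioo] at h
  rw [arcsine_eq, two_smul, ae_add_measure_iff]
  exact ⟨h, h⟩

/-- The open square. -/
def openSquare : Set (ℝ × ℝ) := Set.Ioo (-1) 1 ×ˢ Set.Ioo (-1) 1

theorem measurableSet_openSquare : MeasurableSet openSquare :=
  measurableSet_Ioo.prod measurableSet_Ioo

theorem ae_arcsine_prod_mem : ∀ᵐ p ∂arcsine.prod arcsine, p ∈ openSquare := by
  have h : arcsine.restrict (Set.Ioo (-1) 1) = arcsine :=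
    Measure.restrict_eq_self_of_ae_mem ae_arcsine_mem
  rw [← h, Measure.prod_restrict]
  exact ae_restrict_mem measurableSet_openSquare

/-- The density `√(1 - x²)` of (twice) Lebesgue measure with respect to the arcsine law. -/
noncomputable def arcsineDensity (x : ℝ) : NNReal := (Real.sqrt (1 - x ^ 2)).toNNReal

theorem coe_arcsineDensity (x : ℝ) : (arcsineDensity x : ℝ) = Real.sqrt (1 - x ^ 2) :=
  Real.coe_toNNReal _ (Real.sqrt_nonneg _)

theorem measurable_arcsineDensity : Measurable arcsineDensity := by
  unfold arcsineDensity
  fun_prop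

theorem arcsine_withDensity :
    arcsine.withDensity (fun x => arcsineDensity x) =
      (2 : ENNReal) • volume.restrict (Set.Ioo (-1 : ℝ) 1) := by
  have hm : Measurable fun x => (arcsineDensity x : ENNReal) :=
    measurable_arcsineDensity.coe_nnreal_ennreal
  ext s hs
  rw [withDensity_apply _ hs, arcsine_eq, Measure.restrict_smul, lintegral_smul_measure,
    Measure.smul_apply]
  congr 1
  rw [setLIntegral_map hs hm Real.measurable_cos, Measure.restrict_apply hs,
    ← lintegral_indicator_one (hs.inter measurableSet_Ioo), ← lintegral_indicator
      (Real.measurable_cos hs)]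
  have h := lintegral_image_eq_lintegral_abs_deriv_mul (s := Set.Ioo 0 Real.pi) (f := Real.cos)
    (f' := fun t => -Real.sin t) measurableSet_Ioo
    (fun t _ => (Real.hasDerivAt_cos t).hasDerivWithinAt)
    (Real.injOn_cos.mono Set.Ioo_subset_Icc_self) (s.indicator 1)
  rw [image_cos_Ioo, ← lintegral_indicator measurableSet_Ioo, Set.indicator_indicator,
    Set.inter_comm] at h
  rw [h]
  refine setLIntegral_congr_fun measurableSet_Ioo fun t ht => ?_
  have hsin := Real.sin_pos_of_mem_Ioo ht
  have hd : (arcsineDensity (Real.cos t) : ENNReal) = ENNReal.ofReal (Real.sin t) := by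
    rw [arcsineDensity, ← Real.sin_sq, Real.sqrt_sq hsin.le, ENNReal.ofReal]
  by_cases hts : Real.cos t ∈ s
  · simp [Set.indicator, hts, hd, abs_of_pos hsin]
  · simp [Set.indicator, hts]

theorem volume_restrict_square :
    (volume : Measure (ℝ × ℝ)).restrict square = volume.restrict openSquare := by
  refine Measure.restrict_congr_set ?_
  exact (Measure.set_prod_ae_eq Ioo_ae_eq_Icc Ioo_ae_eq_Icc).symm

/-- Lebesgue measure on the square has density `√(1 - x²) √(1 - y²)`, up to the factor `4`, with
respect to the product of the arcsine laws. -/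
theorem arcsine_prod_withDensity :
    (arcsine.prod arcsine).withDensity
        (fun p => ((arcsineDensity p.1 * arcsineDensity p.2 : NNReal) : ENNReal)) =
      (4 : ENNReal) • volume.restrict square := by
  have hm : Measurable fun x => (arcsineDensity x : ENNReal) :=
    measurable_arcsineDensity.coe_nnreal_ennreal
  simp only [ENNReal.coe_mul]
  rw [← prod_withDensity hm hm, arcsine_withDensity, volume_restrict_square, openSquare,
    Measure.volume_eq_prod, ← Measure.prod_restrict, Measure.prod_smul_left,
    Measure.prod_smul_right, smul_smul]
  norm_num

theorem integrableOn_square_iff (f : ℝ × ℝ → ℝ) :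
    IntegrableOn f square ↔ Integrable (fun p => Real.sqrt (1 - p.1 ^ 2) * Real.sqrt (1 - p.2 ^ 2)
      * f p) (arcsine.prod arcsine) := by
  have hm : Measurable fun p : ℝ × ℝ => arcsineDensity p.1 * arcsineDensity p.2 :=
    (measurable_arcsineDensity.comp measurable_fst).mul
      (measurable_arcsineDensity.comp measurable_snd)
  have h := integrable_withDensity_iff_integrable_smul (μ := arcsine.prod arcsine) hm (g := f)
  rw [arcsine_prod_withDensity, integrable_smul_measure (by simp) (by simp)] at h
  rw [IntegrableOn, h]
  simp only [NNReal.smul_def, NNReal.coe_mul, coe_arcsineDensity, smul_eq_mul]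

theorem integral_square_eq (f : ℝ × ℝ → ℝ) :
    ∫ p in square, f p = 1 / 4 * ∫ p, Real.sqrt (1 - p.1 ^ 2) * Real.sqrt (1 - p.2 ^ 2)
      * f p ∂(arcsine.prod arcsine) := by
  have hm : Measurable fun p : ℝ × ℝ => arcsineDensity p.1 * arcsineDensity p.2 :=
    (measurable_arcsineDensity.comp measurable_fst).mul
      (measurable_arcsineDensity.comp measurable_snd)
  have h := integral_withDensity_eq_integral_smul (μ := arcsine.prod arcsine) hm f
  rw [arcsine_prod_withDensity, integral_smul_measure] at h
  simp only [NNReal.smul_def, NNReal.coe_mul, coe_arcsineDensity, smul_eq_mul] at h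
  rw [← h, ENNReal.toReal_ofNat]
  ring

/-- The map `(θ, φ) ↦ (θ - φ, θ + φ)` of the torus to itself preserves Haar measure. -/
theorem measurePreserving_torus :
    MeasurePreserving (fun z : AddCircle (2 * Real.pi) × AddCircle (2 * Real.pi) =>
      (z.1 - z.2, z.1 + z.2)) (volume.prod volume) (volume.prod volume) := by
  let f : AddCircle (2 * Real.pi) × AddCircle (2 * Real.pi) →+
      AddCircle (2 * Real.pi) × AddCircle (2 * Real.pi) :=
    { toFun := fun z => (z.1 - z.2, z.1 + z.2)
      map_zero' := by simp
      map_add' := fun z w => by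
        ext
        · exact add_sub_add_comm _ _ _ _
        · exact add_add_add_comm _ _ _ _ }
  have hf : Continuous f := by
    change Continuous fun z : AddCircle (2 * Real.pi) × AddCircle (2 * Real.pi) =>
      (z.1 - z.2, z.1 + z.2)
    fun_prop
  refine AddMonoidHom.measurePreserving (f := f) hf ?_ rfl
  rintro ⟨s, d⟩
  obtain ⟨s, rfl⟩ := QuotientAddGroup.mk_surjective s
  obtain ⟨d, rfl⟩ := QuotientAddGroup.mk_surjective d
  refine ⟨(((s + d) / 2 : ℝ), ((d - s) / 2 : ℝ)), ?_⟩
  change ((((s + d) / 2 : ℝ) : AddCircle (2 * Real.pi)) - ((d - s) / 2 : ℝ),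
    (((s + d) / 2 : ℝ) : AddCircle (2 * Real.pi)) + ((d - s) / 2 : ℝ)) = _
  rw [← AddCircle.coe_sub, ← AddCircle.coe_add]
  ring_nf

/-- The substitution `(x, y) ↦ (2xy, x² + y² - 1)` for points. -/
def pointUV (p : ℝ × ℝ) : ℝ × ℝ := (2 * p.1 * p.2, p.1 ^ 2 + p.2 ^ 2 - 1)

/-- The elementary symmetric functions `(x + y, x y)` of the coordinates of a point. -/
def pointSym (p : ℝ × ℝ) : ℝ × ℝ := (p.1 + p.2, p.1 * p.2)

theorem measurable_pointUV : Measurable pointUV := by unfold pointUV; fun_prop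
theorem measurable_pointSym : Measurable pointSym := by unfold pointSym; fun_prop

/-- With `x = cos θ`, `y = cos φ`, the pair `(2xy, x² + y² - 1)` consists of the sum and the product
of `cos (θ - φ)` and `cos (θ + φ)`, and these are again independent with the arcsine law. -/
theorem map_pointUV_arcsine :
    Measure.map pointUV (arcsine.prod arcsine) = Measure.map pointSym (arcsine.prod arcsine) := by
  have hc := continuous_circleCos.measurable
  have h : pointUV ∘ Prod.map circleCos circleCos =
      (pointSym ∘ Prod.map circleCos circleCos) ∘ fun z => (z.1 - z.2, z.1 + z.2) := by
    funext ⟨θ, φ⟩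
    obtain ⟨θ, rfl⟩ := QuotientAddGroup.mk_surjective θ
    obtain ⟨φ, rfl⟩ := QuotientAddGroup.mk_surjective φ
    change pointUV (Real.cos θ, Real.cos φ) = pointSym (Real.cos (θ - φ), Real.cos (θ + φ))
    have h1 := Real.sin_sq_add_cos_sq θ
    have h2 := Real.sin_sq_add_cos_sq φ
    simp only [pointUV, pointSym, Real.cos_add, Real.cos_sub, Prod.mk.injEq]
    constructor
    · ring
    · linear_combination Real.sin φ ^ 2 * h1 + (1 - Real.cos θ ^ 2) * h2
  rw [arcsine, Measure.map_prod_map _ _ hc hc, Measure.map_map measurable_pointUV (by fun_prop),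
    Measure.map_map measurable_pointSym (by fun_prop), h,
    ← Measure.map_map (measurable_pointSym.comp (by fun_prop)) measurePreserving_torus.measurable,
    measurePreserving_torus.map_eq]

/-- The factor `1` or `u²/4 - v` of the weight in the coordinates `u, v`. -/
noncomputable def discUV : Sgn → ℝ × ℝ → ℝ
  | .minus, _ => 1
  | .plus, w => w.1 ^ 2 / 4 - w.2

theorem continuous_discUV (s : Sgn) : Continuous (discUV s) := by
  cases s
  · exact continuous_const
  · change Continuous fun w : ℝ × ℝ => w.1 ^ 2 / 4 - w.2
    fun_prop

/-- The density of the weight, in the coordinates `u, v`, with respect to the image of the product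
of the arcsine laws. -/
noncomputable def weightUV (a b : ℝ) (s : Sgn) (w : ℝ × ℝ) : ℝ :=
  |1 - w.1 + w.2| ^ (a + 1 / 2) * |1 + w.1 + w.2| ^ (b + 1 / 2) * discUV s w

theorem measurable_weightUV (a b : ℝ) (s : Sgn) : Measurable (weightUV a b s) := by
  have h : Measurable (discUV s) := (continuous_discUV s).measurable
  unfold weightUV
  refine Measurable.mul (Measurable.mul ?_ ?_) h
  · exact Measurable.pow_const (by fun_prop) _
  · exact Measurable.pow_const (by fun_prop) _

theorem sqrt_mul_weight_eq (a b : ℝ) (s : Sgn) {p : ℝ × ℝ} (hp : p ∈ openSquare) :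
    Real.sqrt (1 - p.1 ^ 2) * Real.sqrt (1 - p.2 ^ 2) * weight a b s p =
      weightUV a b s (pointUV p) := by
  obtain ⟨x, y⟩ := p
  obtain ⟨⟨hx1, hx2⟩, hy1, hy2⟩ := hp
  simp only at hx1 hx2 hy1 hy2
  have hX : 0 < 1 - x ^ 2 := by nlinarith
  have hY : 0 < 1 - y ^ 2 := by nlinarith
  have key : ∀ t c : ℝ, |t| ^ (2 * c + 1) = |t ^ 2| ^ (c + 1 / 2) := by
    intro t c
    rw [show 2 * c + 1 = 2 * (c + 1 / 2) by ring, Real.rpow_mul (abs_nonneg _), abs_pow]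
    norm_num
  have e1 : 1 - 2 * x * y + (x ^ 2 + y ^ 2 - 1) = (x - y) ^ 2 := by ring
  have e2 : 1 + 2 * x * y + (x ^ 2 + y ^ 2 - 1) = (x + y) ^ 2 := by ring
  simp only [weight, weightUV, pointUV, e1, e2, key]
  have h3 : Real.sqrt (1 - x ^ 2) * Real.sqrt (1 - y ^ 2) *
      ((1 - x ^ 2) ^ s.half * (1 - y ^ 2) ^ s.half) =
      discUV s (2 * x * y, x ^ 2 + y ^ 2 - 1) := by
    rw [Real.sqrt_eq_rpow, Real.sqrt_eq_rpow]
    rw [mul_mul_mul_comm, ← Real.rpow_add hX, ← Real.rpow_add hY]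
    cases s <;> norm_num [Sgn.half, discUV]
    ring
  rw [← h3]
  ring

/-- The weight in the variables `ξ, η`: a product of Jacobi weights, times `1` or `((ξ - η)/2)²`. -/
noncomputable def symWeight (a b : ℝ) (s : Sgn) (q : ℝ × ℝ) : ℝ :=
  jacobiWeight a b q.1 * jacobiWeight a b q.2 * discUV s (pointSym q)

theorem sqrt_mul_symWeight_eq (a b : ℝ) (s : Sgn) {q : ℝ × ℝ} (hq : q ∈ openSquare) :
    Real.sqrt (1 - q.1 ^ 2) * Real.sqrt (1 - q.2 ^ 2) * symWeight a b s q =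
      weightUV a b s (pointSym q) := by
  obtain ⟨x, y⟩ := q
  obtain ⟨⟨hx1, hx2⟩, hy1, hy2⟩ := hq
  simp only at hx1 hx2 hy1 hy2
  have h1 : 0 < 1 - x := by linarith
  have h2 : 0 < 1 + x := by linarith
  have h3 : 0 < 1 - y := by linarith
  have h4 : 0 < 1 + y := by linarith
  have e1 : 1 - (x + y) + x * y = (1 - x) * (1 - y) := by ring
  have e2 : 1 + (x + y) + x * y = (1 + x) * (1 + y) := by ring
  have e3 : 1 - x ^ 2 = (1 - x) * (1 + x) := by ring
  have e4 : 1 - y ^ 2 = (1 - y) * (1 + y) := by ring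
  simp only [symWeight, weightUV, jacobiWeight]
  rw [show 1 - (pointSym (x, y)).1 + (pointSym (x, y)).2 = (1 - x) * (1 - y) from e1,
    show 1 + (pointSym (x, y)).1 + (pointSym (x, y)).2 = (1 + x) * (1 + y) from e2,
    abs_of_pos (mul_pos h1 h3), abs_of_pos (mul_pos h2 h4), e3, e4,
    Real.mul_rpow h1.le h3.le, Real.mul_rpow h2.le h4.le, Real.rpow_add h1, Real.rpow_add h2,
    Real.rpow_add h3, Real.rpow_add h4, Real.sqrt_mul h1.le, Real.sqrt_mul h3.le,
    Real.sqrt_eq_rpow, Real.sqrt_eq_rpow, Real.sqrt_eq_rpow, Real.sqrt_eq_rpow]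
  ring

/-- The change of variables from the square to the coordinates `u = ξ + η`, `v = ξ η`. -/
theorem integral_pointUV_mul_weight (a b : ℝ) (s : Sgn) {F : ℝ × ℝ → ℝ} (hF : Measurable F) :
    ∫ p in square, F (pointUV p) * weight a b s p =
      ∫ q in square, F (pointSym q) * symWeight a b s q := by
  have hm : Measurable fun w => F w * weightUV a b s w := hF.mul (measurable_weightUV a b s)
  rw [integral_square_eq, integral_square_eq]
  congr 1
  have h1 := integral_map (μ := arcsine.prod arcsine) measurable_pointUV.aemeasurable
    hm.aestronglyMeasurable
  have h2 := integral_map (μ := arcsine.prod arcsine) measurable_pointSym.aemeasurable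
    hm.aestronglyMeasurable
  rw [map_pointUV_arcsine, h2] at h1
  refine (Eq.trans ?_ h1.symm).trans ?_
  · refine integral_congr_ae ?_
    filter_upwards [ae_arcsine_prod_mem] with p hp
    rw [← sqrt_mul_weight_eq a b s hp]
    ring
  · refine integral_congr_ae ?_
    filter_upwards [ae_arcsine_prod_mem] with p hp
    rw [← sqrt_mul_symWeight_eq a b s hp]
    ring

theorem integrableOn_jacobiWeight {a b : ℝ} (ha : -1 < a) (hb : -1 < b) :
    IntegrableOn (jacobiWeight a b) (Set.Icc (-1) 1) := by
  rw [integrableOn_Icc_iff_integrableOn_Ioc]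
  exact (intervalIntegrable_iff_integrableOn_Ioc_of_le (by norm_num)).1
    (intervalIntegrable_jacobiWeight ha hb)

theorem volume_restrict_square_eq_prod : (volume : Measure (ℝ × ℝ)).restrict square =
    (volume.restrict (Set.Icc (-1 : ℝ) 1)).prod (volume.restrict (Set.Icc (-1 : ℝ) 1)) := by
  rw [square, Measure.prod_restrict, Measure.volume_eq_prod]

theorem isCompact_square : IsCompact square := isCompact_Icc.prod isCompact_Icc

theorem measurableSet_square : MeasurableSet square := isCompact_square.measurableSet

theorem integrableOn_continuous_mul {W f : ℝ × ℝ → ℝ} (hW : IntegrableOn W square)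
    (hf : Continuous f) : IntegrableOn (fun p => f p * W p) square :=
  hW.continuousOn_mul hf.continuousOn isCompact_square

theorem integrableOn_jacobiWeight_mul {a b : ℝ} (ha : -1 < a) (hb : -1 < b) :
    IntegrableOn (fun q : ℝ × ℝ => jacobiWeight a b q.1 * jacobiWeight a b q.2) square := by
  rw [IntegrableOn, volume_restrict_square_eq_prod]
  exact (integrableOn_jacobiWeight ha hb).mul_prod (integrableOn_jacobiWeight ha hb)

theorem continuous_pointSym : Continuous pointSym := by unfold pointSym; fun_prop

theorem integrableOn_symWeight {a b : ℝ} (ha : -1 < a) (hb : -1 < b) (s : Sgn) :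
    IntegrableOn (symWeight a b s) square := by
  have := integrableOn_continuous_mul (integrableOn_jacobiWeight_mul ha hb)
    ((continuous_discUV s).comp continuous_pointSym)
  refine this.congr_fun (fun q _ => ?_) measurableSet_square
  simp only [symWeight, Function.comp]
  ring

theorem integrableOn_weight {a b : ℝ} (ha : -1 < a) (hb : -1 < b) (s : Sgn) :
    IntegrableOn (weight a b s) square := by
  have h := integrableOn_symWeight ha hb s
  rw [integrableOn_square_iff] at h ⊢
  have h1 : Integrable (fun q => weightUV a b s (pointSym q)) (arcsine.prod arcsine) := by
    refine h.congr ?_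
    filter_upwards [ae_arcsine_prod_mem] with q hq using sqrt_mul_symWeight_eq a b s hq
  have h2 := (integrable_map_measure (measurable_weightUV a b s).aestronglyMeasurable
    measurable_pointSym.aemeasurable).2 h1
  rw [← map_pointUV_arcsine] at h2
  have h3 := (integrable_map_measure (measurable_weightUV a b s).aestronglyMeasurable
    measurable_pointUV.aemeasurable).1 h2
  refine h3.congr ?_
  filter_upwards [ae_arcsine_prod_mem] with q hq using (sqrt_mul_weight_eq a b s hq).symm

/-- Integrals of products of polynomials in the separate variables. -/
theorem integral_square_mul_jacobiWeight (a b : ℝ) (f g : ℝ[X]) :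
    ∫ q in square, f.eval q.1 * g.eval q.2 * (jacobiWeight a b q.1 * jacobiWeight a b q.2) =
      jacobiInt a b f * jacobiInt a b g := by
  rw [volume_restrict_square_eq_prod]
  have := integral_prod_mul (μ := volume.restrict (Set.Icc (-1 : ℝ) 1))
    (ν := volume.restrict (Set.Icc (-1 : ℝ) 1))
    (fun t => f.eval t * jacobiWeight a b t) (fun t => g.eval t * jacobiWeight a b t)
  rw [jacobiInt, jacobiInt, intervalIntegral.integral_of_le (by norm_num),
    intervalIntegral.integral_of_le (by norm_num), ← integral_Icc_eq_integral_Ioc,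
    ← integral_Icc_eq_integral_Ioc, ← this]
  congr 1
  ext q
  ring


/-! ### Polynomials in two variables of bounded degree -/

/-- The span of the products `P^i Q^j` with `i + j < d`. -/
noncomputable def spanLT (P Q : Poly2) (d : ℕ) : Submodule ℝ Poly2 :=
  Submodule.span ℝ {f | ∃ i j : ℕ, i + j < d ∧ f = P ^ i * Q ^ j}

/-- The polynomials of total degree less than `d`. -/
noncomputable def degLT (d : ℕ) : Submodule ℝ Poly2 := spanLT (MvPolynomial.X 0) (MvPolynomial.X 1) d

theorem pow_mul_pow_mem_spanLT {P Q : Poly2} {i j d : ℕ} (h : i + j < d) :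
    P ^ i * Q ^ j ∈ spanLT P Q d := Submodule.subset_span ⟨i, j, h, rfl⟩

theorem spanLT_mono (P Q : Poly2) {d e : ℕ} (h : d ≤ e) : spanLT P Q d ≤ spanLT P Q e :=
  Submodule.span_mono fun _ ⟨i, j, hij, hf⟩ => ⟨i, j, by omega, hf⟩

theorem degLT_mono {d e : ℕ} (h : d ≤ e) : degLT d ≤ degLT e := spanLT_mono _ _ h

theorem spanLT_le {P Q : Poly2} {d : ℕ} {S : Submodule ℝ Poly2}
    (h : ∀ i j, i + j < d → P ^ i * Q ^ j ∈ S) : spanLT P Q d ≤ S :=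
  Submodule.span_le.2 fun _ ⟨i, j, hij, hf⟩ => hf ▸ h i j hij

theorem mul_mem_spanLT {P Q : Poly2} {d e : ℕ} {f g : Poly2} (hf : f ∈ spanLT P Q (d + 1))
    (hg : g ∈ spanLT P Q e) : f * g ∈ spanLT P Q (d + e) := by
  have h1 : spanLT P Q e ≤ (spanLT P Q (d + e)).comap (LinearMap.mulLeft ℝ f) := by
    refine spanLT_le fun i j hij => ?_
    have h2 : spanLT P Q (d + 1) ≤
        (spanLT P Q (d + e)).comap (LinearMap.mulRight ℝ (P ^ i * Q ^ j)) := by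
      refine spanLT_le fun k l hkl => ?_
      have : P ^ k * Q ^ l * (P ^ i * Q ^ j) = P ^ (k + i) * Q ^ (l + j) := by ring
      simp only [Submodule.mem_comap, LinearMap.mulRight_apply, this]
      exact pow_mul_pow_mem_spanLT (by omega)
    exact h2 hf
  exact h1 hg

theorem mul_mem_degLT {d e : ℕ} {f g : Poly2} (hf : f ∈ degLT (d + 1)) (hg : g ∈ degLT e) :
    f * g ∈ degLT (d + e) := mul_mem_spanLT hf hg

theorem one_mem_degLT : (1 : Poly2) ∈ degLT 1 := by
  simpa [degLT] using pow_mul_pow_mem_spanLT (P := MvPolynomial.X 0) (Q := MvPolynomial.X 1)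
    (show 0 + 0 < 1 by omega)

theorem C_mem_degLT (c : ℝ) : (MvPolynomial.C c : Poly2) ∈ degLT 1 := by
  have := (degLT 1).smul_mem c one_mem_degLT
  rwa [MvPolynomial.smul_eq_C_mul, mul_one] at this

theorem X_mem_degLT (i : Fin 2) : (MvPolynomial.X i : Poly2) ∈ degLT 2 := by
  fin_cases i
  · simpa [degLT] using pow_mul_pow_mem_spanLT (P := MvPolynomial.X 0) (Q := MvPolynomial.X 1)
      (show 1 + 0 < 2 by omega)
  · simpa [degLT] using pow_mul_pow_mem_spanLT (P := MvPolynomial.X 0) (Q := MvPolynomial.X 1)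
      (show 0 + 1 < 2 by omega)

theorem pow_mem_degLT {f : Poly2} {e : ℕ} (hf : f ∈ degLT (e + 1)) (k : ℕ) :
    f ^ k ∈ degLT (e * k + 1) := by
  induction k with
  | zero => simpa using one_mem_degLT
  | succ k ih =>
    rw [pow_succ']
    refine degLT_mono ?_ (mul_mem_degLT hf ih)
    rw [Nat.mul_succ]; omega

theorem mem_degLT_of_totalDegree_lt {f : Poly2} {d : ℕ} (h : f.totalDegree < d) :
    f ∈ degLT d := by
  rw [f.as_sum]
  refine Submodule.sum_mem _ fun μ hμ => ?_
  have hdeg : μ 0 + μ 1 < d := by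
    refine lt_of_le_of_lt ?_ h
    have := MvPolynomial.le_totalDegree hμ
    rwa [Finsupp.sum_fintype _ _ (fun _ => rfl), Fin.sum_univ_two] at this
  rw [MvPolynomial.monomial_eq, ← MvPolynomial.smul_eq_C_mul,
    Finsupp.prod_fintype _ _ (fun _ => pow_zero _), Fin.prod_univ_two]
  exact Submodule.smul_mem _ _ (pow_mul_pow_mem_spanLT hdeg)

theorem totalDegree_lt_of_mem_degLT {f : Poly2} {d : ℕ} (h : f ∈ degLT (d + 1)) :
    f.totalDegree < d + 1 := by
  have : degLT (d + 1) ≤ MvPolynomial.restrictTotalDegree (Fin 2) ℝ d := by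
    refine spanLT_le fun i j hij => ?_
    rw [MvPolynomial.mem_restrictTotalDegree]
    refine (MvPolynomial.totalDegree_mul _ _).trans ?_
    rw [MvPolynomial.totalDegree_X_pow, MvPolynomial.totalDegree_X_pow]
    omega
  have := this h
  rw [MvPolynomial.mem_restrictTotalDegree] at this
  omega

/-- If the substitution of `P, Q` has an inverse of degree one, then the products `P^i Q^j` span
the same spaces as the monomials. -/
theorem degLT_le_spanLT {P Q P' Q' : Poly2} (hP' : P' ∈ degLT 2) (hQ' : Q' ∈ degLT 2)
    (h0 : MvPolynomial.aeval ![P, Q] P' = MvPolynomial.X 0)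
    (h1 : MvPolynomial.aeval ![P, Q] Q' = MvPolynomial.X 1) (d : ℕ) : degLT d ≤ spanLT P Q d := by
  have key : ∀ e, degLT e ≤
      (spanLT P Q e).comap (MvPolynomial.aeval ![P, Q] : Poly2 →ₐ[ℝ] Poly2).toLinearMap := by
    intro e
    refine spanLT_le fun i j hij => ?_
    simpa using pow_mul_pow_mem_spanLT hij
  refine spanLT_le fun i j hij => ?_
  have h2 : P' ^ i * Q' ^ j ∈ degLT (i + j + 1) := by
    have := mul_mem_degLT (pow_mem_degLT (e := 1) hP' i) (pow_mem_degLT (e := 1) hQ' j)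
    exact degLT_mono (by omega) this
  have h3 := key _ h2
  simp only [Submodule.mem_comap, AlgHom.toLinearMap_apply, map_mul, map_pow, h0, h1] at h3
  exact spanLT_mono _ _ (by omega) h3

theorem spanLT_le_degLT {P Q : Poly2} (hP : P ∈ degLT 2) (hQ : Q ∈ degLT 2) (d : ℕ) :
    spanLT P Q d ≤ degLT d := by
  refine spanLT_le fun i j hij => ?_
  have := mul_mem_degLT (pow_mem_degLT (e := 1) hP i) (pow_mem_degLT (e := 1) hQ j)
  exact degLT_mono (by omega) this

/-- The polynomial `x + y`. -/
noncomputable def sumXY : Poly2 := MvPolynomial.X 0 + MvPolynomial.X 1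

/-- The polynomial `x - y`. -/
noncomputable def diffXY : Poly2 := MvPolynomial.X 0 - MvPolynomial.X 1

/-- The polynomial `1 + u + v`, which is `(x + y)²` for `u = 2xy`, `v = x² + y² - 1`. -/
noncomputable def sqSumUV : Poly2 := 1 + MvPolynomial.X 0 + MvPolynomial.X 1

/-- The polynomial `1 - u + v`, which is `(x - y)²` for `u = 2xy`, `v = x² + y² - 1`. -/
noncomputable def sqDiffUV : Poly2 := 1 - MvPolynomial.X 0 + MvPolynomial.X 1

theorem C_mul_mem {S : Submodule ℝ Poly2} (c : ℝ) {f : Poly2} (hf : f ∈ S) :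
    MvPolynomial.C c * f ∈ S := by
  rw [← MvPolynomial.smul_eq_C_mul]; exact S.smul_mem c hf

theorem sumXY_mem : sumXY ∈ degLT 2 := add_mem (X_mem_degLT 0) (X_mem_degLT 1)

theorem diffXY_mem : diffXY ∈ degLT 2 := sub_mem (X_mem_degLT 0) (X_mem_degLT 1)

theorem sqSumUV_mem : sqSumUV ∈ degLT 2 :=
  add_mem (add_mem (degLT_mono (by omega) one_mem_degLT) (X_mem_degLT 0)) (X_mem_degLT 1)

theorem sqDiffUV_mem : sqDiffUV ∈ degLT 2 :=
  add_mem (sub_mem (degLT_mono (by omega) one_mem_degLT) (X_mem_degLT 0)) (X_mem_degLT 1)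

theorem C_half_mul_two : (MvPolynomial.C (1 / 2) : Poly2) * 2 = 1 := by
  rw [show (2 : Poly2) = MvPolynomial.C 2 from rfl, ← MvPolynomial.C_mul]
  norm_num

theorem degLT_eq_sumXY_diffXY (d : ℕ) : degLT d = spanLT sumXY diffXY d := by
  refine le_antisymm (degLT_le_spanLT
    (P' := MvPolynomial.C (1 / 2) * (MvPolynomial.X 0 + MvPolynomial.X 1))
    (Q' := MvPolynomial.C (1 / 2) * (MvPolynomial.X 0 - MvPolynomial.X 1))
    (C_mul_mem _ sumXY_mem) (C_mul_mem _ diffXY_mem) ?_ ?_ d)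
    (spanLT_le_degLT sumXY_mem diffXY_mem d)
  · simp only [map_mul, map_add, MvPolynomial.aeval_X, MvPolynomial.algHom_C,
      MvPolynomial.algebraMap_eq]
    simp only [Matrix.cons_val_zero, Matrix.cons_val_one, sumXY, diffXY]
    linear_combination MvPolynomial.X 0 * C_half_mul_two
  · simp only [map_mul, map_sub, MvPolynomial.aeval_X, MvPolynomial.algHom_C,
      MvPolynomial.algebraMap_eq]
    simp only [Matrix.cons_val_zero, Matrix.cons_val_one, sumXY, diffXY]
    linear_combination MvPolynomial.X 1 * C_half_mul_two

theorem degLT_eq_sqSumUV_sqDiffUV (d : ℕ) : degLT d = spanLT sqSumUV sqDiffUV d := by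
  refine le_antisymm (degLT_le_spanLT
    (P' := MvPolynomial.C (1 / 2) * (MvPolynomial.X 0 - MvPolynomial.X 1))
    (Q' := MvPolynomial.C (1 / 2) * (MvPolynomial.X 0 + MvPolynomial.X 1) - 1)
    (C_mul_mem _ diffXY_mem) (sub_mem (C_mul_mem _ sumXY_mem)
      (degLT_mono (by omega) one_mem_degLT)) ?_ ?_ d)
    (spanLT_le_degLT sqSumUV_mem sqDiffUV_mem d)
  · simp only [map_mul, map_sub, MvPolynomial.aeval_X, MvPolynomial.algHom_C,
      MvPolynomial.algebraMap_eq]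
    simp only [Matrix.cons_val_zero, Matrix.cons_val_one, sqSumUV, sqDiffUV]
    linear_combination MvPolynomial.X 0 * C_half_mul_two
  · simp only [map_mul, map_sub, map_add, map_one, MvPolynomial.aeval_X, MvPolynomial.algHom_C,
      MvPolynomial.algebraMap_eq]
    simp only [Matrix.cons_val_zero, Matrix.cons_val_one, sqSumUV, sqDiffUV]
    linear_combination (1 + MvPolynomial.X 1) * C_half_mul_two

/-- The substitution `substUV` as a homomorphism of algebras. -/
noncomputable def substUVHom : Poly2 →ₐ[ℝ] Poly2 :=
  MvPolynomial.aeval ![2 * MvPolynomial.X 0 * MvPolynomial.X 1,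
    MvPolynomial.X 0 ^ 2 + MvPolynomial.X 1 ^ 2 - 1]

theorem substUV_eq (P : Poly2) : substUV P = substUVHom P := rfl

theorem substUVHom_sqSumUV : substUVHom sqSumUV = sumXY ^ 2 := by
  simp [substUVHom, sqSumUV, sumXY]; ring

theorem substUVHom_sqDiffUV : substUVHom sqDiffUV = diffXY ^ 2 := by
  simp [substUVHom, sqDiffUV, diffXY]; ring

theorem evalAt_substUV (p : ℝ × ℝ) (P : Poly2) : evalAt p (substUV P) = evalAt (pointUV p) P := by
  unfold evalAt substUV
  rw [← MvPolynomial.coe_aeval_eq_eval, ← MvPolynomial.coe_aeval_eq_eval]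
  change (MvPolynomial.aeval ![p.1, p.2]) ((MvPolynomial.aeval _) P) = (MvPolynomial.aeval _) P
  rw [← AlgHom.comp_apply]
  congr 1
  apply MvPolynomial.algHom_ext
  intro i
  fin_cases i <;> simp [pointUV]

/-- Evaluation at a point as a homomorphism of algebras. -/
noncomputable def evalHom (p : ℝ × ℝ) : Poly2 →ₐ[ℝ] ℝ := MvPolynomial.aeval ![p.1, p.2]

theorem evalAt_eq (p : ℝ × ℝ) (f : Poly2) : evalAt p f = evalHom p f := by
  rw [evalAt, evalHom, ← MvPolynomial.coe_aeval_eq_eval]; rfl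

theorem evalHom_X0 (p : ℝ × ℝ) : evalHom p (MvPolynomial.X 0) = p.1 := by simp [evalHom]
theorem evalHom_X1 (p : ℝ × ℝ) : evalHom p (MvPolynomial.X 1) = p.2 := by simp [evalHom]
theorem evalHom_C (p : ℝ × ℝ) (c : ℝ) : evalHom p (MvPolynomial.C c) = c := by simp [evalHom]
theorem evalHom_sumXY (p : ℝ × ℝ) : evalHom p sumXY = p.1 + p.2 := by
  simp [sumXY, evalHom_X0, evalHom_X1]
theorem evalHom_diffXY (p : ℝ × ℝ) : evalHom p diffXY = p.1 - p.2 := by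
  simp [diffXY, evalHom_X0, evalHom_X1]

theorem evalHom_substUV (p : ℝ × ℝ) (P : Poly2) :
    evalHom p (substUV P) = evalHom (pointUV p) P := by
  rw [← evalAt_eq, ← evalAt_eq, evalAt_substUV]

theorem continuous_evalAt (f : Poly2) : Continuous fun p => evalAt p f := by
  unfold evalAt
  refine (MvPolynomial.continuous_eval f).comp ?_
  refine continuous_pi fun i => ?_
  fin_cases i
  · exact continuous_fst
  · exact continuous_snd

/-- Substituting `u = 2xy`, `v = x² + y² - 1` doubles degrees. -/
theorem mul_substUV_mem_degLT {P F : Poly2} {d : ℕ} (hP : P ∈ degLT 2) (hF : F ∈ degLT d) :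
    P * substUV F ∈ degLT (2 * d) := by
  have : degLT d ≤ ((degLT (2 * d)).comap (LinearMap.mulLeft ℝ P)).comap
      substUVHom.toLinearMap := by
    rw [degLT_eq_sqSumUV_sqDiffUV]
    refine spanLT_le fun i j hij => ?_
    simp only [Submodule.mem_comap, AlgHom.toLinearMap_apply, map_mul, map_pow,
      LinearMap.mulLeft_apply, substUVHom_sqSumUV, substUVHom_sqDiffUV, ← pow_mul]
    have h := mul_mem_degLT hP (mul_mem_degLT (pow_mem_degLT (e := 1) sumXY_mem (2 * i))
      (pow_mem_degLT (e := 1) diffXY_mem (2 * j)))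
    exact degLT_mono (by omega) h
  exact this hF


/-! ### Symmetries of the weight and the integration functional -/

theorem integrableOn_evalAt_mul {α β : ℝ} (hα : -1 < α) (hβ : -1 < β) (s : Sgn) (f : Poly2) :
    IntegrableOn (fun p => evalAt p f * weight α β s p) square :=
  integrableOn_continuous_mul (integrableOn_weight hα hβ s) (continuous_evalAt f)

section

variable {α β : ℝ} (hα : -1 < α) (hβ : -1 < β) (s : Sgn)

/-- The integral of a polynomial against the weight, as a linear functional. -/
noncomputable def weightInt : Poly2 →ₗ[ℝ] ℝ where
  toFun f := ∫ p in square, evalAt p f * weight α β s p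
  map_add' f g := by
    rw [← integral_add (integrableOn_evalAt_mul hα hβ s f) (integrableOn_evalAt_mul hα hβ s g)]
    simp only [evalAt_eq, map_add, add_mul]
  map_smul' c f := by
    rw [RingHom.id_apply, smul_eq_mul, ← integral_const_mul]
    simp only [evalAt_eq, map_smul, smul_eq_mul, mul_assoc]

theorem weightInt_apply (f : Poly2) :
    weightInt hα hβ s f = ∫ p in square, evalAt p f * weight α β s p := rfl

end

theorem integral_square_swap (g : ℝ × ℝ → ℝ) :
    ∫ p in square, g (p.2, p.1) = ∫ p in square, g p := by
  have h := (Measure.measurePreserving_swap (μ := (volume : Measure ℝ))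
    (ν := (volume : Measure ℝ))).setIntegral_preimage_emb
    (MeasurableEquiv.prodComm (α := ℝ) (β := ℝ)).measurableEmbedding g square
  rw [← Measure.volume_eq_prod] at h
  rw [← h]
  congr 2
  ext p
  simp only [square, Set.mem_prod, Set.mem_preimage, Prod.fst_swap, Prod.snd_swap, and_comm]

theorem integral_square_neg (g : ℝ × ℝ → ℝ) :
    ∫ p in square, g (-p) = ∫ p in square, g p := by
  have h := (Measure.measurePreserving_neg (volume : Measure (ℝ × ℝ))).setIntegral_preimage_emb
    (MeasurableEquiv.neg (ℝ × ℝ)).measurableEmbedding g square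
  rw [← h]
  congr 2
  ext p
  simp only [square, Set.mem_prod, Set.mem_preimage, Prod.fst_neg, Prod.snd_neg, Set.mem_Icc]
  constructor <;> rintro ⟨⟨h1, h2⟩, h3, h4⟩ <;> refine ⟨⟨?_, ?_⟩, ?_, ?_⟩ <;> linarith

theorem weight_swap (α β : ℝ) (s : Sgn) (p : ℝ × ℝ) :
    weight α β s (p.2, p.1) = weight α β s p := by
  simp only [weight]
  rw [abs_sub_comm, add_comm p.2]
  ring

theorem weight_neg (α β : ℝ) (s : Sgn) (p : ℝ × ℝ) : weight α β s (-p) = weight α β s p := by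
  simp only [weight, Prod.fst_neg, Prod.snd_neg, neg_sq]
  rw [show -p.1 - -p.2 = -(p.1 - p.2) by ring, show -p.1 + -p.2 = -(p.1 + p.2) by ring, abs_neg,
    abs_neg]

theorem rpow_add_two {t c : ℝ} (hc : -1 < c) :
    |t| ^ (2 * (c + 1) + 1) = t ^ 2 * |t| ^ (2 * c + 1) := by
  rcases eq_or_ne t 0 with rfl | ht
  · rw [abs_zero, Real.zero_rpow (by linarith)]; simp
  · rw [show 2 * (c + 1) + 1 = 2 + (2 * c + 1) by ring, Real.rpow_add (abs_pos.2 ht), ← sq_abs t]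
    norm_num

theorem sq_sub_mul_weight {α : ℝ} (hα : -1 < α) (β : ℝ) (s : Sgn) (p : ℝ × ℝ) :
    (p.1 - p.2) ^ 2 * weight α β s p = weight (α + 1) β s p := by
  simp only [weight, rpow_add_two hα]
  ring

theorem sq_add_mul_weight (α : ℝ) {β : ℝ} (hβ : -1 < β) (s : Sgn) (p : ℝ × ℝ) :
    (p.1 + p.2) ^ 2 * weight α β s p = weight α (β + 1) s p := by
  simp only [weight, rpow_add_two hβ]
  ring

/-! ### Orthogonality -/

/-- The symmetric or alternating combination of two polynomials that belongs to the sign. -/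
noncomputable def pairPoly : Sgn → ℝ[X] → ℝ[X] → Poly2
  | .minus, f, g => symPair f g
  | .plus, f, g => altPair f g

/-- The degree `m` or `m + 1` of the Jacobi polynomials whose zeros generate the nodes. -/
def topDeg : Sgn → ℕ → ℕ
  | .minus, m => m
  | .plus, m => m + 1

/-- `pairPoly s f g` is orthogonal, in the coordinates `u, v`, to all polynomials of degree less
than `m`, if `f` is orthogonal to all polynomials of degree less than `topDeg s m`. -/
theorem integral_pairPoly {a b : ℝ} (ha : -1 < a) (hb : -1 < b) (s : Sgn) {m : ℕ} {f : ℝ[X]}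
    (hf : ∀ q : ℝ[X], q.degree < topDeg s m → jacobiInt a b (f * q) = 0) (g : ℝ[X]) {i j : ℕ}
    (hij : i + j < m) :
    ∫ p in square, evalAt (pointUV p) (pairPoly s f g * sqSumUV ^ i * sqDiffUV ^ j) *
      weight a b s p = 0 := by
  rw [integral_pointUV_mul_weight a b s (continuous_evalAt _).measurable]
  set r : ℝ[X] := (1 + X) ^ i * (1 - X) ^ j with hr
  have hrdeg : r.natDegree ≤ i + j := by
    rw [hr]; compute_degree
  have hr0 : r ≠ 0 := by
    refine mul_ne_zero (pow_ne_zero _ ?_) (pow_ne_zero _ ?_)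
    · intro h; simpa using congrArg (eval 1) h
    · intro h; simpa using congrArg (eval 0) h
  have hint : ∀ f g : ℝ[X], IntegrableOn (fun q : ℝ × ℝ =>
      f.eval q.1 * g.eval q.2 * (jacobiWeight a b q.1 * jacobiWeight a b q.2)) square :=
    fun f g => integrableOn_continuous_mul (integrableOn_jacobiWeight_mul ha hb)
      ((f.continuous.comp continuous_fst).mul (g.continuous.comp continuous_snd))
  have hint2 : ∀ f g f' g' : ℝ[X], IntegrableOn (fun q : ℝ × ℝ =>
      f.eval q.1 * g.eval q.2 * (jacobiWeight a b q.1 * jacobiWeight a b q.2) -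
      f'.eval q.1 * g'.eval q.2 * (jacobiWeight a b q.1 * jacobiWeight a b q.2)) square :=
    fun f g f' g' => (hint f g).sub (hint f' g')
  have hev : ∀ q : ℝ × ℝ, evalHom (pointSym q) sqSumUV ^ i * evalHom (pointSym q) sqDiffUV ^ j =
      r.eval q.1 * r.eval q.2 := by
    intro q
    have e1 : evalHom (pointSym q) sqSumUV = (1 + q.1) * (1 + q.2) := by
      simp [sqSumUV, evalHom_X0, evalHom_X1, pointSym]; ring
    have e2 : evalHom (pointSym q) sqDiffUV = (1 - q.1) * (1 - q.2) := by
      simp [sqDiffUV, evalHom_X0, evalHom_X1, pointSym]; ring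
    rw [e1, e2, hr]
    simp only [eval_mul, eval_pow, eval_add, eval_sub, eval_one, eval_X, mul_pow]
    ring
  cases s with
  | minus =>
    have h1 : jacobiInt a b (f * r) = 0 := hf r <| by
      rw [degree_eq_natDegree hr0]; exact_mod_cast hrdeg.trans_lt hij
    have e : ∀ q : ℝ × ℝ, evalAt (pointSym q) (pairPoly .minus f g * sqSumUV ^ i * sqDiffUV ^ j) *
        symWeight a b .minus q =
        (f * r).eval q.1 * (g * r).eval q.2 * (jacobiWeight a b q.1 * jacobiWeight a b q.2) +
        (g * r).eval q.1 * (f * r).eval q.2 * (jacobiWeight a b q.1 * jacobiWeight a b q.2) := by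
      intro q
      have h2 := evalAt_symPair f g q.1 q.2
      rw [evalAt_eq, map_mul, map_mul, map_pow, map_pow, mul_assoc (evalHom _ _), hev, ← evalAt_eq]
      simp only [pairPoly, pointSym, h2, symWeight, discUV, eval_mul]
      ring
    simp only [e]
    rw [integral_add (hint _ _) (hint _ _), integral_square_mul_jacobiWeight,
      integral_square_mul_jacobiWeight, h1]
    simp
  | plus =>
    have h1 : jacobiInt a b (f * r) = 0 := hf r <| by
      rw [degree_eq_natDegree hr0]
      exact_mod_cast hrdeg.trans_lt (hij.trans (Nat.lt_succ_self m))
    have h2 : jacobiInt a b (f * (X * r)) = 0 := hf _ <| by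
      rw [degree_eq_natDegree (mul_ne_zero X_ne_zero hr0), natDegree_X_mul hr0]
      exact_mod_cast Nat.add_lt_add_right (hrdeg.trans_lt hij) 1
    have e : ∀ q : ℝ × ℝ, evalAt (pointSym q) (pairPoly .plus f g * sqSumUV ^ i * sqDiffUV ^ j) *
        symWeight a b .plus q = 1 / 4 *
        (((f * (X * r)).eval q.1 * (g * r).eval q.2 *
            (jacobiWeight a b q.1 * jacobiWeight a b q.2) -
          (f * r).eval q.1 * (g * (X * r)).eval q.2 *
            (jacobiWeight a b q.1 * jacobiWeight a b q.2)) -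
          ((g * (X * r)).eval q.1 * (f * r).eval q.2 *
            (jacobiWeight a b q.1 * jacobiWeight a b q.2) -
          (g * r).eval q.1 * (f * (X * r)).eval q.2 *
            (jacobiWeight a b q.1 * jacobiWeight a b q.2))) := by
      intro q
      have h2 := evalAt_altPair f g q.1 q.2
      rw [evalAt_eq, map_mul, map_mul, map_pow, map_pow, mul_assoc (evalHom _ _), hev, ← evalAt_eq]
      simp only [pairPoly, pointSym, symWeight, discUV, eval_mul, eval_X]
      linear_combination (r.eval q.1 * r.eval q.2 * jacobiWeight a b q.1 * jacobiWeight a b q.2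
        * (q.1 - q.2) / 4) * h2
    simp only [e]
    rw [integral_const_mul, integral_sub (hint2 _ _ _ _) (hint2 _ _ _ _),
      integral_sub (hint _ _) (hint _ _), integral_sub (hint _ _) (hint _ _)]
    simp only [integral_square_mul_jacobiWeight, h1, h2]
    simp

/-- The constant by which `Q₂` differs from `(x - y)` times a symmetric pairing. -/
noncomputable def Q₂Const (α β : ℝ) (s : Sgn) (m k : ℕ) : ℝ :=
  Real.sqrt (normConst (α + 1) β s / normConst α β s) *
    match s with
    | .minus => if k = m then Real.sqrt 2 / 2 else 1
    | .plus => 1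

theorem Q₂_eq (α β : ℝ) (s : Sgn) (m k : ℕ) :
    Q₂ α β s m k = MvPolynomial.C (Q₂Const α β s m k) * (diffXY *
      substUV (pairPoly s (jacobi (α + 1) β (topDeg s m)) (jacobi (α + 1) β k))) := by
  cases s with
  | minus =>
    by_cases h : k = m
    · subst h
      simp only [Q₂, biJacobi, Q₂Const, pairPoly, topDeg, if_true, diffXY, substUV_eq, map_mul,
        MvPolynomial.algHom_C, MvPolynomial.algebraMap_eq]
      ring
    · simp only [Q₂, biJacobi, Q₂Const, pairPoly, topDeg, if_neg h, diffXY, mul_one]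
      ring
  | plus =>
    simp only [Q₂, biJacobi, Q₂Const, pairPoly, topDeg, diffXY, mul_one]
    ring

/-- The constant by which `qExtra` differs from `(x + y)` times a symmetric pairing. -/
def qConst : Sgn → ℝ
  | .minus => 1
  | .plus => 2

theorem qExtra_eq (α β : ℝ) (s : Sgn) (m : ℕ) :
    qExtra α β s m = MvPolynomial.C (qConst s) * (sumXY *
      substUV (pairPoly s (jacobi α (β + 1) (topDeg s m)) (jacobi (α + 1) β (topDeg s m)))) := by
  cases s with
  | minus => simp [qExtra, qConst, pairPoly, topDeg, sumXY]
  | plus =>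
    simp only [qExtra, qConst, pairPoly, topDeg, sumXY]
    rw [show (MvPolynomial.C 2 : Poly2) = 2 from rfl]
    ring

section

variable {α β : ℝ} (hα : -1 < α) (hβ : -1 < β) (s : Sgn)

/-- A function that changes sign under `(x, y) ↦ (y, x)` integrates to zero. -/
theorem weightInt_eq_zero_of_swap {f : Poly2} (h : ∀ p : ℝ × ℝ, evalAt (p.2, p.1) f = -evalAt p f) :
    weightInt hα hβ s f = 0 := by
  have h1 := integral_square_swap fun p => evalAt p f * weight α β s p
  simp only [h, weight_swap, neg_mul, integral_neg] at h1
  rw [weightInt_apply]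
  linarith

/-- A function that changes sign under `(x, y) ↦ (-x, -y)` integrates to zero. -/
theorem weightInt_eq_zero_of_neg {f : Poly2} (h : ∀ p : ℝ × ℝ, evalAt (-p) f = -evalAt p f) :
    weightInt hα hβ s f = 0 := by
  have h1 := integral_square_neg fun p => evalAt p f * weight α β s p
  simp only [h, weight_neg, neg_mul, integral_neg] at h1
  rw [weightInt_apply]
  linarith

theorem evalAt_pow_mul (F : Poly2) (i j : ℕ) (p : ℝ × ℝ) :
    evalAt p (substUV F * (sumXY ^ i * diffXY ^ j)) =
      evalAt (pointUV p) F * ((p.1 + p.2) ^ i * (p.1 - p.2) ^ j) := by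
  simp only [evalAt_eq, map_mul, map_pow, evalHom_substUV, evalHom_sumXY, evalHom_diffXY]

theorem weightInt_eq_zero_of_odd_right (F : Poly2) {i j : ℕ} (hj : Odd j) :
    weightInt hα hβ s (substUV F * (sumXY ^ i * diffXY ^ j)) = 0 := by
  refine weightInt_eq_zero_of_swap hα hβ s fun p => ?_
  rw [evalAt_pow_mul, evalAt_pow_mul]
  have h1 : pointUV (p.2, p.1) = pointUV p := by
    simp only [pointUV, Prod.mk.injEq]; constructor <;> ring
  rw [h1]
  simp only
  rw [show p.2 - p.1 = -(p.1 - p.2) by ring, hj.neg_pow, add_comm p.2]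
  ring

theorem weightInt_eq_zero_of_odd_left (F : Poly2) {i j : ℕ} (hi : Odd i) :
    weightInt hα hβ s (substUV F * (sumXY ^ i * diffXY ^ j)) = 0 := by
  rcases Nat.even_or_odd j with hj | hj
  · refine weightInt_eq_zero_of_neg hα hβ s fun p => ?_
    rw [evalAt_pow_mul, evalAt_pow_mul]
    have h1 : pointUV (-p) = pointUV p := by
      simp only [pointUV, Prod.mk.injEq, Prod.fst_neg, Prod.snd_neg]; constructor <;> ring
    rw [h1, Prod.fst_neg, Prod.snd_neg]
    rw [show -p.1 - -p.2 = -(p.1 - p.2) by ring, show -p.1 + -p.2 = -(p.1 + p.2) by ring,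
      hi.neg_pow, hj.neg_pow]
    ring
  · exact weightInt_eq_zero_of_odd_right hα hβ s F hj

theorem weightInt_Q₂_mul (m k : ℕ) {g : Poly2} (hg : g ∈ degLT (2 * m + 1)) :
    weightInt hα hβ s (Q₂ α β s m k * g) = 0 := by
  have hα1 : -1 < α + 1 := by linarith
  rw [Q₂_eq, ← MvPolynomial.smul_eq_C_mul, smul_mul_assoc, map_smul]
  refine smul_eq_zero_of_right _ ?_
  set F := pairPoly s (jacobi (α + 1) β (topDeg s m)) (jacobi (α + 1) β k) with hF
  have : degLT (2 * m + 1) ≤ LinearMap.ker ((weightInt hα hβ s).comp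
      (LinearMap.mulLeft ℝ (diffXY * substUV F))) := by
    rw [degLT_eq_sumXY_diffXY]
    refine spanLT_le fun i j hij => ?_
    rw [LinearMap.mem_ker, LinearMap.comp_apply, LinearMap.mulLeft_apply]
    have e : diffXY * substUV F * (sumXY ^ i * diffXY ^ j) =
        substUV F * (sumXY ^ i * diffXY ^ (j + 1)) := by ring
    rw [e]
    rcases Nat.even_or_odd j with hj | hj
    · exact weightInt_eq_zero_of_odd_right hα hβ s F hj.add_one
    rcases Nat.even_or_odd i with hi | hi
    swap
    · exact weightInt_eq_zero_of_odd_left hα hβ s F hi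
    obtain ⟨i, rfl⟩ := hi
    obtain ⟨j, rfl⟩ := hj
    rw [← integral_pairPoly hα1 hβ s (jacobiInt_jacobi_mul hα1 hβ (topDeg s m))
      (jacobi (α + 1) β k) (show i + j < m by omega), weightInt_apply]
    refine integral_congr_ae (Filter.Eventually.of_forall fun p => ?_)
    simp only [← sq_sub_mul_weight hα, ← hF]
    rw [evalAt_pow_mul]
    simp only [evalAt_eq, map_mul, map_pow]
    rw [← evalHom_substUV p sqSumUV, ← evalHom_substUV p sqDiffUV, substUV_eq, substUV_eq,
      substUVHom_sqSumUV, substUVHom_sqDiffUV, map_pow, map_pow, evalHom_sumXY, evalHom_diffXY,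
      ← pow_mul, ← pow_mul]
    ring
  exact this hg

theorem weightInt_qExtra_mul (m : ℕ) {g : Poly2} (hg : g ∈ degLT (2 * m + 1)) :
    weightInt hα hβ s (qExtra α β s m * g) = 0 := by
  have hβ1 : -1 < β + 1 := by linarith
  rw [qExtra_eq, ← MvPolynomial.smul_eq_C_mul, smul_mul_assoc, map_smul]
  refine smul_eq_zero_of_right _ ?_
  set F := pairPoly s (jacobi α (β + 1) (topDeg s m)) (jacobi (α + 1) β (topDeg s m)) with hF
  have : degLT (2 * m + 1) ≤ LinearMap.ker ((weightInt hα hβ s).comp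
      (LinearMap.mulLeft ℝ (sumXY * substUV F))) := by
    rw [degLT_eq_sumXY_diffXY]
    refine spanLT_le fun i j hij => ?_
    rw [LinearMap.mem_ker, LinearMap.comp_apply, LinearMap.mulLeft_apply]
    have e : sumXY * substUV F * (sumXY ^ i * diffXY ^ j) =
        substUV F * (sumXY ^ (i + 1) * diffXY ^ j) := by ring
    rw [e]
    rcases Nat.even_or_odd i with hi | hi
    · exact weightInt_eq_zero_of_odd_left hα hβ s F hi.add_one
    rcases Nat.even_or_odd j with hj | hj
    swap
    · exact weightInt_eq_zero_of_odd_right hα hβ s F hj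
    obtain ⟨i, rfl⟩ := hi
    obtain ⟨j, rfl⟩ := hj
    rw [← integral_pairPoly hα hβ1 s (jacobiInt_jacobi_mul hα hβ1 (topDeg s m))
      (jacobi (α + 1) β (topDeg s m)) (show i + j < m by omega), weightInt_apply]
    refine integral_congr_ae (Filter.Eventually.of_forall fun p => ?_)
    simp only [← sq_add_mul_weight α hβ, ← hF]
    rw [evalAt_pow_mul]
    simp only [evalAt_eq, map_mul, map_pow]
    rw [← evalHom_substUV p sqSumUV, ← evalHom_substUV p sqDiffUV, substUV_eq, substUV_eq,
      substUVHom_sqSumUV, substUVHom_sqDiffUV, map_pow, map_pow, evalHom_sumXY, evalHom_diffXY,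
      ← pow_mul, ← pow_mul]
    ring
  exact this hg

/-- The generators are orthogonal to all polynomials of smaller degree. -/
theorem weightInt_generators_mul (m : ℕ) (i : Fin (m + 2)) {g : Poly2}
    (hg : g ∈ degLT (2 * m + 1)) : weightInt hα hβ s (generators α β s m i * g) = 0 := by
  refine Fin.cases ?_ (fun k => ?_) i
  · exact weightInt_qExtra_mul hα hβ s m hg
  · exact weightInt_Q₂_mul hα hβ s m k hg

/-! ### Positivity -/

theorem weight_nonneg {p : ℝ × ℝ} (hp : p ∈ square) (α β : ℝ) (s : Sgn) :
    0 ≤ weight α β s p := by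
  obtain ⟨⟨h1, h2⟩, h3, h4⟩ := hp
  have hX : 0 ≤ 1 - p.1 ^ 2 := by nlinarith
  have hY : 0 ≤ 1 - p.2 ^ 2 := by nlinarith
  unfold weight
  positivity

/-- An open box inside the square on which the weight is positive. -/
def box : Set (ℝ × ℝ) := Set.Ioo (1 / 2) 1 ×ˢ Set.Ioo 0 (1 / 2)

theorem box_subset : box ⊆ square := by
  rintro p ⟨⟨h1, h2⟩, h3, h4⟩
  refine ⟨⟨?_, ?_⟩, ?_, ?_⟩ <;> linarith

theorem weight_pos {p : ℝ × ℝ} (hp : p ∈ box) (α β : ℝ) (s : Sgn) : 0 < weight α β s p := by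
  obtain ⟨⟨h1, h2⟩, h3, h4⟩ := hp
  have hX : 0 < 1 - p.1 ^ 2 := by nlinarith
  have hY : 0 < 1 - p.2 ^ 2 := by nlinarith
  have hD : 0 < |p.1 - p.2| := abs_pos.2 (by linarith)
  have hS : 0 < |p.1 + p.2| := abs_pos.2 (by linarith)
  unfold weight
  positivity

theorem eq_zero_of_eval_box {f : Poly2} (h : ∀ p ∈ box, evalAt p f = 0) : f = 0 := by
  refine MvPolynomial.funext_set
    (fun i : Fin 2 => if i = 0 then Set.Ioo (1 / 2 : ℝ) 1 else Set.Ioo (0 : ℝ) (1 / 2)) ?_ ?_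
  · intro i
    fin_cases i
    · exact Set.Ioo_infinite (by norm_num)
    · exact Set.Ioo_infinite (by norm_num)
  · intro x hx
    have h0 := hx 0 trivial
    have h1 := hx 1 trivial
    have := h (x 0, x 1) ⟨by simpa using h0, by simpa using h1⟩
    rw [map_zero, ← this, evalAt]
    congr 1
    congr 1
    ext i
    fin_cases i <;> rfl

theorem eq_zero_of_weightInt_sq {f : Poly2} (h : weightInt hα hβ s (f * f) = 0) : f = 0 := by
  rw [weightInt_apply, setIntegral_eq_zero_iff_of_nonneg_ae] at h
  · have h1 : ∀ᵐ p ∂volume.restrict box, evalAt p f = (fun _ => (0 : ℝ)) p := by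
      have h2 := ae_restrict_of_ae_restrict_of_subset box_subset h
      filter_upwards [h2, ae_restrict_mem (measurableSet_Ioo.prod measurableSet_Ioo)] with p hp hb
      have hw := (weight_pos hb α β s).ne'
      simpa [evalAt_eq, hw] using hp
    have hopen : IsOpen box := isOpen_Ioo.prod isOpen_Ioo
    have h3 := Measure.eqOn_open_of_ae_eq h1 hopen (continuous_evalAt f).continuousOn
      continuousOn_const
    exact eq_zero_of_eval_box fun p hp => h3 hp
  · filter_upwards [ae_restrict_mem measurableSet_square] with p hp
    rw [evalAt_eq, map_mul]
    exact mul_nonneg (mul_self_nonneg _) (weight_nonneg hp α β s)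
  · exact integrableOn_evalAt_mul hα hβ s _

theorem normConst_pos (hα : -1 < α) (hβ : -1 < β) (s : Sgn) : 0 < normConst α β s := by
  have h1 : weightInt hα hβ s 1 ≠ 0 := fun h =>
    one_ne_zero (eq_zero_of_weightInt_sq hα hβ s (f := 1) (by rwa [mul_one]))
  have h2 : weightInt hα hβ s 1 = ∫ p in square, weight α β s p := by
    rw [weightInt_apply]; simp [evalAt_eq]
  rw [h2] at h1
  have h3 : 0 ≤ ∫ p in square, weight α β s p :=
    setIntegral_nonneg measurableSet_square fun p hp => weight_nonneg hp α β s
  unfold normConst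
  have := lt_of_le_of_ne h3 h1.symm
  positivity

theorem Q₂Const_ne_zero (hα : -1 < α) (hβ : -1 < β) (s : Sgn) (m k : ℕ) :
    Q₂Const α β s m k ≠ 0 := by
  have h1 := normConst_pos hα hβ s
  have h2 := normConst_pos (α := α + 1) (by linarith) hβ s
  unfold Q₂Const
  refine mul_ne_zero (Real.sqrt_pos.2 (div_pos h2 h1)).ne' ?_
  cases s
  · simp only
    split_ifs <;> norm_num
  · norm_num

theorem qConst_ne_zero (s : Sgn) : qConst s ≠ 0 := by cases s <;> simp [qConst]

end


/-! ### Leading forms -/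

theorem powSum_mem_degLT : ∀ k, powSum k ∈ degLT (k + 1)
  | 0 => C_mem_degLT 2
  | 1 => X_mem_degLT 0
  | k + 2 => by
    rw [powSum]
    refine sub_mem ?_ ?_
    · exact degLT_mono (by omega) (mul_mem_degLT (X_mem_degLT 0) (powSum_mem_degLT (k + 1)))
    · exact degLT_mono (by omega) (mul_mem_degLT (X_mem_degLT 1) (powSum_mem_degLT k))

theorem powSum_sub_mem_degLT (k : ℕ) :
    powSum (k + 1) - MvPolynomial.X 0 ^ (k + 1) ∈ degLT (k + 1) := by
  induction k with
  | zero => simp [powSum]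
  | succ k ih =>
    have e : powSum (k + 2) - MvPolynomial.X 0 ^ (k + 2) = MvPolynomial.X 0 *
        (powSum (k + 1) - MvPolynomial.X 0 ^ (k + 1)) - MvPolynomial.X 1 * powSum k := by
      rw [powSum]; ring
    rw [e]
    refine sub_mem ?_ ?_
    · exact degLT_mono (by omega) (mul_mem_degLT (X_mem_degLT 0) ih)
    · exact degLT_mono (by omega) (mul_mem_degLT (X_mem_degLT 1) (powSum_mem_degLT k))

theorem powDiff_mem_degLT : ∀ k, powDiff k ∈ degLT k
  | 0 => by simp [powDiff]
  | 1 => one_mem_degLT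
  | k + 2 => by
    rw [powDiff]
    refine sub_mem ?_ ?_
    · exact degLT_mono (by omega) (mul_mem_degLT (X_mem_degLT 0) (powDiff_mem_degLT (k + 1)))
    · exact degLT_mono (by omega) (mul_mem_degLT (X_mem_degLT 1) (powDiff_mem_degLT k))

theorem powDiff_sub_mem_degLT (k : ℕ) : powDiff (k + 1) - MvPolynomial.X 0 ^ k ∈ degLT k := by
  induction k with
  | zero => simp [powDiff]
  | succ k ih =>
    have e : powDiff (k + 2) - MvPolynomial.X 0 ^ (k + 1) = MvPolynomial.X 0 *
        (powDiff (k + 1) - MvPolynomial.X 0 ^ k) - MvPolynomial.X 1 * powDiff k := by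
      rw [powDiff]; ring
    rw [e]
    refine sub_mem ?_ ?_
    · exact degLT_mono (by omega) (mul_mem_degLT (X_mem_degLT 0) ih)
    · exact degLT_mono (by omega) (mul_mem_degLT (X_mem_degLT 1) (powDiff_mem_degLT k))

/-- The monomial `v^j u^(m-j)`. -/
noncomputable def topMono (m j : ℕ) : Poly2 := MvPolynomial.X 1 ^ j * MvPolynomial.X 0 ^ (m - j)

theorem X1_pow_mul_mem {f : Poly2} {e : ℕ} (hf : f ∈ degLT e) (j : ℕ) :
    MvPolynomial.X 1 ^ j * f ∈ degLT (j + e) :=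
  degLT_mono (by omega) (mul_mem_degLT (pow_mem_degLT (e := 1) (X_mem_degLT 1) j) hf)

theorem symMono_sub_mem_degLT {m i j : ℕ} (hi : i ≤ m) (hj : j ≤ m) :
    symMono i j - ((if i = m then topMono m j else 0) + if j = m then topMono m i else 0)
      ∈ degLT m := by
  have key : ∀ k < m, MvPolynomial.X 1 ^ k * powSum (m - k) - topMono m k ∈ degLT m := by
    intro k hk
    obtain ⟨d, rfl⟩ := Nat.exists_eq_add_of_lt hk
    rw [topMono, show k + d + 1 - k = d + 1 by omega, ← mul_sub]
    exact degLT_mono (by omega) (X1_pow_mul_mem (powSum_sub_mem_degLT d) k)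
  by_cases h1 : i = m
  · subst h1
    by_cases h2 : j = i
    · subst h2
      simp [symMono, topMono, powSum, mul_two]
    · simp only [symMono, if_pos hj, if_true, if_neg h2, add_zero]
      exact key j (lt_of_le_of_ne hj h2)
  · by_cases h2 : j = m
    · subst h2
      simp only [symMono, if_neg (show ¬ j ≤ i by omega), if_true, if_neg h1, zero_add]
      exact key i (lt_of_le_of_ne hi h1)
    · simp only [if_neg h1, if_neg h2, add_zero, sub_zero, symMono]
      split_ifs with h
      · exact degLT_mono (by omega) (X1_pow_mul_mem (powSum_mem_degLT (i - j)) j)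
      · exact degLT_mono (by omega) (X1_pow_mul_mem (powSum_mem_degLT (j - i)) i)

theorem altMono_sub_mem_degLT {m i j : ℕ} (hi : i ≤ m + 1) (hj : j ≤ m) :
    altMono i j - (if i = m + 1 then topMono m j else 0) ∈ degLT m := by
  by_cases h1 : i = m + 1
  · subst h1
    simp only [altMono, if_pos (show j ≤ m + 1 by omega), if_true]
    obtain ⟨d, rfl⟩ := Nat.exists_eq_add_of_le hj
    rw [topMono, show j + d + 1 - j = d + 1 by omega, show j + d - j = d by omega, ← mul_sub]
    exact X1_pow_mul_mem (powDiff_sub_mem_degLT d) j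
  · simp only [if_neg h1, sub_zero, altMono]
    split_ifs with h
    · exact degLT_mono (by omega) (X1_pow_mul_mem (powDiff_mem_degLT (i - j)) j)
    · exact neg_mem (degLT_mono (by omega) (X1_pow_mul_mem (powDiff_mem_degLT (j - i)) i))

/-- The form `v^m p(u/v)` written as `∑ p_j v^j u^(m-j)`. -/
noncomputable def topForm (m : ℕ) : ℝ[X] →ₗ[ℝ] Poly2 where
  toFun p := ∑ j ∈ Finset.range (m + 1), p.coeff j • topMono m j
  map_add' p q := by simp [add_smul, Finset.sum_add_distrib]
  map_smul' c p := by simp [mul_smul, Finset.smul_sum]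

theorem topForm_apply (m : ℕ) (p : ℝ[X]) :
    topForm m p = ∑ j ∈ Finset.range (m + 1), p.coeff j • topMono m j := rfl

theorem topMono_mem_degLT {m j : ℕ} (hj : j ≤ m) : topMono m j ∈ degLT (m + 1) := by
  rw [topMono, mul_comm]
  exact pow_mul_pow_mem_spanLT (by omega)

theorem topForm_mem_degLT (m : ℕ) (p : ℝ[X]) : topForm m p ∈ degLT (m + 1) := by
  rw [topForm_apply]
  refine Submodule.sum_mem _ fun j hj => Submodule.smul_mem _ _ (topMono_mem_degLT ?_)
  exact Nat.lt_succ_iff.1 (Finset.mem_range.1 hj)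

theorem topForm_X_pow {m j : ℕ} (hj : j ≤ m) : topForm m (X ^ j) = topMono m j := by
  rw [topForm_apply, Finset.sum_eq_single j]
  · simp
  · intro i _ hi
    simp [coeff_X_pow, hi]
  · intro h
    exact absurd (Finset.mem_range.2 (Nat.lt_succ_of_le hj)) h

theorem sum_sum_range (F : ℕ → ℕ → Poly2) {f g : ℝ[X]} {a b : ℕ} (hf : f.natDegree < a)
    (hg : g.natDegree < b) :
    (f.sum fun i x => g.sum fun j y => MvPolynomial.C (x * y) * F i j) =
      ∑ i ∈ Finset.range a, ∑ j ∈ Finset.range b, (f.coeff i * g.coeff j) • F i j := by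
  rw [sum_over_range' _ (by simp [Polynomial.sum]) a hf]
  refine Finset.sum_congr rfl fun i _ => ?_
  rw [sum_over_range' _ (by simp) b hg]
  exact Finset.sum_congr rfl fun j _ => (MvPolynomial.smul_eq_C_mul _ _).symm

theorem symPair_sub_mem_degLT {m : ℕ} {f g : ℝ[X]} (hf : f.natDegree ≤ m) (hg : g.natDegree ≤ m) :
    symPair f g - (f.coeff m • topForm m g + g.coeff m • topForm m f) ∈ degLT m := by
  have e : f.coeff m • topForm m g + g.coeff m • topForm m f =
      ∑ i ∈ Finset.range (m + 1), ∑ j ∈ Finset.range (m + 1), (f.coeff i * g.coeff j) •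
        ((if i = m then topMono m j else 0) + if j = m then topMono m i else 0) := by
    simp only [smul_add, Finset.sum_add_distrib, smul_ite, smul_zero]
    congr 1
    · rw [Finset.sum_comm]
      simp only [Finset.sum_ite_eq', Finset.mem_range, Nat.lt_succ_self, if_true, topForm_apply,
        Finset.smul_sum, mul_smul]
    · simp only [Finset.sum_ite_eq', Finset.mem_range, Nat.lt_succ_self, if_true, topForm_apply,
        Finset.smul_sum, smul_smul]
      simp only [mul_comm]
  rw [e, symPair, sum_sum_range symMono (Nat.lt_succ_of_le hf) (Nat.lt_succ_of_le hg),
    ← Finset.sum_sub_distrib]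
  refine Submodule.sum_mem _ fun i hi => ?_
  rw [← Finset.sum_sub_distrib]
  refine Submodule.sum_mem _ fun j hj => ?_
  rw [← smul_sub]
  exact Submodule.smul_mem _ _ (symMono_sub_mem_degLT (Nat.lt_succ_iff.1 (Finset.mem_range.1 hi))
    (Nat.lt_succ_iff.1 (Finset.mem_range.1 hj)))

theorem altPair_sub_mem_degLT {m : ℕ} {f g : ℝ[X]} (hf : f.natDegree ≤ m + 1)
    (hg : g.natDegree ≤ m) :
    altPair f g - f.coeff (m + 1) • topForm m g ∈ degLT m := by
  have e : f.coeff (m + 1) • topForm m g =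
      ∑ i ∈ Finset.range (m + 2), ∑ j ∈ Finset.range (m + 1), (f.coeff i * g.coeff j) •
        (if i = m + 1 then topMono m j else 0) := by
    simp only [smul_ite, smul_zero]
    rw [Finset.sum_comm]
    simp only [Finset.sum_ite_eq', Finset.mem_range, Nat.lt_succ_self, if_true, topForm_apply,
      Finset.smul_sum, mul_smul]
  rw [e, altPair, sum_sum_range altMono (show f.natDegree < m + 2 by omega) (Nat.lt_succ_of_le hg),
    ← Finset.sum_sub_distrib]
  refine Submodule.sum_mem _ fun i hi => ?_
  rw [← Finset.sum_sub_distrib]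
  refine Submodule.sum_mem _ fun j hj => ?_
  rw [← smul_sub]
  exact Submodule.smul_mem _ _ (altMono_sub_mem_degLT (Nat.lt_succ_iff.1 (Finset.mem_range.1 hi))
    (Nat.lt_succ_iff.1 (Finset.mem_range.1 hj)))

/-- Alternating pairings of two polynomials of degree at most `m + 1` have degree at most `m`: the
terms of degree `m + 1` cancel. -/
theorem altPair_mem_degLT {m : ℕ} {f g : ℝ[X]} (hf : f.natDegree ≤ m + 1)
    (hg : g.natDegree ≤ m + 1) : altPair f g ∈ degLT (m + 1) := by
  rw [altPair, sum_sum_range altMono (Nat.lt_succ_of_le hf) (Nat.lt_succ_of_le hg)]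
  refine Submodule.sum_mem _ fun i hi => Submodule.sum_mem _ fun j hj => Submodule.smul_mem _ _ ?_
  rw [Finset.mem_range] at hi hj
  unfold altMono
  split_ifs with h
  · exact degLT_mono (by omega) (X1_pow_mul_mem (powDiff_mem_degLT (i - j)) j)
  · exact neg_mem (degLT_mono (by omega) (X1_pow_mul_mem (powDiff_mem_degLT (j - i)) i))

theorem symPair_mem_degLT {m : ℕ} {f g : ℝ[X]} (hf : f.natDegree ≤ m) (hg : g.natDegree ≤ m) :
    symPair f g ∈ degLT (m + 1) := by
  have h := degLT_mono (Nat.le_succ m) (symPair_sub_mem_degLT hf hg)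
  have h2 := add_mem h (add_mem (Submodule.smul_mem _ (f.coeff m) (topForm_mem_degLT m g))
    (Submodule.smul_mem _ (g.coeff m) (topForm_mem_degLT m f)))
  rwa [sub_add_cancel] at h2

theorem pairPoly_mem_degLT (s : Sgn) {m : ℕ} {f g : ℝ[X]} (hf : f.natDegree ≤ topDeg s m)
    (hg : g.natDegree ≤ topDeg s m) : pairPoly s f g ∈ degLT (m + 1) := by
  cases s
  · exact symPair_mem_degLT hf hg
  · exact altPair_mem_degLT hf hg

section

variable {a b : ℝ} (ha : -1 < a) (hb : -1 < b)
include ha hb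

theorem coeff_jacobi_self (n : ℕ) : (jacobi a b n).coeff n = jacobiLead a b n := by
  rw [← leadingCoeff_jacobi, leadingCoeff, natDegree_jacobi ha hb]

/-- The leading form of the pairing of the top Jacobi polynomial with `p_k` is a multiple of the
form that belongs to `p_k`. -/
theorem exists_pairPoly_sub_mem_degLT (s : Sgn) {m k : ℕ} (hk : k ≤ m) :
    ∃ c : ℝ, c ≠ 0 ∧ pairPoly s (jacobi a b (topDeg s m)) (jacobi a b k) -
      c • topForm m (jacobi a b k) ∈ degLT m := by
  cases s with
  | minus =>
    have h := symPair_sub_mem_degLT (m := m) (natDegree_jacobi ha hb m).le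
      ((natDegree_jacobi ha hb k).le.trans hk)
    rw [coeff_jacobi_self ha hb] at h
    rcases eq_or_lt_of_le hk with rfl | hlt
    · rw [coeff_jacobi_self ha hb, ← add_smul] at h
      refine ⟨_, ?_, h⟩
      have := jacobiLead_pos ha hb k
      positivity
    · rw [coeff_eq_zero_of_natDegree_lt (by rwa [natDegree_jacobi ha hb]), zero_smul,
        add_zero] at h
      exact ⟨_, (jacobiLead_pos ha hb m).ne', h⟩
  | plus =>
    have h := altPair_sub_mem_degLT (m := m) (natDegree_jacobi ha hb (m + 1)).le
      ((natDegree_jacobi ha hb k).le.trans hk)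
    rw [coeff_jacobi_self ha hb] at h
    exact ⟨_, (jacobiLead_pos ha hb (m + 1)).ne', h⟩

/-- Modulo polynomials of degree less than `m`, the pairings span all polynomials of degree at most
`m` in `u, v`. -/
theorem degLT_succ_le_span_pairPoly (s : Sgn) (m : ℕ) :
    degLT (m + 1) ≤ Submodule.span ℝ (Set.range fun k : Fin (m + 1) =>
      pairPoly s (jacobi a b (topDeg s m)) (jacobi a b k)) ⊔ degLT m := by
  set S := Submodule.span ℝ (Set.range fun k : Fin (m + 1) =>
      pairPoly s (jacobi a b (topDeg s m)) (jacobi a b k)) ⊔ degLT m with hS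
  have h1 : ∀ k ≤ m, topForm m (monicJacobi a b k) ∈ S := by
    intro k hk
    obtain ⟨c, hc, h⟩ := exists_pairPoly_sub_mem_degLT ha hb s hk
    have h2 : c • topForm m (jacobi a b k) ∈ S := by
      have h3 : pairPoly s (jacobi a b (topDeg s m)) (jacobi a b k) ∈ S :=
        Submodule.mem_sup_left (Submodule.subset_span ⟨⟨k, by omega⟩, rfl⟩)
      have := sub_mem h3 (Submodule.mem_sup_right h)
      rwa [sub_sub_cancel] at this
    rw [jacobi_eq, ← smul_eq_C_mul, map_smul, smul_smul] at h2
    have hne : c * jacobiLead a b k ≠ 0 := mul_ne_zero hc (jacobiLead_pos ha hb k).ne'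
    exact (Submodule.smul_mem_iff _ hne).1 h2
  have h2 : degreeLT ℝ (m + 1) ≤ S.comap (topForm m) := by
    rw [← (monicJacobiSeq a b).span_degreeLT (m := m + 1) fun i _ => by
      rw [show (monicJacobiSeq a b) i = monicJacobi a b i from rfl,
        (monicJacobi_monic a b i).leadingCoeff]
      exact isUnit_one]
    refine Submodule.span_le.2 ?_
    rintro _ ⟨k, hk, rfl⟩
    exact h1 k (Nat.lt_succ_iff.1 hk)
  refine spanLT_le fun i j hij => ?_
  rcases Nat.lt_succ_iff_lt_or_eq.1 hij with h | h
  · exact Submodule.mem_sup_right (pow_mul_pow_mem_spanLT h)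
  · have h3 : (X : ℝ[X]) ^ j ∈ degreeLT ℝ (m + 1) := by
      rw [mem_degreeLT, degree_X_pow]
      exact_mod_cast (by omega : j < m + 1)
    have h4 := h2 h3
    rw [Submodule.mem_comap, topForm_X_pow (by omega), topMono, show m - j = i by omega,
      mul_comm] at h4
    exact h4

end

/-- A polynomial of degree at most `m` in `u, v` is, modulo `1 - u + v` and lower degrees, a multiple
of `(1 + u + v)^m`. -/
theorem exists_eq_smul_sqSumUV_pow {m : ℕ} {F : Poly2} (hF : F ∈ degLT (m + 1)) :
    ∃ c : ℝ, ∃ G ∈ degLT m, ∃ H ∈ degLT m, F = c • sqSumUV ^ m + sqDiffUV * G + H := by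
  have : degLT (m + 1) ≤ Submodule.span ℝ {sqSumUV ^ m} ⊔
      (degLT m).map (LinearMap.mulLeft ℝ sqDiffUV) ⊔ degLT m := by
    conv_lhs => rw [degLT_eq_sqSumUV_sqDiffUV]
    refine spanLT_le fun i j hij => ?_
    rcases Nat.lt_succ_iff_lt_or_eq.1 hij with h | h
    · refine Submodule.mem_sup_right ?_
      rw [degLT_eq_sqSumUV_sqDiffUV]
      exact pow_mul_pow_mem_spanLT h
    · refine Submodule.mem_sup_left ?_
      rcases j with _ | j
      · refine Submodule.mem_sup_left ?_
        rw [pow_zero, mul_one, show i = m by omega]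
        exact Submodule.mem_span_singleton_self _
      · refine Submodule.mem_sup_right ⟨sqSumUV ^ i * sqDiffUV ^ j, ?_, ?_⟩
        · rw [degLT_eq_sqSumUV_sqDiffUV]
          exact pow_mul_pow_mem_spanLT (by omega)
        · rw [LinearMap.mulLeft_apply]; ring
  obtain ⟨x, hx, H, hH, rfl⟩ := Submodule.mem_sup.1 (this hF)
  obtain ⟨y, hy, z, ⟨G, hG, rfl⟩, rfl⟩ := Submodule.mem_sup.1 hx
  obtain ⟨c, rfl⟩ := Submodule.mem_span_singleton.1 hy
  exact ⟨c, G, hG, H, hH, rfl⟩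

/-! ### Reduction modulo the generators -/

/-- The exponents of the products `(x + y)^i (x - y)^j` that span a complement of the ideal: all of
degree at most `2m`, and those of degree `2m + 1` with `j` even and positive. -/
def complExp (m : ℕ) : Finset (ℕ × ℕ) :=
  (Finset.range (2 * m + 1)).biUnion Finset.HasAntidiagonal.antidiagonal ∪
    (Finset.Icc 1 m).image fun j => (2 * m + 1 - 2 * j, 2 * j)

theorem sum_range_add_one_mul_two (k : ℕ) :
    (∑ d ∈ Finset.range k, (d + 1)) * 2 = k * (k + 1) := by
  induction k with
  | zero => simp
  | succ k ih => rw [Finset.sum_range_succ, add_mul, ih]; ring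

theorem card_complExp_le (m : ℕ) : (complExp m).card + 1 ≤ 2 * (m + 1) ^ 2 := by
  have h1 : ((Finset.range (2 * m + 1)).biUnion Finset.HasAntidiagonal.antidiagonal).card ≤
      ∑ d ∈ Finset.range (2 * m + 1), (d + 1) := by
    refine Finset.card_biUnion_le.trans (Finset.sum_le_sum fun d _ => ?_)
    rw [Finset.Nat.card_antidiagonal]
  have h2 : ((Finset.Icc 1 m).image fun j => (2 * m + 1 - 2 * j, 2 * j)).card ≤ m := by
    refine Finset.card_image_le.trans ?_
    simp
  have h3 := sum_range_add_one_mul_two (2 * m + 1)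
  have h4 := Finset.card_union_le ((Finset.range (2 * m + 1)).biUnion Finset.HasAntidiagonal.antidiagonal)
    ((Finset.Icc 1 m).image fun j => (2 * m + 1 - 2 * j, 2 * j))
  unfold complExp
  nlinarith

/-- A complement of the ideal of the generators. -/
noncomputable def compl (m : ℕ) : Submodule ℝ Poly2 :=
  Submodule.span ℝ ((complExp m).image fun p => sumXY ^ p.1 * diffXY ^ p.2 : Finset Poly2)

instance (m : ℕ) : FiniteDimensional ℝ (compl m) := by unfold compl; infer_instance

theorem finrank_compl_add_one_le (m : ℕ) :
    Module.finrank ℝ (compl m) + 1 ≤ 2 * (m + 1) ^ 2 :=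
  (Nat.add_le_add_right ((finrank_span_finset_le_card _).trans Finset.card_image_le) 1).trans
    (card_complExp_le m)

theorem pow_mul_pow_mem_compl {m i j : ℕ} (h : (i, j) ∈ complExp m) :
    sumXY ^ i * diffXY ^ j ∈ compl m :=
  Submodule.subset_span (Finset.mem_coe.2 (Finset.mem_image.2 ⟨(i, j), h, rfl⟩))

theorem degLT_le_compl (m : ℕ) : degLT (2 * m + 1) ≤ compl m := by
  rw [degLT_eq_sumXY_diffXY]
  refine spanLT_le fun i j hij => pow_mul_pow_mem_compl (Finset.mem_union_left _ ?_)
  exact Finset.mem_biUnion.2 ⟨i + j, Finset.mem_range.2 hij, Finset.HasAntidiagonal.mem_antidiagonal.2 rfl⟩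

/-- The combinations of the generators with coefficients of degree at most `e`. -/
noncomputable def idealLE (α β : ℝ) (s : Sgn) (m e : ℕ) : Submodule ℝ Poly2 :=
  Submodule.span ℝ {f | ∃ g ∈ degLT (e + 1), ∃ i, f = g * generators α β s m i}

section

variable {α β : ℝ} (s : Sgn)

theorem mul_mem_idealLE {m d e : ℕ} (hd : d ≤ e) {f g : Poly2} (hg : g ∈ degLT (d + 1))
    (hf : f ∈ Submodule.span ℝ (Set.range (generators α β s m))) :
    g * f ∈ idealLE α β s m e := by
  have : Submodule.span ℝ (Set.range (generators α β s m)) ≤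
      (idealLE α β s m e).comap (LinearMap.mulLeft ℝ g) := by
    refine Submodule.span_le.2 ?_
    rintro _ ⟨i, rfl⟩
    exact Submodule.subset_span ⟨g, degLT_mono (by omega) hg, i, rfl⟩
  exact this hf

/-- The leading forms of the `₂Q_{k,2m+1}` span those of the products `(x + y)^i (x - y)^j` of
degree `2m + 1` with `j` odd. -/
theorem pow_mul_pow_mem_span_generators (hα : -1 < α) (hβ : -1 < β) {m i j : ℕ}
    (h : i + j = 2 * m + 1) (hj : Odd j) :
    sumXY ^ i * diffXY ^ j ∈ Submodule.span ℝ (Set.range (generators α β s m)) ⊔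
      degLT (2 * m + 1) := by
  set S := Submodule.span ℝ (Set.range (generators α β s m)) ⊔ degLT (2 * m + 1) with hS
  obtain ⟨j, rfl⟩ := hj
  obtain ⟨i', hi'⟩ : ∃ i', i = 2 * i' := ⟨m - j, by omega⟩
  subst hi'
  let φ : Poly2 →ₗ[ℝ] Poly2 := (LinearMap.mulLeft ℝ diffXY).comp substUVHom.toLinearMap
  have hφ : ∀ F, φ F = diffXY * substUV F := fun F => rfl
  have h1 : degLT (m + 1) ≤ S.comap φ := by
    refine (degLT_succ_le_span_pairPoly (a := α + 1) (by linarith) hβ s m).trans (sup_le ?_ ?_)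
    · refine Submodule.span_le.2 ?_
      rintro _ ⟨k, rfl⟩
      refine Submodule.mem_sup_left ?_
      have h2 : Q₂ α β s m k ∈ Submodule.span ℝ (Set.range (generators α β s m)) :=
        Submodule.subset_span ⟨Fin.succ k, rfl⟩
      rw [Q₂_eq, ← MvPolynomial.smul_eq_C_mul] at h2
      exact (Submodule.smul_mem_iff _ (Q₂Const_ne_zero hα hβ s m k)).1 h2
    · intro F hF
      refine Submodule.mem_sup_right ?_
      exact degLT_mono (by omega) (mul_substUV_mem_degLT diffXY_mem hF)
  have h2 : sqSumUV ^ i' * sqDiffUV ^ j ∈ degLT (m + 1) := by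
    rw [degLT_eq_sqSumUV_sqDiffUV]
    exact pow_mul_pow_mem_spanLT (by omega)
  have h3 := h1 h2
  rw [Submodule.mem_comap, hφ, substUV_eq, map_mul, map_pow, map_pow, substUVHom_sqSumUV,
    substUVHom_sqDiffUV] at h3
  convert h3 using 1
  ring

/-- The condition that the leading form of `qExtra` is not divisible by `x - y`. -/
def TopNonzero (α β : ℝ) (s : Sgn) (m : ℕ) : Prop :=
  ∃ c : ℝ, c ≠ 0 ∧ ∃ G ∈ degLT m, ∃ H ∈ degLT m,
    pairPoly s (jacobi α (β + 1) (topDeg s m)) (jacobi (α + 1) β (topDeg s m)) =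
      c • sqSumUV ^ m + sqDiffUV * G + H

theorem exists_sumXY_pow_sub_mem {m : ℕ} (h : TopNonzero α β s m) :
    ∃ G ∈ degLT m, ∃ H ∈ degLT (2 * m + 1), sumXY ^ (2 * m + 1) + sumXY * diffXY ^ 2 * substUV G + H ∈
      Submodule.span ℝ (Set.range (generators α β s m)) := by
  obtain ⟨c, hc, G, hG, H, hH, hF⟩ := h
  refine ⟨c⁻¹ • G, Submodule.smul_mem _ _ hG, c⁻¹ • (sumXY * substUV H), ?_, ?_⟩
  · exact Submodule.smul_mem _ _ (degLT_mono (by omega) (mul_substUV_mem_degLT sumXY_mem hH))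
  have h2 : qExtra α β s m ∈ Submodule.span ℝ (Set.range (generators α β s m)) :=
    Submodule.subset_span ⟨0, rfl⟩
  rw [qExtra_eq, ← MvPolynomial.smul_eq_C_mul, Submodule.smul_mem_iff _ (qConst_ne_zero s), hF] at h2
  have h3 := Submodule.smul_mem _ c⁻¹ h2
  convert h3 using 1
  simp only [substUV_eq, map_add, map_smul, map_mul, map_pow, substUVHom_sqSumUV,
    substUVHom_sqDiffUV, mul_add, smul_add, mul_smul_comm, smul_smul, inv_mul_cancel₀ hc, one_smul,
    ← pow_mul]
  ring_nf

/-- Every polynomial of degree at most `2m + 1 + e` is congruent to an element of the complement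
modulo combinations of the generators with coefficients of degree at most `e`. -/
theorem degLT_le_compl_sup_idealLE (hα : -1 < α) (hβ : -1 < β) {m : ℕ} (h : TopNonzero α β s m)
    (e d : ℕ) (hd : d ≤ 2 * m + 1 + e) :
    degLT (d + 1) ≤ compl m ⊔ idealLE α β s m e := by
  induction d using Nat.strong_induction_on with
  | _ d ih =>
    set S := compl m ⊔ idealLE α β s m e with hS
    rcases Nat.lt_or_ge d (2 * m + 1) with hlt | hge
    · exact (degLT_mono hlt).trans ((degLT_le_compl m).trans le_sup_left)
    have hlow : degLT d ≤ S := by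
      obtain ⟨k, rfl⟩ : ∃ k, d = k + 1 := ⟨d - 1, by omega⟩
      exact ih k (by omega) (by omega)
    obtain ⟨t, rfl⟩ := Nat.exists_eq_add_of_le hge
    have hmul : ∀ f g : Poly2, g ∈ degLT (t + 1) →
        f ∈ Submodule.span ℝ (Set.range (generators α β s m)) → g * f ∈ S :=
      fun f g hg hf => Submodule.mem_sup_right (mul_mem_idealLE s (by omega) hg hf)
    -- products with an odd factor `(x - y)^j₁` of degree `2m + 1` reduce by the `₂Q_{k,2m+1}`
    have hodd : ∀ i j i₁ j₁ : ℕ, i + j = 2 * m + 1 + t → i₁ + j₁ = 2 * m + 1 → i₁ ≤ i → j₁ ≤ j →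
        Odd j₁ → sumXY ^ i * diffXY ^ j ∈ S := by
      intro i j i₁ j₁ hij h1 hi hj ho
      obtain ⟨x, hx, y, hy, hxy⟩ := Submodule.mem_sup.1
        (pow_mul_pow_mem_span_generators s hα hβ h1 ho)
      have e1 : sumXY ^ i * diffXY ^ j =
          (sumXY ^ (i - i₁) * diffXY ^ (j - j₁)) * x +
          (sumXY ^ (i - i₁) * diffXY ^ (j - j₁)) * y := by
        rw [← mul_add, hxy]
        conv_lhs => rw [← Nat.sub_add_cancel hi, ← Nat.sub_add_cancel hj, pow_add, pow_add]
        ring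
      have hg : sumXY ^ (i - i₁) * diffXY ^ (j - j₁) ∈ degLT (t + 1) := by
        rw [degLT_eq_sumXY_diffXY]
        exact pow_mul_pow_mem_spanLT (by omega)
      rw [e1]
      refine add_mem (hmul _ _ hg hx) (hlow ?_)
      exact degLT_mono (by omega) (mul_mem_degLT hg hy)
    have hpos : ∀ i j : ℕ, i + j = 2 * m + 1 + t → 1 ≤ j →
        sumXY ^ i * diffXY ^ j ∈ S := by
      intro i j hij hj
      by_cases hj2 : Odd j ∧ j ≤ 2 * m + 1
      · exact hodd i j (2 * m + 1 - j) j hij (by omega) (by omega) le_rfl hj2.1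
      by_cases hjn : 2 * m + 1 ≤ j
      · exact hodd i j 0 (2 * m + 1) hij (by omega) (by omega) hjn ⟨m, rfl⟩
      have hev : Even j := by
        rw [← Nat.not_odd_iff_even]; exact fun h => hj2 ⟨h, by omega⟩
      obtain ⟨k, rfl⟩ := hev
      rcases Nat.eq_zero_or_pos t with rfl | ht
      · refine Submodule.mem_sup_left (pow_mul_pow_mem_compl (Finset.mem_union_right _ ?_))
        refine Finset.mem_image.2 ⟨k, Finset.mem_Icc.2 ⟨by omega, by omega⟩, ?_⟩
        ext <;> simp only <;> omega
      · exact hodd i (k + k) (2 * m + 1 - (2 * k - 1)) (2 * k - 1) hij (by omega) (by omega)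
          (by omega) ⟨k - 1, by omega⟩
    have hzero : sumXY ^ (2 * m + 1 + t) ∈ S := by
      obtain ⟨G, hG, H, hH, hq⟩ := exists_sumXY_pow_sub_mem s h
      have hg : sumXY ^ t ∈ degLT (t + 1) := by
        have := pow_mem_degLT (e := 1) sumXY_mem t
        rwa [one_mul] at this
      have h1 := hmul _ _ hg hq
      have h2 : sumXY ^ t * H ∈ S := hlow (degLT_mono (by omega) (mul_mem_degLT hg hH))
      have h3 : sumXY ^ t * (sumXY * diffXY ^ 2 * substUV G) ∈ S := by
        have : degLT m ≤ S.comap ((LinearMap.mulLeft ℝ (sumXY ^ t * (sumXY * diffXY ^ 2))).comp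
            substUVHom.toLinearMap) := by
          rw [degLT_eq_sqSumUV_sqDiffUV]
          refine spanLT_le fun i j hij => ?_
          rw [Submodule.mem_comap, LinearMap.comp_apply, LinearMap.mulLeft_apply,
            AlgHom.toLinearMap_apply, map_mul, map_pow, map_pow, substUVHom_sqSumUV,
            substUVHom_sqDiffUV, show sumXY ^ t * (sumXY * diffXY ^ 2) *
              ((sumXY ^ 2) ^ i * (diffXY ^ 2) ^ j) =
              sumXY ^ (t + 1 + 2 * i) * diffXY ^ (2 + 2 * j) by ring]
          rcases Nat.lt_or_ge (i + j + 1) m with hlt | hge'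
          · refine hlow ?_
            rw [degLT_eq_sumXY_diffXY]
            exact pow_mul_pow_mem_spanLT (by omega)
          · exact hpos _ _ (by omega) (by omega)
        have h4 := this hG
        rw [Submodule.mem_comap, LinearMap.comp_apply, LinearMap.mulLeft_apply,
            AlgHom.toLinearMap_apply, ← substUV_eq, mul_assoc] at h4
        exact h4
      have h4 := sub_mem (sub_mem h1 h2) h3
      convert h4 using 1
      ring
    rw [degLT_eq_sumXY_diffXY]
    refine spanLT_le fun i j hij => ?_
    rcases Nat.lt_succ_iff_lt_or_eq.1 hij with h1 | h1
    · refine hlow ?_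
      rw [degLT_eq_sumXY_diffXY]
      exact pow_mul_pow_mem_spanLT h1
    rcases Nat.eq_zero_or_pos j with rfl | hj
    · rw [pow_zero, mul_one, show i = 2 * m + 1 + t by omega]
      exact hzero
    · exact hpos i j h1 hj

end


/-! ### The generators on the diagonal -/

theorem jacobiInt_add_one_right {b : ℝ} (a : ℝ) (hb : -1 < b) (f : ℝ[X]) :
    jacobiInt a (b + 1) f = jacobiInt a b (f * (1 + X)) := by
  refine intervalIntegral.integral_congr fun t ht => ?_
  rw [Set.uIcc_of_le (by norm_num)] at ht
  simp only [jacobiWeight, eval_mul, eval_add, eval_one, eval_X]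
  rw [Real.rpow_add_one' (by linarith [ht.1]) (by linarith)]
  ring

theorem jacobiInt_add_one_left {a : ℝ} (ha : -1 < a) (b : ℝ) (f : ℝ[X]) :
    jacobiInt (a + 1) b f = jacobiInt a b (f * (1 - X)) := by
  refine intervalIntegral.integral_congr fun t ht => ?_
  rw [Set.uIcc_of_le (by norm_num)] at ht
  simp only [jacobiWeight, eval_mul, eval_sub, eval_one, eval_X]
  rw [Real.rpow_add_one' (by linarith [ht.2]) (by linarith)]
  ring

theorem degree_mul_lt {q r : ℝ[X]} {k l : ℕ} (hq : q.degree < k) (hr : r.natDegree ≤ l) :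
    (q * r).degree < (k + l : ℕ) := by
  rcases eq_or_ne q 0 with rfl | hq0
  · rw [zero_mul, degree_zero]; exact WithBot.bot_lt_coe _
  rw [degree_eq_natDegree hq0, Nat.cast_lt] at hq
  refine lt_of_le_of_lt degree_le_natDegree ?_
  rw [Nat.cast_lt]
  exact natDegree_mul_le.trans_lt (by omega)

theorem natDegree_one_add_X_le : (1 + X : ℝ[X]).natDegree ≤ 1 := by compute_degree

theorem natDegree_one_sub_X_le : (1 - X : ℝ[X]).natDegree ≤ 1 := by compute_degree

/-- The restriction of a polynomial in `u, v` to the line `u = 1 + v`, the image of the diagonal. -/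
noncomputable def diagPoly : Poly2 →ₐ[ℝ] ℝ[X] := MvPolynomial.aeval ![1 + X, X]

theorem eval_diagPoly (F : Poly2) (t : ℝ) : (diagPoly F).eval t = evalAt (1 + t, t) F := by
  rw [evalAt_eq, ← coe_aeval_eq_eval, diagPoly, evalHom, ← AlgHom.comp_apply]
  congr 1
  apply MvPolynomial.algHom_ext
  intro i
  fin_cases i <;> simp

theorem diagPoly_sqDiffUV : diagPoly sqDiffUV = 0 := by simp [diagPoly, sqDiffUV]

theorem diagPoly_mem_degreeLT {d : ℕ} {F : Poly2} (hF : F ∈ degLT d) :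
    diagPoly F ∈ degreeLT ℝ d := by
  have : degLT d ≤ (degreeLT ℝ d).comap diagPoly.toLinearMap := by
    refine spanLT_le fun i j hij => ?_
    rw [Submodule.mem_comap, AlgHom.toLinearMap_apply, map_mul, map_pow, map_pow, mem_degreeLT]
    have e0 : diagPoly (MvPolynomial.X 0) = 1 + X := by simp [diagPoly]
    have e1 : diagPoly (MvPolynomial.X 1) = X := by simp [diagPoly]
    rw [e0, e1]
    refine lt_of_le_of_lt degree_le_natDegree ?_
    rw [Nat.cast_lt]
    refine lt_of_le_of_lt ?_ hij
    compute_degree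
  exact this hF

/-- The pairing that occurs in `qExtra`, restricted to the image of the diagonal. -/
noncomputable def diagExtra (α β : ℝ) (s : Sgn) (m : ℕ) : ℝ[X] :=
  diagPoly (pairPoly s (jacobi α (β + 1) (topDeg s m)) (jacobi (α + 1) β (topDeg s m)))

theorem diagExtra_minus (α β : ℝ) (m : ℕ) :
    diagExtra α β .minus m = C ((jacobi α (β + 1) m).eval 1) * jacobi (α + 1) β m +
      C ((jacobi (α + 1) β m).eval 1) * jacobi α (β + 1) m := by
  refine Polynomial.funext fun t => ?_
  have h := evalAt_symPair (jacobi α (β + 1) m) (jacobi (α + 1) β m) 1 t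
  rw [one_mul] at h
  rw [diagExtra, eval_diagPoly, pairPoly, topDeg, h]
  simp only [eval_add, eval_mul, eval_C]
  ring

theorem diagExtra_plus_mul (α β : ℝ) (m : ℕ) :
    diagExtra α β .plus m * (1 - X) =
      C ((jacobi α (β + 1) (m + 1)).eval 1) * jacobi (α + 1) β (m + 1) -
      C ((jacobi (α + 1) β (m + 1)).eval 1) * jacobi α (β + 1) (m + 1) := by
  refine Polynomial.funext fun t => ?_
  have h := evalAt_altPair (jacobi α (β + 1) (m + 1)) (jacobi (α + 1) β (m + 1)) 1 t
  rw [one_mul] at h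
  rw [eval_mul, diagExtra, eval_diagPoly, pairPoly, topDeg, eval_sub, eval_one, eval_X, h]
  simp only [eval_sub, eval_mul, eval_C]
  ring

section

variable {α β : ℝ} (hα : -1 < α) (hβ : -1 < β)
include hα hβ

/-- Both families `p_n^{(α,β+1)}` and `p_n^{(α+1,β)}` are orthogonal to polynomials of degree less
than `n - 1` with respect to the parameters `(α+1, β+1)`. -/
theorem jacobiInt_shift_eq_zero (c d : ℝ) (n : ℕ) {q : ℝ[X]} {k : ℕ} (hk : k + 1 ≤ n)
    (hq : q.degree < k) :
    jacobiInt (α + 1) (β + 1) ((C c * jacobi (α + 1) β n + C d * jacobi α (β + 1) n) * q) = 0 := by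
  have hα1 : -1 < α + 1 := by linarith
  have hβ1 : -1 < β + 1 := by linarith
  have hkn : ((k + 1 : ℕ) : WithBot ℕ) ≤ n := by exact_mod_cast hk
  rw [add_mul, jacobiInt_add hα1 hβ1, mul_assoc, mul_assoc, jacobiInt_C_mul, jacobiInt_C_mul,
    jacobiInt_add_one_right (α + 1) hβ, jacobiInt_add_one_left hα (β + 1), mul_assoc, mul_assoc,
    jacobiInt_jacobi_mul hα1 hβ n _ ((degree_mul_lt hq natDegree_one_add_X_le).trans_le hkn),
    jacobiInt_jacobi_mul hα hβ1 n _ ((degree_mul_lt hq natDegree_one_sub_X_le).trans_le hkn)]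
  simp

theorem eval_one_diagExtra_minus_pos (m : ℕ) : 0 < (diagExtra α β .minus m).eval 1 := by
  have h1 := eval_one_jacobi_pos hα (b := β + 1) (by linarith) m
  have h2 := eval_one_jacobi_pos (a := α + 1) (by linarith) hβ m
  rw [diagExtra_minus]
  simp only [eval_add, eval_mul, eval_C]
  positivity

theorem eval_neg_one_diagExtra_minus_pos (m : ℕ) :
    0 < (-1) ^ m * (diagExtra α β .minus m).eval (-1) := by
  have h1 := eval_one_jacobi_pos hα (b := β + 1) (by linarith) m
  have h2 := eval_one_jacobi_pos (a := α + 1) (by linarith) hβ m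
  have h3 := eval_neg_one_jacobi_pos hα (b := β + 1) (by linarith) m
  have h4 := eval_neg_one_jacobi_pos (a := α + 1) (by linarith) hβ m
  rw [diagExtra_minus]
  simp only [eval_add, eval_mul, eval_C]
  nlinarith [mul_pos h1 h4, mul_pos h2 h3]

/-- For the minus sign orthogonality gives `m - 1` sign changes in `(-1,1)`, and the signs at the end
points force their number to have the parity of `m`. -/
theorem le_card_oddRoots_diagExtra_minus (m : ℕ) :
    m ≤ (oddRoots (diagExtra α β .minus m)).card := by
  set R := diagExtra α β .minus m with hR
  have hp := eval_one_diagExtra_minus_pos hα hβ m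
  have hn := eval_neg_one_diagExtra_minus_pos hα hβ m
  rw [← hR] at hp hn
  have hR0 : R ≠ 0 := fun h => by simp [h] at hp
  have h1 : m - 1 ≤ (oddRoots R).card := by
    rcases Nat.eq_zero_or_pos m with h0 | hpos
    · omega
    refine le_card_oddRoots (a := α + 1) (b := β + 1) (by linarith) (by linarith) hR0
      fun q hq => ?_
    rw [hR, diagExtra_minus]
    exact jacobiInt_shift_eq_zero hα hβ _ _ m (by omega) hq
  have hcl : ∀ P : ℝ[X], (∀ t ∈ Set.Ioo (-1 : ℝ) 1, 0 ≤ P.eval t) →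
      ∀ t ∈ Set.Icc (-1 : ℝ) 1, 0 ≤ P.eval t := by
    intro P hP
    rw [← closure_Ioo (by norm_num : (-1 : ℝ) ≠ 1)]
    exact fun t ht => closure_minimal (t := {t | 0 ≤ P.eval t}) hP
      (isClosed_le continuous_const P.continuous) ht
  have h2 : ∀ x ∈ Set.Icc (-1 : ℝ) 1, ∀ t ∈ Set.Icc (-1 : ℝ) 1,
      0 ≤ (R * oddPart R).eval x * (R * oddPart R).eval t := by
    intro x hx t ht
    have h3 : ∀ y ∈ Set.Ioo (-1 : ℝ) 1, 0 ≤ (R * oddPart R).eval x * (R * oddPart R).eval y := by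
      intro y hy
      have := hcl (C ((R * oddPart R).eval y) * (R * oddPart R)) (fun z hz => by
        rw [eval_mul, eval_C]; exact eval_mul_oddPart_nonneg hR0 hy hz) x hx
      rw [eval_mul, eval_C] at this
      linarith
    have := hcl (C ((R * oddPart R).eval x) * (R * oddPart R)) (fun z hz => by
        rw [eval_mul, eval_C]; exact h3 z hz) t ht
    rwa [eval_mul, eval_C] at this
  have h3 := h2 1 (by norm_num) (-1) (by norm_num)
  rw [eval_mul, eval_mul] at h3
  have h4 := eval_one_oddPart_pos R
  have h5 := eval_neg_one_oddPart_pos R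
  by_contra! hlt
  obtain ⟨k, hk⟩ : ∃ k, m = k + 1 := ⟨m - 1, by omega⟩
  have hc : (oddRoots R).card = k := by omega
  rw [hc] at h5
  rw [hk, pow_succ] at hn
  have h6 := mul_pos (mul_pos hp h4) (mul_pos hn h5)
  have h7 : ((-1 : ℝ) ^ k) * (-1) ^ k = 1 := by rw [← mul_pow]; norm_num
  nlinarith

/-- For the plus sign the restriction to the diagonal does not vanish identically: otherwise
`p_n^{(α,β+1)}` would be orthogonal to itself for the parameters `(α, β)`. -/
theorem diagExtra_plus_ne_zero (m : ℕ) : diagExtra α β .plus m ≠ 0 := by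
  intro h0
  have hα1 : -1 < α + 1 := by linarith
  have hβ1 : -1 < β + 1 := by linarith
  have h1 := diagExtra_plus_mul α β m
  have hf1 := eval_one_jacobi_pos hα hβ1 (m + 1)
  have hg1 := eval_one_jacobi_pos hα1 hβ (m + 1)
  have hg := jacobiInt_jacobi_mul hα1 hβ (m + 1)
  have hf := jacobiInt_jacobi_mul hα hβ1 (m + 1)
  have hdeg := degree_jacobi hα hβ1 (m + 1)
  have hne := jacobi_ne_zero hα hβ1 (m + 1)
  rw [h0, zero_mul] at h1
  set f := jacobi α (β + 1) (m + 1)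
  set g := jacobi (α + 1) β (m + 1)
  have hq1 : ∀ q : ℝ[X], q.degree < (m + 1 : ℕ) → jacobiInt α β (f * q * (1 + X)) = 0 := by
    intro q hq
    rw [← jacobiInt_add_one_right _ hβ]
    exact hf q hq
  have hq2 : ∀ q : ℝ[X], q.degree < (m + 1 : ℕ) → jacobiInt α β (f * q * (1 - X)) = 0 := by
    intro q hq
    rw [← jacobiInt_add_one_left hα]
    have h2 : jacobiInt (α + 1) β (C (f.eval 1) * (g * q)) =
        jacobiInt (α + 1) β (C (g.eval 1) * (f * q)) := by
      congr 1
      linear_combination (-q) * h1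
    rw [jacobiInt_C_mul, jacobiInt_C_mul, hg q hq, mul_zero] at h2
    exact (mul_eq_zero.1 h2.symm).resolve_left hg1.ne'
  have hq0 : ∀ q : ℝ[X], q.degree < (m + 1 : ℕ) → jacobiInt α β (f * q) = 0 := by
    intro q hq
    have e : f * q = C (1 / 2) * (f * q * (1 + X) + f * q * (1 - X)) := by
      have h2 : (C (1 / 2) : ℝ[X]) * 2 = 1 := by
        rw [show (2 : ℝ[X]) = C 2 from rfl, ← C_mul]; norm_num
      linear_combination (-f * q) * h2
    rw [e, jacobiInt_C_mul, jacobiInt_add hα hβ, hq1 q hq, hq2 q hq]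
    simp
  have hsplit := modByMonic_add_div f (X - C (-1))
  rw [modByMonic_X_sub_C_eq_C_eval] at hsplit
  have hqd : (f /ₘ (X - C (-1))).degree < (m + 1 : ℕ) := by
    rw [← hdeg]
    exact degree_divByMonic_lt f _ hne (by rw [degree_X_sub_C]; norm_num)
  have hff : jacobiInt α β (f * f) = 0 := by
    have e : f * f = C (f.eval (-1)) * (f * 1) + f * (f /ₘ (X - C (-1))) * (1 + X) := by
      conv_lhs => rhs; rw [← hsplit]
      rw [C_neg, C_1]
      ring
    rw [e, jacobiInt_add hα hβ, jacobiInt_C_mul, hq1 _ hqd, hq0 1 ?_]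
    · simp
    · rw [degree_one]; exact_mod_cast Nat.succ_pos m
  exact (jacobiInt_pos hα hβ (mul_ne_zero hne hne) fun t _ => by
    rw [eval_mul]; exact mul_self_nonneg _).ne' hff

theorem le_card_oddRoots_diagExtra_plus (m : ℕ) :
    m ≤ (oddRoots (diagExtra α β .plus m)).card := by
  refine le_card_oddRoots (a := α + 1 + 1) (b := β + 1) (by linarith) (by linarith)
    (diagExtra_plus_ne_zero hα hβ m) fun q hq => ?_
  rw [jacobiInt_add_one_left (by linarith), mul_right_comm, diagExtra_plus_mul, sub_eq_add_neg,
    ← neg_mul, ← C_neg]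
  exact jacobiInt_shift_eq_zero hα hβ _ _ (m + 1) le_rfl hq

theorem diagExtra_ne_zero (s : Sgn) (m : ℕ) : diagExtra α β s m ≠ 0 := by
  cases s
  · intro h
    have := eval_one_diagExtra_minus_pos hα hβ m
    simp [h] at this
  · exact diagExtra_plus_ne_zero hα hβ m

theorem le_card_oddRoots_diagExtra (s : Sgn) (m : ℕ) :
    m ≤ (oddRoots (diagExtra α β s m)).card := by
  cases s
  · exact le_card_oddRoots_diagExtra_minus hα hβ m
  · exact le_card_oddRoots_diagExtra_plus hα hβ m

/-- The leading form of `qExtra` does not vanish on the diagonal, since the restriction to the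
diagonal has too many zeros for a polynomial of smaller degree. -/
theorem topNonzero (s : Sgn) (m : ℕ) : TopNonzero α β s m := by
  have hF : pairPoly s (jacobi α (β + 1) (topDeg s m)) (jacobi (α + 1) β (topDeg s m)) ∈
      degLT (m + 1) := pairPoly_mem_degLT s
    (natDegree_jacobi hα (b := β + 1) (by linarith) _).le
    (natDegree_jacobi (a := α + 1) (by linarith) hβ _).le
  obtain ⟨c, G, hG, H, hH, h⟩ := exists_eq_smul_sqSumUV_pow hF
  refine ⟨c, ?_, G, hG, H, hH, h⟩
  rintro rfl
  have h1 : diagExtra α β s m ∈ degreeLT ℝ m := by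
    rw [diagExtra, h, zero_smul, zero_add, map_add, map_mul, diagPoly_sqDiffUV, zero_mul, zero_add]
    exact diagPoly_mem_degreeLT hH
  have h0 := diagExtra_ne_zero hα hβ s m
  rw [mem_degreeLT, degree_eq_natDegree h0, Nat.cast_lt] at h1
  have h2 := le_card_oddRoots_diagExtra hα hβ s m
  have h3 : (oddRoots (diagExtra α β s m)).card ≤ (diagExtra α β s m).natDegree :=
    (Finset.card_filter_le _ _).trans ((Multiset.toFinset_card_le _).trans (card_roots' _))
  omega

end

/-! ### The common zeros -/

theorem evalAt_qExtra_diag (α β : ℝ) (s : Sgn) (m : ℕ) (z : ℝ) :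
    evalAt (z, z) (qExtra α β s m) =
      qConst s * (2 * z * (diagExtra α β s m).eval (2 * z ^ 2 - 1)) := by
  rw [qExtra_eq, evalAt_eq, map_mul, map_mul, evalHom_C, evalHom_sumXY, evalHom_substUV, diagExtra,
    eval_diagPoly, ← evalAt_eq]
  have e : pointUV (z, z) = (1 + (2 * z ^ 2 - 1), 2 * z ^ 2 - 1) := by
    simp only [pointUV, Prod.mk.injEq]; constructor <;> ring
  rw [e]
  ring

theorem evalAt_pairPoly_eq_zero (s : Sgn) {f g : ℝ[X]} {x y : ℝ} (hs : s = .plus → x ≠ y)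
    (h : (f.eval x = 0 ∧ f.eval y = 0) ∨ (g.eval x = 0 ∧ g.eval y = 0)) :
    evalAt (x + y, x * y) (pairPoly s f g) = 0 := by
  cases s with
  | minus =>
    rw [pairPoly, evalAt_symPair]
    rcases h with ⟨h1, h2⟩ | ⟨h1, h2⟩ <;> simp [h1, h2]
  | plus =>
    have h3 := evalAt_altPair f g x y
    have h4 : f.eval x * g.eval y - f.eval y * g.eval x = 0 := by
      rcases h with ⟨h1, h2⟩ | ⟨h1, h2⟩ <;> simp [h1, h2]
    rw [h4] at h3
    exact (mul_eq_zero.1 h3).resolve_right (sub_ne_zero.2 (hs rfl))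

theorem mem_commonZeros_iff {α β : ℝ} {s : Sgn} {m : ℕ} {p : ℝ × ℝ} :
    p ∈ commonZeros α β s m ↔ evalAt p (qExtra α β s m) = 0 ∧
      ∀ k : Fin (m + 1), evalAt p (Q₂ α β s m k) = 0 :=
  Fin.forall_fin_succ

theorem evalAt_generator_eq (p : ℝ × ℝ) (c : ℝ) (P F : Poly2) :
    evalAt p (MvPolynomial.C c * (P * substUV F)) = c * (evalAt p P * evalAt (pointUV p) F) := by
  rw [evalAt_eq, map_mul, map_mul, evalHom_C, evalHom_substUV, ← evalAt_eq, ← evalAt_eq]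

theorem diagonalNodes_subset (α β : ℝ) (s : Sgn) (m : ℕ) :
    diagonalNodes α β s m ⊆ commonZeros α β s m := by
  rintro p ⟨z, -, rfl, hz⟩
  refine mem_commonZeros_iff.2 ⟨hz, fun k => ?_⟩
  rw [Q₂_eq, evalAt_generator_eq, evalAt_eq _ diffXY, evalHom_diffXY]
  simp

theorem offDiagonalNodes_subset (α β : ℝ) (s : Sgn) (m : ℕ) :
    offDiagonalNodes α β s m ⊆ commonZeros α β s m := by
  rintro p ⟨θ, hθ, φ, hφ, hzero, hp⟩
  obtain ⟨h1, h2, h3⟩ : (jacobi (α + 1) β (topDeg s m)).eval (Real.cos θ) = 0 ∧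
      (jacobi (α + 1) β (topDeg s m)).eval (Real.cos φ) = 0 ∧
      (s = .plus → Real.cos θ ≠ Real.cos φ) := by
    cases s with
    | minus => exact ⟨hzero.1, hzero.2.1, fun h => by cases h⟩
    | plus =>
      refine ⟨hzero.1, hzero.2.1, fun _ h => hzero.2.2.ne ?_⟩
      exact Real.injOn_cos ⟨hθ.1.le, hθ.2.le⟩ ⟨hφ.1.le, hφ.2.le⟩ h
  have huv : pointUV p = (Real.cos θ + Real.cos φ, Real.cos θ * Real.cos φ) := by
    have e1 : Real.cos θ = 2 * Real.cos (θ / 2) ^ 2 - 1 := by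
      rw [← Real.cos_two_mul]; congr 1; ring
    have e2 : Real.cos φ = 2 * Real.cos (φ / 2) ^ 2 - 1 := by
      rw [← Real.cos_two_mul]; congr 1; ring
    have e3 := Real.sin_sq_add_cos_sq (θ / 2)
    have e4 := Real.sin_sq_add_cos_sq (φ / 2)
    rw [sub_div, add_div, Real.cos_sub, Real.cos_add] at hp
    rw [e1, e2]
    have key : ∀ c d S T : ℝ, S ^ 2 + c ^ 2 = 1 → T ^ 2 + d ^ 2 = 1 →
        2 * (c * d + S * T) * (c * d - S * T) = 2 * c ^ 2 - 1 + (2 * d ^ 2 - 1) ∧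
        (c * d + S * T) ^ 2 + (c * d - S * T) ^ 2 - 1 = (2 * c ^ 2 - 1) * (2 * d ^ 2 - 1) := by
      intro c d S T hS hT
      constructor
      · linear_combination (-2 * T ^ 2) * hS + (2 * c ^ 2 - 2) * hT
      · linear_combination (2 * T ^ 2) * hS + (2 - 2 * c ^ 2) * hT
    obtain ⟨k1, k2⟩ := key _ _ _ _ e3 e4
    rw [← k1, ← k2]
    rcases hp with rfl | rfl | rfl | rfl <;> simp only [pointUV, Prod.mk.injEq] <;>
      constructor <;> ring
  refine mem_commonZeros_iff.2 ⟨?_, fun k => ?_⟩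
  · rw [qExtra_eq, evalAt_generator_eq, huv, evalAt_pairPoly_eq_zero s h3 (Or.inr ⟨h1, h2⟩)]
    simp
  · rw [Q₂_eq, evalAt_generator_eq, huv, evalAt_pairPoly_eq_zero s h3 (Or.inl ⟨h1, h2⟩)]
    simp

/-! ### Counting the common zeros -/

/-- There are at least `2m + 1` nodes on the diagonal. -/
theorem exists_diagonal_finset {α β : ℝ} (hα : -1 < α) (hβ : -1 < β) (s : Sgn) (m : ℕ) :
    ∃ D : Finset (ℝ × ℝ), (D : Set (ℝ × ℝ)) ⊆ diagonalNodes α β s m ∧ 2 * m + 1 ≤ D.card ∧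
      ∀ p ∈ D, p.1 = p.2 := by
  set R := diagExtra α β s m with hR
  set P : Finset ℝ := (oddRoots R).image fun t => Real.sqrt ((1 + t) / 2) with hP
  have hsq : ∀ t ∈ oddRoots R, Real.sqrt ((1 + t) / 2) ^ 2 = (1 + t) / 2 := fun t ht =>
    Real.sq_sqrt (by have := (mem_oddRoots.1 ht).1.1; linarith)
  have hPcard : P.card = (oddRoots R).card := by
    refine Finset.card_image_of_injOn fun t ht t' ht' h => ?_
    have h1 := hsq t ht
    have h2 := hsq t' ht'
    rw [show Real.sqrt ((1 + t) / 2) = Real.sqrt ((1 + t') / 2) from h] at h1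
    linarith
  have hpos : ∀ z ∈ P, 0 < z := by
    intro z hz
    obtain ⟨t, ht, rfl⟩ := Finset.mem_image.1 hz
    exact Real.sqrt_pos.2 (by have := (mem_oddRoots.1 ht).1.1; linarith)
  have hroot : ∀ z ∈ P, z ^ 2 < 1 ∧ R.eval (2 * z ^ 2 - 1) = 0 := by
    intro z hz
    obtain ⟨t, ht, rfl⟩ := Finset.mem_image.1 hz
    rw [hsq t ht]
    refine ⟨by have := (mem_oddRoots.1 ht).1.2; linarith, ?_⟩
    rw [show 2 * ((1 + t) / 2) - 1 = t by ring]
    exact eval_eq_zero_of_mem_oddRoots ht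
  set Z : Finset ℝ := insert 0 (P ∪ P.image fun z => -z) with hZ
  have hZcard : Z.card = 2 * P.card + 1 := by
    rw [hZ, Finset.card_insert_of_notMem, Finset.card_union_of_disjoint,
      Finset.card_image_of_injective _ neg_injective]
    · ring
    · refine Finset.disjoint_left.2 fun z hz hz' => ?_
      obtain ⟨w, hw, rfl⟩ := Finset.mem_image.1 hz'
      have := hpos _ hz
      have := hpos _ hw
      linarith
    · intro h
      rcases Finset.mem_union.1 h with h | h
      · exact (hpos _ h).false
      · obtain ⟨w, hw, hw0⟩ := Finset.mem_image.1 h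
        have := hpos _ hw
        linarith
  have hZmem : ∀ z ∈ Z, z = 0 ∨ (z ^ 2 < 1 ∧ R.eval (2 * z ^ 2 - 1) = 0) := by
    intro z hz
    rcases Finset.mem_insert.1 hz with h | h
    · exact Or.inl h
    rcases Finset.mem_union.1 h with h | h
    · exact Or.inr (hroot z h)
    · obtain ⟨w, hw, rfl⟩ := Finset.mem_image.1 h
      rw [neg_sq]
      exact Or.inr (hroot w hw)
  refine ⟨Z.image fun z => (z, z), ?_, ?_, ?_⟩
  · intro p hp
    obtain ⟨z, hz, rfl⟩ := Finset.mem_image.1 (Finset.mem_coe.1 hp)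
    refine ⟨z, ?_, rfl, ?_⟩
    · rcases hZmem z hz with rfl | ⟨h, -⟩
      · norm_num
      · rw [sq_lt_one_iff_abs_lt_one, abs_lt] at h
        exact h
    · rw [evalAt_qExtra_diag]
      rcases hZmem z hz with rfl | ⟨-, h⟩
      · simp
      · rw [← hR, h]; simp
  · rw [Finset.card_image_of_injective _ fun a b h => (Prod.mk.inj h).1, hZcard, hPcard]
    have := le_card_oddRoots_diagExtra hα hβ s m
    rw [← hR] at this
    omega
  · intro p hp
    obtain ⟨z, hz, rfl⟩ := Finset.mem_image.1 hp
    rfl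

theorem card_filter_lt_comm (Z : Finset ℝ) :
    ((Z ×ˢ Z).filter fun z => z.1 < z.2).card = ((Z ×ˢ Z).filter fun z => z.2 < z.1).card := by
  refine Finset.card_bij (fun z _ => (z.2, z.1)) ?_ ?_ ?_
  · intro z hz; simp only [Finset.mem_filter, Finset.mem_product] at hz ⊢; tauto
  · rintro ⟨a, b⟩ _ ⟨c, d⟩ _ h; simp only [Prod.mk.injEq] at h ⊢; tauto
  · rintro ⟨a, b⟩ hz
    refine ⟨(b, a), ?_, rfl⟩
    simp only [Finset.mem_filter, Finset.mem_product] at hz ⊢; tauto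

theorem card_filter_lt_mul_two (Z : Finset ℝ) :
    ((Z ×ˢ Z).filter fun z => z.2 < z.1).card * 2 + Z.card = Z.card * Z.card := by
  have h1 : ((Z ×ˢ Z).filter fun z => z.1 < z.2).card =
      ((Z ×ˢ Z).filter fun z => z.2 < z.1).card := card_filter_lt_comm Z
  have h2 : ((Z ×ˢ Z).filter fun z => z.1 = z.2).card = Z.card := by
    refine Finset.card_bij (fun z _ => z.1) ?_ ?_ ?_
    · intro z hz; simp only [Finset.mem_filter, Finset.mem_product] at hz; exact hz.1.1
    · rintro ⟨a, b⟩ hz ⟨c, d⟩ hw h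
      simp only [Finset.mem_filter, Finset.mem_product, Prod.mk.injEq] at *
      exact ⟨h, by rw [← hz.2, ← hw.2, h]⟩
    · intro a ha
      exact ⟨(a, a), by simp [ha], rfl⟩
  have h3 := Finset.card_filter_add_card_filter_not (s := Z ×ˢ Z) (fun z => z.2 < z.1)
  have h4 := Finset.card_filter_add_card_filter_not
    (s := (Z ×ˢ Z).filter fun z => ¬ z.2 < z.1) (fun z => z.1 = z.2)
  rw [Finset.filter_filter, Finset.filter_filter] at h4
  have h5 : ((Z ×ˢ Z).filter fun z => ¬ z.2 < z.1 ∧ z.1 = z.2) =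
      (Z ×ˢ Z).filter fun z => z.1 = z.2 :=
    Finset.filter_congr fun z _ => ⟨fun h => h.2, fun h => ⟨by rw [h]; exact lt_irrefl _, h⟩⟩
  have h6 : ((Z ×ˢ Z).filter fun z => ¬ z.2 < z.1 ∧ ¬ z.1 = z.2) =
      (Z ×ˢ Z).filter fun z => z.1 < z.2 :=
    Finset.filter_congr fun z _ => ⟨fun h => lt_of_le_of_ne (not_lt.1 h.1) h.2,
      fun h => ⟨not_lt.2 h.le, h.ne⟩⟩
  rw [h5, h6, h1, h2] at h4
  rw [Finset.card_product] at h3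
  omega

/-- The order relation between the zeros that belongs to the sign. -/
def ordRel : Sgn → ℝ → ℝ → Prop
  | .minus, x, y => x ≤ y
  | .plus, x, y => x < y

theorem ordRel.le {s : Sgn} {x y : ℝ} (h : ordRel s x y) : x ≤ y := by
  cases s
  · exact h
  · exact le_of_lt h

open Classical in
theorem card_filter_ordRel (s : Sgn) (m : ℕ) (Z : Finset ℝ) (hZ : Z.card = topDeg s m) :
    ((Z ×ˢ Z).filter fun z => ordRel s z.2 z.1).card * 2 = m * (m + 1) := by
  have h1 := card_filter_lt_mul_two Z
  cases s with
  | minus =>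
    simp only [topDeg] at hZ
    have h2 : ((Z ×ˢ Z).filter fun z => ordRel .minus z.2 z.1).card =
        ((Z ×ˢ Z).filter fun z => z.2 < z.1).card + Z.card := by
      have h3 := Finset.card_filter_add_card_filter_not (s := Z ×ˢ Z) (fun z => z.1 < z.2)
      have h4 : ((Z ×ˢ Z).filter fun z => ¬ z.1 < z.2) =
          (Z ×ˢ Z).filter fun z => ordRel .minus z.2 z.1 :=
        Finset.filter_congr fun z _ => not_lt
      have h5 : ((Z ×ˢ Z).filter fun z => z.1 < z.2).card =
          ((Z ×ˢ Z).filter fun z => z.2 < z.1).card := card_filter_lt_comm Z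
      rw [h4, h5, Finset.card_product] at h3
      omega
    rw [h2]
    rw [hZ] at h1 ⊢
    nlinarith
  | plus =>
    simp only [topDeg] at hZ
    have h2 : ((Z ×ˢ Z).filter fun z => ordRel .plus z.2 z.1) =
        (Z ×ˢ Z).filter fun z => z.2 < z.1 := Finset.filter_congr fun z _ => Iff.rfl
    rw [h2]
    rw [hZ] at h1
    nlinarith

/-- The value of `x + y` at the node `(cos ((θ-φ)/2), cos ((θ+φ)/2))`, where `z = (cos θ, cos φ)`. -/
noncomputable def nodeSum (z : ℝ × ℝ) : ℝ :=
  2 * (Real.cos (Real.arccos z.1 / 2) * Real.cos (Real.arccos z.2 / 2))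

/-- The value of `x - y` at the node `(cos ((θ-φ)/2), cos ((θ+φ)/2))`, where `z = (cos θ, cos φ)`. -/
noncomputable def nodeDiff (z : ℝ × ℝ) : ℝ :=
  2 * (Real.sin (Real.arccos z.1 / 2) * Real.sin (Real.arccos z.2 / 2))

theorem nodeSum_sq {z : ℝ × ℝ} (hz : z ∈ openSquare) :
    nodeSum z ^ 2 = (1 + z.1) * (1 + z.2) := by
  have h : ∀ x ∈ Set.Ioo (-1 : ℝ) 1, 2 * Real.cos (Real.arccos x / 2) ^ 2 = 1 + x := by
    intro x hx
    have := Real.cos_two_mul (Real.arccos x / 2)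
    rw [mul_div_cancel₀ _ (two_ne_zero), Real.cos_arccos hx.1.le hx.2.le] at this
    linarith
  rw [← h _ hz.1, ← h _ hz.2, nodeSum]
  ring

theorem nodeDiff_sq {z : ℝ × ℝ} (hz : z ∈ openSquare) :
    nodeDiff z ^ 2 = (1 - z.1) * (1 - z.2) := by
  have h : ∀ x ∈ Set.Ioo (-1 : ℝ) 1, 2 * Real.sin (Real.arccos x / 2) ^ 2 = 1 - x := by
    intro x hx
    have := Real.cos_two_mul (Real.arccos x / 2)
    have h2 := Real.sin_sq_add_cos_sq (Real.arccos x / 2)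
    rw [mul_div_cancel₀ _ (two_ne_zero), Real.cos_arccos hx.1.le hx.2.le] at this
    linarith
  rw [← h _ hz.1, ← h _ hz.2, nodeDiff]
  ring

theorem nodeSum_pos {z : ℝ × ℝ} (hz : z ∈ openSquare) : 0 < nodeSum z := by
  have h : ∀ x ∈ Set.Ioo (-1 : ℝ) 1, 0 < Real.cos (Real.arccos x / 2) := by
    intro x hx
    have h1 := Real.arccos_pos.2 hx.2
    have h2 := Real.arccos_lt_pi.2 hx.1
    exact Real.cos_pos_of_mem_Ioo ⟨by linarith, by linarith⟩
  exact mul_pos two_pos (mul_pos (h _ hz.1) (h _ hz.2))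

theorem nodeDiff_pos {z : ℝ × ℝ} (hz : z ∈ openSquare) : 0 < nodeDiff z := by
  have h : ∀ x ∈ Set.Ioo (-1 : ℝ) 1, 0 < Real.sin (Real.arccos x / 2) := by
    intro x hx
    have h1 := Real.arccos_pos.2 hx.2
    have h2 := Real.arccos_lt_pi.2 hx.1
    exact Real.sin_pos_of_mem_Ioo ⟨by linarith, by linarith⟩
  exact mul_pos two_pos (mul_pos (h _ hz.1) (h _ hz.2))

/-- The point with `x + y = ε nodeSum z` and `x - y = δ nodeDiff z`. -/
noncomputable def nodePoint (w : (ℝ × ℝ) × ℝ × ℝ) : ℝ × ℝ :=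
  ((w.2.1 * nodeSum w.1 + w.2.2 * nodeDiff w.1) / 2,
    (w.2.1 * nodeSum w.1 - w.2.2 * nodeDiff w.1) / 2)

open Classical in
/-- There are at least `2m(m+1)` nodes off the diagonal. -/
theorem exists_offDiagonal_finset {α β : ℝ} (hα : -1 < α) (hβ : -1 < β) (s : Sgn) (m : ℕ) :
    ∃ D : Finset (ℝ × ℝ), (D : Set (ℝ × ℝ)) ⊆ offDiagonalNodes α β s m ∧
      2 * (m * (m + 1)) ≤ D.card ∧ ∀ p ∈ D, p.1 ≠ p.2 := by
  have hα1 : -1 < α + 1 := by linarith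
  set Z := oddRoots (jacobi (α + 1) β (topDeg s m)) with hZ
  have hZcard : Z.card = topDeg s m := card_oddRoots_jacobi hα1 hβ _
  set T := (Z ×ˢ Z).filter fun z => ordRel s z.2 z.1 with hT
  have hTcard : T.card * 2 = m * (m + 1) := card_filter_ordRel s m Z hZcard
  have hTsq : ∀ z ∈ T, z ∈ openSquare := fun z hz => by
    have := Finset.mem_product.1 (Finset.mem_filter.1 hz).1
    exact ⟨(mem_oddRoots.1 this.1).1, (mem_oddRoots.1 this.2).1⟩
  set E : Finset ℝ := {1, -1} with hE
  have hEcard : E.card = 2 := Finset.card_pair (by norm_num)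
  have hEsq : ∀ e ∈ E, e ^ 2 = 1 := by
    intro e he
    rcases Finset.mem_insert.1 he with rfl | he
    · norm_num
    · rw [Finset.mem_singleton.1 he]; norm_num
  refine ⟨(T ×ˢ (E ×ˢ E)).image nodePoint, ?_, ?_, ?_⟩
  · intro p hp
    obtain ⟨⟨z, e, d⟩, hw, rfl⟩ := Finset.mem_image.1 (Finset.mem_coe.1 hp)
    obtain ⟨hz, hed⟩ := Finset.mem_product.1 hw
    obtain ⟨he, hd⟩ := Finset.mem_product.1 hed
    have hsq := hTsq z hz
    obtain ⟨hzZ, hord⟩ := Finset.mem_filter.1 hz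
    obtain ⟨hz1, hz2⟩ := Finset.mem_product.1 hzZ
    refine ⟨Real.arccos z.1, ⟨Real.arccos_pos.2 hsq.1.2, Real.arccos_lt_pi.2 hsq.1.1⟩,
      Real.arccos z.2, ⟨Real.arccos_pos.2 hsq.2.2, Real.arccos_lt_pi.2 hsq.2.1⟩, ?_, ?_⟩
    · have e1 := eval_eq_zero_of_mem_oddRoots hz1
      have e2 := eval_eq_zero_of_mem_oddRoots hz2
      cases s with
      | minus =>
        rw [Real.cos_arccos hsq.1.1.le hsq.1.2.le, Real.cos_arccos hsq.2.1.le hsq.2.2.le]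
        exact ⟨e1, e2, Real.arccos_le_arccos hord⟩
      | plus =>
        rw [Real.cos_arccos hsq.1.1.le hsq.1.2.le, Real.cos_arccos hsq.2.1.le hsq.2.2.le]
        exact ⟨e1, e2, Real.arccos_lt_arccos hsq.2.1.le hord hsq.1.2.le⟩
    · simp only [nodePoint, nodeSum, nodeDiff, sub_div, add_div, Real.cos_sub, Real.cos_add,
        Prod.mk.injEq]
      simp only [hE, Finset.mem_insert, Finset.mem_singleton] at he hd
      rcases he with rfl | rfl <;> rcases hd with rfl | rfl
      · left; constructor <;> ring
      · right; left; constructor <;> ring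
      · right; right; right; constructor <;> ring
      · right; right; left; constructor <;> ring
  · rw [Finset.card_image_of_injOn, Finset.card_product, Finset.card_product, hEcard]
    · omega
    · rintro ⟨z, e, d⟩ hw ⟨z', e', d'⟩ hw' h
      obtain ⟨hz, hed⟩ := Finset.mem_product.1 (Finset.mem_coe.1 hw)
      obtain ⟨he, hd⟩ := Finset.mem_product.1 hed
      obtain ⟨hz', hed'⟩ := Finset.mem_product.1 (Finset.mem_coe.1 hw')
      obtain ⟨he', hd'⟩ := Finset.mem_product.1 hed'
      simp only [nodePoint, Prod.mk.injEq] at h hz hz' he hd he' hd'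
      obtain ⟨h1, h2⟩ := h
      have hS : e * nodeSum z = e' * nodeSum z' := by linarith
      have hD : d * nodeDiff z = d' * nodeDiff z' := by linarith
      have hS2 : nodeSum z ^ 2 = nodeSum z' ^ 2 := by
        have := congrArg (· ^ 2) hS
        simpa only [mul_pow, hEsq _ he, hEsq _ he', one_mul] using this
      have hD2 : nodeDiff z ^ 2 = nodeDiff z' ^ 2 := by
        have := congrArg (· ^ 2) hD
        simpa only [mul_pow, hEsq _ hd, hEsq _ hd', one_mul] using this
      rw [nodeSum_sq (hTsq z hz), nodeSum_sq (hTsq z' hz')] at hS2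
      rw [nodeDiff_sq (hTsq z hz), nodeDiff_sq (hTsq z' hz')] at hD2
      have hord := (Finset.mem_filter.1 hz).2.le
      have hord' := (Finset.mem_filter.1 hz').2.le
      have hzz : z = z' := by
        have hsum : z.1 + z.2 = z'.1 + z'.2 := by linarith
        have hprod : z.1 * z.2 = z'.1 * z'.2 := by linarith
        have hfac : (z.1 - z'.1) * (z.1 - z'.2) = 0 := by
          linear_combination z.1 * hsum - hprod
        rcases mul_eq_zero.1 hfac with h | h
        · exact Prod.ext (by linarith) (by linarith)
        · exact Prod.ext (by linarith) (by linarith)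
      subst hzz
      have e1 : e = e' := mul_right_cancel₀ (nodeSum_pos (hTsq z hz)).ne' hS
      have e2 : d = d' := mul_right_cancel₀ (nodeDiff_pos (hTsq z hz)).ne' hD
      rw [e1, e2]
  · intro p hp heq
    obtain ⟨⟨z, e, d⟩, hw, rfl⟩ := Finset.mem_image.1 hp
    obtain ⟨hz, hed⟩ := Finset.mem_product.1 hw
    obtain ⟨he, hd⟩ := Finset.mem_product.1 hed
    simp only [nodePoint] at heq hz hd
    have h1 : d * nodeDiff z = 0 := by linarith
    rcases mul_eq_zero.1 h1 with h | h
    · have := hEsq d hd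
      rw [h] at this
      norm_num at this
    · exact (nodeDiff_pos (hTsq z hz)).ne' h

/-- There are at least `2(m+1)² - 1` nodes. -/
theorem exists_nodes_finset {α β : ℝ} (hα : -1 < α) (hβ : -1 < β) (s : Sgn) (m : ℕ) :
    ∃ D : Finset (ℝ × ℝ),
      (D : Set (ℝ × ℝ)) ⊆ offDiagonalNodes α β s m ∪ diagonalNodes α β s m ∧
      2 * (m + 1) ^ 2 ≤ D.card + 1 := by
  classical
  obtain ⟨D, hD, hDc, hDd⟩ := exists_diagonal_finset hα hβ s m
  obtain ⟨E, hE, hEc, hEd⟩ := exists_offDiagonal_finset hα hβ s m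
  refine ⟨E ∪ D, ?_, ?_⟩
  · rw [Finset.coe_union]
    exact Set.union_subset_union hE hD
  · rw [Finset.card_union_of_disjoint (Finset.disjoint_left.2 fun p h1 h2 => hEd p h1 (hDd p h2))]
    nlinarith


/-! ### Independence and exact degree of the generators -/

theorem linearIndependent_monomials :
    LinearIndependent ℝ fun p : ℕ × ℕ =>
      (MvPolynomial.X 0 ^ p.1 * MvPolynomial.X 1 ^ p.2 : Poly2) := by
  have hinj : Function.Injective fun p : ℕ × ℕ =>
      (Finsupp.single 0 p.1 + Finsupp.single 1 p.2 : Fin 2 →₀ ℕ) := by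
    intro p q h
    have h0 := DFunLike.congr_fun h 0
    have h1 := DFunLike.congr_fun h 1
    simp at h0 h1
    exact Prod.ext h0 h1
  have h := (MvPolynomial.basisMonomials (Fin 2) ℝ).linearIndependent.comp _ hinj
  have e : (MvPolynomial.basisMonomials (Fin 2) ℝ) ∘ (fun p : ℕ × ℕ =>
      (Finsupp.single 0 p.1 + Finsupp.single 1 p.2 : Fin 2 →₀ ℕ)) =
      fun p : ℕ × ℕ => (MvPolynomial.X 0 ^ p.1 * MvPolynomial.X 1 ^ p.2 : Poly2) := by
    ext1 p
    rw [Function.comp_apply, MvPolynomial.coe_basisMonomials, MvPolynomial.X_pow_eq_monomial,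
      MvPolynomial.X_pow_eq_monomial, MvPolynomial.monomial_mul, one_mul]
  rwa [e] at h

/-- The span of the monomials with exponents in `I`. -/
noncomputable def monoSpan (I : Finset (ℕ × ℕ)) : Submodule ℝ Poly2 :=
  Submodule.span ℝ (Set.range fun p : I =>
    (MvPolynomial.X 0 ^ p.1.1 * MvPolynomial.X 1 ^ p.1.2 : Poly2))

theorem finrank_monoSpan (I : Finset (ℕ × ℕ)) : Module.finrank ℝ (monoSpan I) = I.card := by
  have h := finrank_span_eq_card (linearIndependent_monomials.comp (fun p : I => p.1)
    Subtype.val_injective)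
  rw [Fintype.card_coe] at h
  exact h

instance (I : Finset (ℕ × ℕ)) : FiniteDimensional ℝ (monoSpan I) :=
  FiniteDimensional.span_of_finite ℝ (Set.finite_range _)

theorem monoSpan_le {I : Finset (ℕ × ℕ)} {S : Submodule ℝ Poly2}
    (h : ∀ p ∈ I, MvPolynomial.X 0 ^ p.1 * MvPolynomial.X 1 ^ p.2 ∈ S) : monoSpan I ≤ S :=
  Submodule.span_le.2 fun _ ⟨p, hp⟩ => hp ▸ h p.1 p.2

theorem card_biUnion_antidiagonal {κ : Type*} [DecidableEq κ] (K : Finset κ) (d : κ → ℕ)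
    (hd : Function.Injective d) :
    (K.biUnion fun k => Finset.HasAntidiagonal.antidiagonal (d k)).card = ∑ k ∈ K, (d k + 1) := by
  rw [Finset.card_biUnion]
  · exact Finset.sum_congr rfl fun k _ => Finset.Nat.card_antidiagonal _
  · intro k _ l _ hkl
    refine Finset.disjoint_left.2 fun p h1 h2 => hkl (hd ?_)
    rw [Finset.HasAntidiagonal.mem_antidiagonal] at h1 h2
    rw [← h1, ← h2]

section

variable {α β : ℝ} (hα : -1 < α) (hβ : -1 < β) (s : Sgn) (m : ℕ)

theorem idealLE_zero_le (α β : ℝ) (s : Sgn) (m : ℕ) :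
    idealLE α β s m 0 ≤ Submodule.span ℝ (Set.range (generators α β s m)) := by
  refine Submodule.span_le.2 ?_
  rintro _ ⟨g, hg, i, rfl⟩
  have : degLT 1 ≤ (Submodule.span ℝ (Set.range (generators α β s m))).comap
      (LinearMap.mulRight ℝ (generators α β s m i)) := by
    refine spanLT_le fun k l hkl => ?_
    obtain ⟨rfl, rfl⟩ : k = 0 ∧ l = 0 := by omega
    simpa using Submodule.subset_span (Set.mem_range_self i)
  exact this hg

include hα hβ in
/-- The generators are linearly independent: together with the complement they span the space of all
polynomials of degree at most `2m + 1`, whose dimension leaves no room for a relation. -/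
theorem linearIndependent_generators : LinearIndependent ℝ (generators α β s m) := by
  rw [linearIndependent_iff_card_le_finrank_span, Fintype.card_fin]
  set I := (Finset.range (2 * m + 2)).biUnion fun k => Finset.HasAntidiagonal.antidiagonal k
  have hI : I.card * 2 = (2 * m + 2) * (2 * m + 2 + 1) := by
    rw [card_biUnion_antidiagonal _ (fun k => k) Function.injective_id, sum_range_add_one_mul_two]
  have h1 : monoSpan I ≤ compl m ⊔ Submodule.span ℝ (Set.range (generators α β s m)) := by
    refine monoSpan_le fun p hp => ?_
    obtain ⟨k, hk, hpk⟩ := Finset.mem_biUnion.1 hp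
    rw [Finset.HasAntidiagonal.mem_antidiagonal] at hpk
    have h2 := degLT_le_compl_sup_idealLE s hα hβ (topNonzero hα hβ s m) 0 (2 * m + 1) le_rfl
    refine sup_le_sup_left (idealLE_zero_le α β s m) _ (h2 (pow_mul_pow_mem_spanLT ?_))
    rw [hpk]
    exact Finset.mem_range.1 hk
  have : FiniteDimensional ℝ (Submodule.span ℝ (Set.range (generators α β s m))) :=
    FiniteDimensional.span_of_finite ℝ (Set.finite_range _)
  have h2 := Submodule.finrank_mono h1
  have h3 := Submodule.finrank_add_le_finrank_add_finrank (compl m)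
    (Submodule.span ℝ (Set.range (generators α β s m)))
  have h4 := finrank_compl_add_one_le m
  rw [finrank_monoSpan] at h2
  unfold Set.finrank
  nlinarith

theorem generators_mem_degLT (hα : -1 < α) (hβ : -1 < β) (i : Fin (m + 2)) :
    generators α β s m i ∈ degLT (2 * m + 2) := by
  have hα1 : -1 < α + 1 := by linarith
  have hβ1 : -1 < β + 1 := by linarith
  refine Fin.cases ?_ (fun k => ?_) i
  · change qExtra α β s m ∈ _
    rw [qExtra_eq]
    exact C_mul_mem _ (mul_substUV_mem_degLT (d := m + 1) sumXY_mem (pairPoly_mem_degLT s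
      (natDegree_jacobi hα hβ1 _).le (natDegree_jacobi hα1 hβ _).le))
  · change Q₂ α β s m k ∈ _
    rw [Q₂_eq]
    refine C_mul_mem _ (mul_substUV_mem_degLT (d := m + 1) diffXY_mem (pairPoly_mem_degLT s
      (natDegree_jacobi hα1 hβ _).le ((natDegree_jacobi hα1 hβ _).le.trans ?_)))
    have := k.2
    cases s <;> simp only [topDeg] <;> omega

include hα hβ in
theorem isOrthogonalPoly_generators (i : Fin (m + 2)) :
    IsOrthogonalPoly (weight α β s) (2 * m + 1) (generators α β s m i) := by
  constructor
  · have h1 := totalDegree_lt_of_mem_degLT (generators_mem_degLT s m hα hβ i)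
    by_contra hne
    have h2 := weightInt_generators_mul hα hβ s m i
      (mem_degLT_of_totalDegree_lt (show (generators α β s m i).totalDegree < 2 * m + 1 by omega))
    exact (linearIndependent_generators hα hβ s m).ne_zero i (eq_zero_of_weightInt_sq hα hβ s h2)
  · intro Q hQ
    have h1 := weightInt_generators_mul hα hβ s m i (mem_degLT_of_totalDegree_lt hQ)
    have h2 := integrableOn_evalAt_mul hα hβ s (generators α β s m i * Q)
    rw [weightInt_apply] at h1
    simp only [evalAt_eq, map_mul] at h1 h2 ⊢
    exact ⟨h2, h1⟩

/-! ### The ideal of the common zeros -/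

theorem evalHom_idealLE {e : ℕ} {f : Poly2} (hf : f ∈ idealLE α β s m e) {p : ℝ × ℝ}
    (hp : p ∈ commonZeros α β s m) : evalHom p f = 0 := by
  have : idealLE α β s m e ≤ LinearMap.ker (evalHom p).toLinearMap := by
    refine Submodule.span_le.2 ?_
    rintro _ ⟨g, -, i, rfl⟩
    have hi := hp i
    rw [evalAt_eq] at hi
    simp [hi]
  exact this hf

theorem weightInt_idealLE {f : Poly2} (hf : f ∈ idealLE α β s m (2 * m)) :
    weightInt hα hβ s f = 0 := by
  have : idealLE α β s m (2 * m) ≤ LinearMap.ker (weightInt hα hβ s) := by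
    refine Submodule.span_le.2 ?_
    rintro _ ⟨g, hg, i, rfl⟩
    rw [SetLike.mem_coe, LinearMap.mem_ker, mul_comm]
    exact weightInt_generators_mul hα hβ s m i hg
  exact this hf

theorem exists_separating_pair {p q : ℝ × ℝ} (h : p ≠ q) :
    ∃ f : Poly2, evalHom p f = 1 ∧ evalHom q f = 0 := by
  by_cases h1 : p.1 = q.1
  · have h2 : p.2 - q.2 ≠ 0 := sub_ne_zero.2 fun h2 => h (Prod.ext h1 h2)
    refine ⟨MvPolynomial.C (p.2 - q.2)⁻¹ * (MvPolynomial.X 1 - MvPolynomial.C q.2), ?_, ?_⟩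
    · simp only [map_mul, map_sub, evalHom_C, evalHom_X1]; exact inv_mul_cancel₀ h2
    · simp only [map_mul, map_sub, evalHom_C, evalHom_X1]; ring
  · have h2 : p.1 - q.1 ≠ 0 := sub_ne_zero.2 h1
    refine ⟨MvPolynomial.C (p.1 - q.1)⁻¹ * (MvPolynomial.X 0 - MvPolynomial.C q.1), ?_, ?_⟩
    · simp only [map_mul, map_sub, evalHom_C, evalHom_X0]; exact inv_mul_cancel₀ h2
    · simp only [map_mul, map_sub, evalHom_C, evalHom_X0]; ring

theorem exists_separating (Y : Finset (ℝ × ℝ)) (p : ℝ × ℝ) :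
    ∃ f : Poly2, evalHom p f = 1 ∧ ∀ q ∈ Y, q ≠ p → evalHom q f = 0 := by
  classical
  choose g hg1 hg2 using fun q : {q : ℝ × ℝ // p ≠ q} => exists_separating_pair q.2
  refine ⟨∏ q ∈ Y, if h : p ≠ q then g ⟨q, h⟩ else 1, ?_, ?_⟩
  · rw [map_prod]
    refine Finset.prod_eq_one fun q _ => ?_
    split_ifs with h
    · exact hg1 ⟨q, h⟩
    · exact map_one _
  · intro q hq hne
    rw [map_prod]
    refine Finset.prod_eq_zero hq ?_
    rw [dif_pos hne.symm]
    exact hg2 ⟨q, hne.symm⟩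

/-- Evaluation at finitely many points, on the complement of the ideal. -/
noncomputable def evalCompl (m : ℕ) (Y : Finset (ℝ × ℝ)) : compl m →ₗ[ℝ] (Y → ℝ) :=
  LinearMap.pi fun p => (evalHom p.1).toLinearMap.domRestrict (compl m)

theorem evalCompl_apply (m : ℕ) (Y : Finset (ℝ × ℝ)) (f : compl m) (p : Y) :
    evalCompl m Y f p = evalHom p.1 f := rfl

include hα hβ in
theorem evalCompl_surjective {Y : Finset (ℝ × ℝ)} (hY : (Y : Set (ℝ × ℝ)) ⊆ commonZeros α β s m) :
    Function.Surjective (evalCompl m Y) := by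
  classical
  rw [← LinearMap.range_eq_top, ← top_le_iff, ← (Pi.basisFun ℝ Y).span_eq]
  refine Submodule.span_le.2 ?_
  rintro _ ⟨p, rfl⟩
  obtain ⟨f, hf1, hf2⟩ := exists_separating Y p
  have hf := mem_degLT_of_totalDegree_lt (Nat.lt_succ_self f.totalDegree)
  obtain ⟨c, hc, k, hk, hck⟩ := Submodule.mem_sup.1 (degLT_le_compl_sup_idealLE s hα hβ
    (topNonzero hα hβ s m) f.totalDegree f.totalDegree (by omega) hf)
  refine ⟨⟨c, hc⟩, ?_⟩
  funext q
  have h1 : evalHom q.1 c = evalHom q.1 f := by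
    rw [← hck, map_add, evalHom_idealLE s m hk (hY q.2), add_zero]
  rw [evalCompl_apply, h1, Pi.basisFun_apply]
  by_cases hqp : q = p
  · subst hqp; simpa using hf1
  · rw [Pi.single_eq_of_ne hqp]
    exact hf2 q q.2 fun h => hqp (Subtype.ext h)

include hα hβ in
theorem card_le_of_subset_commonZeros {Y : Finset (ℝ × ℝ)}
    (hY : (Y : Set (ℝ × ℝ)) ⊆ commonZeros α β s m) : Y.card + 1 ≤ 2 * (m + 1) ^ 2 := by
  have h1 := LinearMap.finrank_le_finrank_of_surjective (evalCompl_surjective hα hβ s m hY)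
  rw [Module.finrank_fintype_fun_eq_card, Fintype.card_coe] at h1
  exact (Nat.add_le_add_right h1 1).trans (finrank_compl_add_one_le m)

include hα hβ in
/-- The common zeros are the nodes found explicitly, since there cannot be more of them than the
dimension of the complement. -/
theorem exists_finset_eq_commonZeros :
    ∃ D : Finset (ℝ × ℝ), (D : Set (ℝ × ℝ)) = commonZeros α β s m ∧
      D.card + 1 = 2 * (m + 1) ^ 2 ∧
      commonZeros α β s m = offDiagonalNodes α β s m ∪ diagonalNodes α β s m := by
  classical
  obtain ⟨D, hD, hDc⟩ := exists_nodes_finset hα hβ s m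
  have hsub : offDiagonalNodes α β s m ∪ diagonalNodes α β s m ⊆ commonZeros α β s m :=
    Set.union_subset (offDiagonalNodes_subset α β s m) (diagonalNodes_subset α β s m)
  have hDz := hD.trans hsub
  have hle := card_le_of_subset_commonZeros hα hβ s m hDz
  have hback : commonZeros α β s m ⊆ D := by
    intro p hp
    by_contra hpD
    have h1 : ((insert p D : Finset (ℝ × ℝ)) : Set (ℝ × ℝ)) ⊆ commonZeros α β s m := by
      rw [Finset.coe_insert]
      exact Set.insert_subset hp hDz
    have h2 := card_le_of_subset_commonZeros hα hβ s m h1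
    rw [Finset.card_insert_of_notMem hpD] at h2
    omega
  exact ⟨D, hDz.antisymm hback, by omega, (hback.trans hD).antisymm hsub⟩

/-! ### The lower bound for the number of nodes -/

/-- The exponents of the monomials of even degree at most `2m`. -/
def evenExp (m : ℕ) : Finset (ℕ × ℕ) :=
  (Finset.range (m + 1)).biUnion fun k => Finset.HasAntidiagonal.antidiagonal (2 * k)

theorem card_evenExp (m : ℕ) : (evenExp m).card = (m + 1) ^ 2 := by
  rw [evenExp, card_biUnion_antidiagonal _ (fun k => 2 * k) fun a b h => by simpa using h]
  induction m with
  | zero => simp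
  | succ m ih => rw [Finset.sum_range_succ, ih]; ring

theorem mem_evenExp {m : ℕ} {p : ℕ × ℕ} (hp : p ∈ evenExp m) :
    Even (p.1 + p.2) ∧ p.1 + p.2 < 2 * m + 1 := by
  obtain ⟨k, hk, hp⟩ := Finset.mem_biUnion.1 hp
  rw [Finset.HasAntidiagonal.mem_antidiagonal] at hp
  rw [Finset.mem_range] at hk
  exact ⟨⟨k, by omega⟩, by omega⟩

theorem monoSpan_evenExp_le (m : ℕ) : monoSpan (evenExp m) ≤ degLT (2 * m + 1) :=
  monoSpan_le fun _ hp => pow_mul_pow_mem_spanLT (mem_evenExp hp).2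

theorem evalHom_neg_of_mem {m : ℕ} {f : Poly2} (hf : f ∈ monoSpan (evenExp m)) (p : ℝ × ℝ) :
    evalHom (-p) f = evalHom p f := by
  have : monoSpan (evenExp m) ≤
      LinearMap.ker ((evalHom (-p)).toLinearMap - (evalHom p).toLinearMap) := by
    refine monoSpan_le fun q hq => ?_
    rw [LinearMap.mem_ker, LinearMap.sub_apply, AlgHom.toLinearMap_apply, AlgHom.toLinearMap_apply,
      map_mul, map_mul, map_pow, map_pow, map_pow, map_pow, evalHom_X0, evalHom_X1, evalHom_X0,
      evalHom_X1, Prod.fst_neg, Prod.snd_neg, neg_pow p.1, neg_pow p.2, sub_eq_zero,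
      mul_mul_mul_comm, ← pow_add, (mem_evenExp hq).1.neg_one_pow, one_mul]
  have h := this hf
  rwa [LinearMap.mem_ker, LinearMap.sub_apply, sub_eq_zero] at h

theorem evalHom_zero_of_mem {m : ℕ} {f : Poly2}
    (hf : f ∈ monoSpan ((evenExp m).erase (0, 0))) : evalHom 0 f = 0 := by
  have : monoSpan ((evenExp m).erase (0, 0)) ≤ LinearMap.ker (evalHom 0).toLinearMap := by
    refine monoSpan_le fun q hq => ?_
    have hne := (Finset.mem_erase.1 hq).1
    rw [LinearMap.mem_ker, AlgHom.toLinearMap_apply, map_mul, map_pow, map_pow, evalHom_X0,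
      evalHom_X1, Prod.fst_zero, Prod.snd_zero]
    rcases Nat.eq_zero_or_pos q.1 with h | h
    · have h2 : q.2 ≠ 0 := fun h2 => hne (Prod.ext h h2)
      rw [zero_pow h2, mul_zero]
    · rw [zero_pow h.ne', zero_mul]
  exact this hf

/-- There is a linear form that does not vanish at any of finitely many points other than the
origin. -/
theorem exists_linearForm (Y : Finset (ℝ × ℝ)) :
    ∃ ℓ ∈ degLT 2, (∀ p, evalHom (-p) ℓ = -evalHom p ℓ) ∧ ∀ p ∈ Y, p ≠ 0 → evalHom p ℓ ≠ 0 := by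
  classical
  obtain ⟨c, hc⟩ := Infinite.exists_notMem_finset (Y.image fun p => -p.1 / p.2)
  refine ⟨MvPolynomial.X 0 + MvPolynomial.C c * MvPolynomial.X 1,
    add_mem (X_mem_degLT 0) (C_mul_mem c (X_mem_degLT 1)), fun p => ?_, fun p hp hp0 h => ?_⟩
  · simp only [map_add, map_mul, evalHom_X0, evalHom_X1, evalHom_C, Prod.fst_neg, Prod.snd_neg]
    ring
  · simp only [map_add, map_mul, evalHom_X0, evalHom_X1, evalHom_C] at h
    by_cases h2 : p.2 = 0
    · rw [h2, mul_zero, add_zero] at h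
      exact hp0 (Prod.ext h h2)
    · refine hc (Finset.mem_image.2 ⟨p, hp, ?_⟩)
      rw [div_eq_iff h2]
      linarith

/-- A rule that is exact on all polynomials of degree at most `4m + 1` has at least `2(m+1)² - 1`
nodes. With `ℓ` a linear form that vanishes at no node but possibly the origin, the polynomials
`f + ℓ g` with `f, g` even of degree at most `2m` and `g(0) = 0` are determined by their values at
the nodes: if these vanish, then the integral of `f²`, which is that of `f (f + ℓ g)` as the weight
is even, is zero. -/
theorem lower_bound {Y : Finset (ℝ × ℝ)} {lam : ℝ × ℝ → ℝ}
    (h : ∀ f ∈ degLT (4 * m + 2), weightInt hα hβ s f = ∑ p ∈ Y, lam p * evalHom p f) :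
    2 * (m + 1) ^ 2 ≤ Y.card + 1 := by
  obtain ⟨ℓ, hℓ, hℓneg, hℓY⟩ := exists_linearForm Y
  let E := monoSpan (evenExp m)
  let E' := monoSpan ((evenExp m).erase (0, 0))
  have hE' : E' ≤ E := monoSpan_le fun p hp =>
    Submodule.subset_span ⟨⟨p, Finset.mem_of_mem_erase hp⟩, rfl⟩
  let ev : Poly2 →ₗ[ℝ] (Y → ℝ) := LinearMap.pi fun p => (evalHom p.1).toLinearMap
  let Φ : E × E' →ₗ[ℝ] (Y → ℝ) :=
    ev.comp (E.subtype.coprod ((LinearMap.mulLeft ℝ ℓ).comp E'.subtype))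
  have hΦ : ∀ (x : E × E') (p : Y), Φ x p = evalHom p.1 x.1 + evalHom p.1 ℓ * evalHom p.1 x.2 := by
    intro x p
    simp [Φ, ev]
  have hinj : Function.Injective Φ := by
    rw [← LinearMap.ker_eq_bot, LinearMap.ker_eq_bot']
    rintro ⟨⟨f, hf⟩, ⟨g, hg⟩⟩ hfg
    have hval : ∀ p ∈ Y, evalHom p f + evalHom p ℓ * evalHom p g = 0 := fun p hp => by
      rw [← hΦ (⟨f, hf⟩, ⟨g, hg⟩) ⟨p, hp⟩, hfg]; rfl
    have hgE := hE' hg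
    have hfd := monoSpan_evenExp_le m hf
    have hgd := monoSpan_evenExp_le m hgE
    have hf0 : f = 0 := by
      have h1 : weightInt hα hβ s (f * (f + ℓ * g)) = 0 := by
        rw [h _ (degLT_mono (by omega) (mul_mem_degLT hfd
          (add_mem (degLT_mono (Nat.le_add_left _ 1) hfd) (mul_mem_degLT (d := 1) hℓ hgd))))]
        refine Finset.sum_eq_zero fun p hp => ?_
        rw [map_mul, map_add, map_mul, hval p hp, mul_zero, mul_zero]
      have h2 : weightInt hα hβ s (f * (ℓ * g)) = 0 := by
        refine weightInt_eq_zero_of_neg hα hβ s fun p => ?_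
        simp only [evalAt_eq, map_mul, evalHom_neg_of_mem hf, evalHom_neg_of_mem hgE, hℓneg]
        ring
      rw [mul_add, map_add, h2, add_zero] at h1
      exact eq_zero_of_weightInt_sq hα hβ s h1
    have hg0 : g = 0 := by
      have h1 : ∀ p ∈ Y, evalHom p g = 0 := by
        intro p hp
        by_cases hp0 : p = 0
        · rw [hp0]; exact evalHom_zero_of_mem hg
        · have h2 := hval p hp
          rw [hf0, map_zero, zero_add] at h2
          exact (mul_eq_zero.1 h2).resolve_left (hℓY p hp hp0)
      refine eq_zero_of_weightInt_sq hα hβ s ?_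
      rw [h _ (degLT_mono (by omega) (mul_mem_degLT hgd hgd))]
      refine Finset.sum_eq_zero fun p hp => ?_
      rw [map_mul, h1 p hp, mul_zero, mul_zero]
    simp only [hf0, hg0]
    rfl
  have h1 := LinearMap.finrank_le_finrank_of_injective hinj
  rw [Module.finrank_prod, finrank_monoSpan, finrank_monoSpan, Module.finrank_fintype_fun_eq_card,
    Fintype.card_coe, Finset.card_erase_of_mem, card_evenExp] at h1
  · omega
  · exact Finset.mem_biUnion.2 ⟨0, by simp, by simp⟩

/-! ### The cubature rule -/

/-- The integral is a combination of the values at the common zeros, for all polynomials of degree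
at most `4m + 1`: those that vanish at the common zeros belong to the ideal and have integral
zero. -/
theorem exists_weights {D : Finset (ℝ × ℝ)} (hD : (D : Set (ℝ × ℝ)) = commonZeros α β s m)
    (hDc : D.card + 1 = 2 * (m + 1) ^ 2) :
    ∃ lam : ℝ × ℝ → ℝ, ∀ f ∈ degLT (4 * m + 2),
      weightInt hα hβ s f = ∑ p ∈ D, lam p * evalHom p f := by
  classical
  have hsurj := evalCompl_surjective hα hβ s m hD.subset
  have hinj : Function.Injective (evalCompl m D) := by
    refine (LinearMap.injective_iff_surjective_of_finrank_eq_finrank ?_).2 hsurj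
    have h1 := LinearMap.finrank_le_finrank_of_surjective hsurj
    have h2 := finrank_compl_add_one_le m
    rw [Module.finrank_fintype_fun_eq_card, Fintype.card_coe] at h1 ⊢
    omega
  let V := degLT (4 * m + 2)
  let L : D → V →ₗ[ℝ] ℝ := fun p => (evalHom p.1).toLinearMap.domRestrict V
  have hker : ⨅ p, LinearMap.ker (L p) ≤ LinearMap.ker ((weightInt hα hβ s).domRestrict V) := by
    rintro ⟨f, hf⟩ hfL
    rw [Submodule.mem_iInf] at hfL
    have hval : ∀ p : D, evalHom p.1 f = 0 := hfL
    obtain ⟨c, hc, k, hk, hck⟩ := Submodule.mem_sup.1 (degLT_le_compl_sup_idealLE s hα hβ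
      (topNonzero hα hβ s m) (2 * m) (4 * m + 1) (by omega) hf)
    have hc0 : (⟨c, hc⟩ : compl m) = 0 := by
      refine hinj ?_
      rw [map_zero]
      funext p
      have h1 := hval p
      rw [← hck, map_add, evalHom_idealLE s m hk (hD ▸ p.2), add_zero] at h1
      exact h1
    have hc1 : c = 0 := congrArg Subtype.val hc0
    rw [hc1, zero_add] at hck
    rw [LinearMap.mem_ker, LinearMap.domRestrict_apply]
    exact weightInt_idealLE hα hβ s m (hck ▸ hk)
  obtain ⟨c, hc⟩ := Submodule.mem_span_range_iff_exists_fun ℝ |>.1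
    (mem_span_of_iInf_ker_le_ker hker)
  refine ⟨fun p => if hp : p ∈ D then c ⟨p, hp⟩ else 0, fun f hf => ?_⟩
  have h1 := LinearMap.congr_fun hc ⟨f, hf⟩
  rw [LinearMap.domRestrict_apply] at h1
  rw [← h1, LinearMap.sum_apply, ← Finset.sum_coe_sort D]
  refine Finset.sum_congr rfl fun p _ => ?_
  simp only [dif_pos p.2]
  rfl

theorem Nmin_eq (m : ℕ) : Nmin (2 * m + 1) + 1 = 2 * (m + 1) ^ 2 := by
  have h1 : (2 * m + 1) * (2 * m + 1 + 1) / 2 = (2 * m + 1) * (m + 1) := by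
    rw [show (2 * m + 1) * (2 * m + 1 + 1) = (2 * m + 1) * (m + 1) * 2 by ring]
    exact Nat.mul_div_cancel _ two_pos
  have h2 : (2 * m + 1) / 2 = m := by omega
  rw [Nmin, h1, h2]
  ring

include hα hβ in
/-- The common zeros are the nodes of a minimal cubature rule. The weights do not vanish, since a
rule with fewer nodes would contradict the lower bound, and the rule is not exact on the square of a
generator. -/
theorem exists_isMinimalCubatureRule {D : Finset (ℝ × ℝ)}
    (hD : (D : Set (ℝ × ℝ)) = commonZeros α β s m) (hDc : D.card + 1 = 2 * (m + 1) ^ 2) :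
    ∃ lam : ℝ × ℝ → ℝ, IsMinimalCubatureRule (weight α β s) (4 * m + 1) D lam := by
  classical
  obtain ⟨lam, hlam⟩ := exists_weights hα hβ s m hD hDc
  refine ⟨lam, ⟨?_, ?_, ?_, ?_⟩, ?_⟩
  · intro p hp h0
    have h1 := lower_bound hα hβ s m (Y := D.erase p) (lam := lam) fun f hf => by
      rw [hlam f hf, ← Finset.add_sum_erase D _ hp, h0, zero_mul, zero_add]
    rw [Finset.card_erase_add_one hp] at h1
    omega
  · exact fun f _ => integrableOn_evalAt_mul hα hβ s f
  · intro f hf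
    have := hlam f (mem_degLT_of_totalDegree_lt (by omega))
    simpa only [weightInt_apply, evalAt_eq] using this
  · set P := generators α β s m 0 with hP
    have hPdeg := (isOrthogonalPoly_generators hα hβ s m 0).1
    refine ⟨P * P, ?_, fun h => ?_⟩
    · refine (MvPolynomial.totalDegree_mul _ _).trans ?_
      rw [hPdeg]
      omega
    · refine (linearIndependent_generators hα hβ s m).ne_zero 0
        (eq_zero_of_weightInt_sq hα hβ s (f := P) ?_)
      rw [weightInt_apply, h]
      refine Finset.sum_eq_zero fun p hp => ?_
      have hp0 : evalAt p P = 0 := (hD ▸ Finset.mem_coe.2 hp : p ∈ commonZeros α β s m) 0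
      rw [evalAt_eq] at hp0
      rw [evalAt_eq, map_mul, hp0, mul_zero, mul_zero]
  · intro Y mu hY
    have h1 := lower_bound hα hβ s m (Y := Y) (lam := mu) fun f hf => by
      have h2 := hY.exact_of_le f (Nat.lt_succ_iff.1 (totalDegree_lt_of_mem_degLT hf))
      simp only [evalAt_eq] at h2
      simpa only [weightInt_apply, evalAt_eq] using h2
    omega

end

end MinCuba

theorem mainTheorem1 (α β : ℝ) (hα : -1 < α) (hβ : -1 < β) (s : MinCuba.Sgn) (m : ℕ) :
    (∀ i, MinCuba.IsOrthogonalPoly (MinCuba.weight α β s) (2 * m + 1)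
      (MinCuba.generators α β s m i)) ∧
    LinearIndependent ℝ (MinCuba.generators α β s m) ∧
    MinCuba.commonZeros α β s m =
      MinCuba.offDiagonalNodes α β s m ∪ MinCuba.diagonalNodes α β s m ∧
    ∃ (nodes : Finset (ℝ × ℝ)) (lam : ℝ × ℝ → ℝ),
      MinCuba.IsMinimalCubatureRule (MinCuba.weight α β s) (4 * m + 1) nodes lam ∧
      (nodes : Set (ℝ × ℝ)) = MinCuba.commonZeros α β s m ∧
      nodes.card = MinCuba.Nmin (2 * m + 1) ∧
      MinCuba.Nmin (2 * m + 1) = 2 * (m + 1) ^ 2 - 1 := by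
  obtain ⟨D, hD, hDc, hunion⟩ := MinCuba.exists_finset_eq_commonZeros hα hβ s m
  obtain ⟨lam, hlam⟩ := MinCuba.exists_isMinimalCubatureRule hα hβ s m hD hDc
  have hN := MinCuba.Nmin_eq m
  exact ⟨MinCuba.isOrthogonalPoly_generators hα hβ s m,
    MinCuba.linearIndependent_generators hα hβ s m, hunion, D, lam, hlam, hD, by omega, by omega⟩
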